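/- Let $k\ge 0$, let $dm_k(x)=|\sin x|^{2k}\,dx$ on $[-\pi,\pi]$, and let $(f,g)_k=\int_{-\pi}^{\pi} f\,\overline{g}\,dm_k$. For $j,n\in\mathbb Z$ write $j\triangleleft n$ if either $|j|<|n|$ and $|n|-|j|$ is even, or $|j|=|n|$ and $n<j$. The non-symmetric Heckman–Opdam polynomial $E_n^k$ $(n\in\mathbb Z)$ of type $A_1$ is the unique function of the form $E_n^k(z)=e^{nz}+\sum_{j\triangleleft n}c_{n,j}e^{jz}$ such that $(E_n^k(ix),e^{ijx})_k=0$ for all $j\triangleleft n$. Put $\gamma_n=\|E_n^k(i\,\cdot)\|_{L^2(dm_k)}^{-1}$ and, for $g\in L^1(dm_k)$, $$a_n(g)=\gamma_n^2\int_{-\pi}^{\pi} g(x)E_n^k(-ix)\,dm_k(x),\qquad S_N(g)(x)=\sum_{n=-N}^{N}a_n(g)E_n^k(ix).$$ Let $1\le p\le\infty$ with $p\notin\left(2-\frac1{k+1},\,2+\frac1k\right)$ (where $1/0=\infty$). Then: 1. Norm convergence fails in $L^p(dm_k)$: there is $g\in L^p([-\pi,\pi],dm_k)$ such that $\|S_N(g)-g\|_{L^p(dm_k)}$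 does not tend to $0$ as $N\to\infty$. Moreover there is no constant $C$ with $\|S_N(g)\|_{L^p(dm_k)}\le C\|g\|_{L^p(dm_k)}$ for all $N\ge 0$ and all $g\in L^p(dm_k)$. 2. Suppose $k>0$ and let $f(x)=(1-\cos x)^{-(k+1)/2}$. Then the integrals defining all $a_n=a_n(f)$ converge absolutely, and there is a constant $A>0$ (depending on $k$ and $p$) such that $$\left\|a_nE_n^k(i\,\cdot)+a_{-n}E_{-n}^k(i\,\cdot)\right\|_{L^p(dm_k)}\ge A\qquad\text{for all } n\ge1;$$ in particular these terms do not tend to $0$ in $L^p(dm_k)$. Moreover $f\in L^p(dm_k)$ if and only if $p<2-\frac1{k+1}$, and in that case $S_N(f)$ does not converge to $f$ in $L^p(dm_k)$. -/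

import Mathlib

open MeasureTheory Filter Topology
open scoped ENNReal NNReal

noncomputable section

namespace HeckmanOpdam

/-- The measure `dm_k(x) = |sin x|^{2k} dx` on `[-π, π]`. -/
def dm (k : ℝ) : Measure ℝ :=
  (volume.restrict (Set.Icc (-Real.pi) Real.pi)).withDensity
    (fun x => ENNReal.ofReal (|Real.sin x| ^ (2 * k)))

/-- The inner product `(f, g)_k = ∫ f conj(g) dm_k`. -/
def innerK (k : ℝ) (f g : ℝ → ℂ) : ℂ :=
  ∫ x, f x * (starRingEnd ℂ) (g x) ∂(dm k)

/-- The partial order `j ◁ n` on `ℤ`. -/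
def Below (j n : ℤ) : Prop :=
  (|j| < |n| ∧ Even (|n| - |j|)) ∨ (|j| = |n| ∧ n < j)

open scoped Classical in
/-- The finite set of all `j` with `j ◁ n`. -/
def lower (n : ℤ) : Finset ℤ := (Finset.Icc (-|n|) |n|).filter (fun j => Below j n)

theorem mem_lower {j n : ℤ} : j ∈ lower n ↔ Below j n := by
  classical
  simp only [lower, Finset.mem_filter, Finset.mem_Icc, and_iff_right_iff_imp]
  rintro (h | h)
  · exact abs_le.mp h.1.le
  · exact abs_le.mp h.1.le

/-- The two conditions characterizing the non-symmetric Heckman–Opdam polynomial `E_n^k`: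
triangularity with respect to `◁`, and orthogonality to `e^{ijx}` for `j ◁ n`. -/
structure IsNonsymmetric (k : ℝ) (n : ℤ) (E : ℂ → ℂ) : Prop where
  triangular : ∃ c : ℤ → ℂ, ∀ z : ℂ,
    E z = Complex.exp (n * z) + ∑ j ∈ lower n, c j * Complex.exp (j * z)
  orthogonal : ∀ j : ℤ, Below j n →
    innerK k (fun x => E (Complex.I * x)) (fun x => Complex.exp (Complex.I * (j * x))) = 0

/-- The non-symmetric Heckman–Opdam polynomial `E_n^k` of type `A₁`: the function with the two
characterizing properties (it exists and is unique for `k ≥ 0`, see `existsUnique_nonsymmetric`). -/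
def E (k : ℝ) (n : ℤ) : ℂ → ℂ := Classical.epsilon (IsNonsymmetric k n)

/-! Existence and uniqueness of `E_n^k`. -/

theorem isFiniteMeasure_dm {k : ℝ} (hk : 0 ≤ k) : IsFiniteMeasure (dm k) := by
  refine isFiniteMeasure_withDensity (ne_of_lt ?_)
  calc ∫⁻ x in Set.Icc (-Real.pi) Real.pi, ENNReal.ofReal (|Real.sin x| ^ (2 * k))
      ≤ ∫⁻ _x in Set.Icc (-Real.pi) Real.pi, 1 := by
        refine lintegral_mono fun x => ?_
        rw [← ENNReal.ofReal_one]
        exact ENNReal.ofReal_le_ofReal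
          (Real.rpow_le_one (abs_nonneg _) (Real.abs_sin_le_one x) (by positivity))
    _ < ⊤ := by simp

theorem ae_of_ae_dm {k : ℝ} {P : ℝ → Prop} (h : ∀ᵐ x ∂(dm k), P x) :
    ∀ᵐ x ∂(volume.restrict (Set.Icc (-Real.pi) Real.pi)), P x := by
  have hm : Measurable (fun x : ℝ => ENNReal.ofReal (|Real.sin x| ^ (2 * k))) := by fun_prop
  rw [dm, ae_withDensity_iff hm] at h
  have h0 : ∀ᵐ x ∂(volume : Measure ℝ), Real.sin x ≠ 0 := by
    have hc : ({x : ℝ | Real.sin x = 0}).Countable := by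
      refine (Set.countable_range (fun m : ℤ => (m : ℝ) * Real.pi)).mono ?_
      intro x hx
      exact Real.sin_eq_zero_iff.mp hx
    simpa [ae_iff] using hc.measure_zero volume
  filter_upwards [h, ae_restrict_of_ae h0] with x hx hx0
  apply hx
  have : 0 < |Real.sin x| ^ (2 * k) := Real.rpow_pos_of_pos (abs_pos.mpr hx0) _
  simpa using this

theorem integrable_dm {k : ℝ} (hk : 0 ≤ k) {f : ℝ → ℂ} (hf : Continuous f) :
    Integrable f (dm k) := by
  have := isFiniteMeasure_dm hk
  obtain ⟨C, hC⟩ := (isCompact_Icc (a := -Real.pi) (b := Real.pi)).exists_bound_of_continuousOn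
    hf.continuousOn
  refine Integrable.of_bound hf.aestronglyMeasurable C ?_
  refine (withDensity_absolutelyContinuous _ _).ae_le ?_
  exact (ae_restrict_iff' measurableSet_Icc).mpr (Eventually.of_forall hC)

theorem integral_exp_int (m : ℤ) :
    ∫ x in Set.Icc (-Real.pi) Real.pi, Complex.exp (Complex.I * (m * x))
      = if m = 0 then (2 * Real.pi : ℂ) else 0 := by
  rw [integral_Icc_eq_integral_Ioc,
    ← intervalIntegral.integral_of_le (by linarith [Real.pi_pos])]
  split_ifs with h
  · subst h
    simp
    ring
  · have hm : Complex.I * (m : ℂ) ≠ 0 :=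
      mul_ne_zero Complex.I_ne_zero (by exact_mod_cast h)
    simp_rw [← mul_assoc]
    rw [integral_exp_mul_complex hm]
    have : Complex.exp (Complex.I * m * (Real.pi : ℝ))
        = Complex.exp (Complex.I * m * ((-Real.pi : ℝ) : ℂ)) := by
      rw [Complex.exp_eq_exp_iff_exists_int]
      exact ⟨m, by push_cast; ring⟩
    rw [this]
    simp

/-- The trigonometric polynomial with the coefficients `c` on the exponents in `lower n`. -/
def trig (n : ℤ) (c : lower n → ℂ) (x : ℝ) : ℂ :=
  ∑ j, c j * Complex.exp (Complex.I * ((j : ℤ) * x))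

theorem continuous_trig (n : ℤ) (c : lower n → ℂ) : Continuous (trig n c) := by
  unfold trig
  fun_prop

theorem conj_exp (j : ℤ) (x : ℝ) :
    (starRingEnd ℂ) (Complex.exp (Complex.I * (j * x)))
      = Complex.exp (Complex.I * ((-j : ℤ) * x)) := by
  rw [← Complex.exp_conj]
  simp

theorem trig_eq_zero {k : ℝ} (hk : 0 ≤ k) {n : ℤ} {c : lower n → ℂ}
    (h : ∀ l : lower n,
      innerK k (trig n c) (fun x => Complex.exp (Complex.I * ((l : ℤ) * x))) = 0) : c = 0 := by
  have hT := continuous_trig n c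
  have h1 : ∫ x, trig n c x * (starRingEnd ℂ) (trig n c x) ∂(dm k) = 0 := by
    have : ∀ x, trig n c x * (starRingEnd ℂ) (trig n c x)
        = ∑ l, (starRingEnd ℂ) (c l) * (trig n c x *
          (starRingEnd ℂ) (Complex.exp (Complex.I * ((l : ℤ) * x)))) := by
      intro x
      conv_lhs => rw [show (starRingEnd ℂ) (trig n c x) = ∑ l, (starRingEnd ℂ) (c l) *
        (starRingEnd ℂ) (Complex.exp (Complex.I * ((l : ℤ) * x))) by
          simp only [trig, map_sum, map_mul]]
      rw [Finset.mul_sum]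
      exact Finset.sum_congr rfl fun l _ => by ring
    simp_rw [this]
    rw [integral_finsetSum]
    · refine Finset.sum_eq_zero fun l _ => ?_
      rw [integral_const_mul]
      have := h l
      rw [innerK] at this
      rw [this, mul_zero]
    · intro l _
      refine (integrable_dm hk ?_)
      simp_rw [conj_exp]
      fun_prop
  have h2 : ∫ x, ‖trig n c x‖ ^ 2 ∂(dm k) = 0 := by
    have h3 : ((∫ x, ‖trig n c x‖ ^ 2 ∂(dm k) : ℝ) : ℂ) = 0 := by
      rw [← integral_complex_ofReal, ← h1]
      refine integral_congr_ae (Eventually.of_forall fun x => ?_)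
      simp [Complex.mul_conj']
    exact_mod_cast h3
  have hint : Integrable (fun x => ‖trig n c x‖ ^ 2) (dm k) := by
    have := (integrable_dm hk (f := fun x => trig n c x ^ 2) (by fun_prop)).norm
    simpa using this
  rw [integral_eq_zero_iff_of_nonneg (fun x => by positivity) hint] at h2
  have h4 : ∀ᵐ x ∂(volume.restrict (Set.Icc (-Real.pi) Real.pi)), trig n c x = 0 := by
    refine ae_of_ae_dm (k := k) ?_
    filter_upwards [h2] with x hx
    simpa using hx
  funext l
  have h5 : ∫ x in Set.Icc (-Real.pi) Real.pi,
      trig n c x * Complex.exp (Complex.I * ((-(l : ℤ) : ℤ) * x)) = 0 := by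
    refine integral_eq_zero_of_ae ?_
    filter_upwards [h4] with x hx
    simp [hx]
  have h6 : ∀ x : ℝ, trig n c x * Complex.exp (Complex.I * ((-(l : ℤ) : ℤ) * x))
      = ∑ j, c j * Complex.exp (Complex.I * (((j : ℤ) - (l : ℤ) : ℤ) * x)) := by
    intro x
    rw [trig, Finset.sum_mul]
    refine Finset.sum_congr rfl fun j _ => ?_
    rw [mul_assoc, ← Complex.exp_add]
    congr 2
    push_cast
    ring
  simp_rw [h6] at h5
  rw [integral_finsetSum] at h5
  · simp_rw [integral_const_mul, integral_exp_int] at h5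
    rw [Finset.sum_eq_single l] at h5
    · simpa [Real.pi_ne_zero] using h5
    · intro j _ hj
      rw [if_neg, mul_zero]
      rw [sub_eq_zero]
      exact fun hh => hj (Subtype.ext hh)
    · simp
  · intro j _
    exact (Continuous.integrableOn_Icc (by fun_prop))

theorem exp_I (j : ℤ) (x : ℝ) :
    Complex.exp (j * (Complex.I * x)) = Complex.exp (Complex.I * (j * x)) := by
  congr 1; ring

theorem innerK_add {k : ℝ} (hk : 0 ≤ k) {f g : ℝ → ℂ} (hf : Continuous f) (hg : Continuous g)
    (l : ℤ) :
    innerK k (fun x => f x + g x) (fun x => Complex.exp (Complex.I * (l * x)))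
      = innerK k f (fun x => Complex.exp (Complex.I * (l * x)))
        + innerK k g (fun x => Complex.exp (Complex.I * (l * x))) := by
  simp only [innerK, conj_exp, add_mul]
  exact integral_add (integrable_dm hk (by fun_prop)) (integrable_dm hk (by fun_prop))

theorem existsUnique_nonsymmetric {k : ℝ} (hk : 0 ≤ k) (n : ℤ) :
    ∃! F : ℂ → ℂ, IsNonsymmetric k n F := by
  classical
  have hsum : ∀ (c : ℤ → ℂ) (x : ℝ),
      ∑ j ∈ lower n, c j * Complex.exp (j * (Complex.I * x))
        = trig n (fun j => c j) x := by
    intro c x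
    rw [trig, Finset.sum_coe_sort (lower n)
      (fun j => c j * Complex.exp (Complex.I * (j * x)))]
    exact Finset.sum_congr rfl fun j _ => by rw [exp_I]
  have hshape : ∀ (c : ℤ → ℂ) (l : ℤ),
      innerK k (fun x : ℝ => Complex.exp (n * (Complex.I * x))
          + ∑ j ∈ lower n, c j * Complex.exp (j * (Complex.I * x)))
          (fun x => Complex.exp (Complex.I * (l * x)))
        = innerK k (fun x : ℝ => Complex.exp (n * (Complex.I * x)))
            (fun x => Complex.exp (Complex.I * (l * x)))
          + innerK k (trig n (fun j => c j)) (fun x => Complex.exp (Complex.I * (l * x))) := by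
    intro c l
    simp_rw [hsum]
    exact innerK_add hk (by fun_prop) (continuous_trig n _) l
  let G : (lower n → ℂ) →ₗ[ℂ] (lower n → ℂ) :=
    { toFun := fun c l => innerK k (trig n c) (fun x => Complex.exp (Complex.I * ((l : ℤ) * x)))
      map_add' := by
        intro c d
        funext l
        have : trig n (c + d) = fun x => trig n c x + trig n d x := by
          funext x
          simp [trig, add_mul, Finset.sum_add_distrib]
        rw [this]
        exact innerK_add hk (continuous_trig n c) (continuous_trig n d) l
      map_smul' := by
        intro a c
        funext l
        have : ∀ x, trig n (a • c) x = a * trig n c x := by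
          intro x
          simp [trig, Finset.mul_sum, mul_assoc]
        simp only [innerK, this, mul_assoc, integral_const_mul, RingHom.id_apply, Pi.smul_apply,
          smul_eq_mul] }
  have hGinj : Function.Injective G := by
    rw [← LinearMap.ker_eq_bot, LinearMap.ker_eq_bot']
    intro c hc
    exact trig_eq_zero hk fun l => congrFun hc l
  have hGsurj : Function.Surjective G := LinearMap.injective_iff_surjective.mp hGinj
  obtain ⟨c, hc⟩ := hGsurj fun l =>
    -innerK k (fun x : ℝ => Complex.exp (n * (Complex.I * x)))
      (fun x => Complex.exp (Complex.I * ((l : ℤ) * x)))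
  let c' : ℤ → ℂ := fun j => if h : j ∈ lower n then c ⟨j, h⟩ else 0
  have hc' : (fun j : lower n => c' j) = c := by
    funext j
    simp [c']
  refine ⟨fun z => Complex.exp (n * z) + ∑ j ∈ lower n, c' j * Complex.exp (j * z),
    ⟨⟨c', fun z => rfl⟩, ?_⟩, ?_⟩
  · intro l hl
    have := congrFun hc ⟨l, mem_lower.mpr hl⟩
    rw [hshape, hc']
    change innerK k (trig n c) _ = _ at this
    rw [this]
    exact add_neg_cancel _
  · rintro F ⟨⟨d, hd⟩, ho⟩
    have hdc : (fun j : lower n => d j) = c := by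
      apply hGinj
      rw [hc]
      funext l
      have := ho l (mem_lower.mp l.2)
      simp_rw [hd] at this
      rw [hshape] at this
      exact eq_neg_of_add_eq_zero_right this
    funext z
    rw [hd]
    congr 1
    refine Finset.sum_congr rfl fun j hj => ?_
    have h1 := congrFun (hdc.trans hc'.symm) ⟨j, hj⟩
    have h2 : d j = c' j := h1
    rw [h2]

theorem isNonsymmetric_E {k : ℝ} (hk : 0 ≤ k) (n : ℤ) : IsNonsymmetric k n (E k n) :=
  Classical.epsilon_spec (existsUnique_nonsymmetric hk n).exists

/-- `γ_n = ‖E_n^k‖_{2,k}⁻¹`, with the norm of `x ↦ E_n^k(ix)` in `L²(dm_k)`. -/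
def gam (k : ℝ) (n : ℤ) : ℝ := (√(∫ x : ℝ, ‖E k n (Complex.I * x)‖ ^ 2 ∂(dm k)))⁻¹

/-- The Fourier–Heckman–Opdam coefficient `a_n = γ_n² ∫ g(x) E_n^k(-ix) dm_k(x)`. -/
def coeff (k : ℝ) (g : ℝ → ℂ) (n : ℤ) : ℂ :=
  (gam k n : ℂ) ^ 2 * ∫ x : ℝ, g x * E k n (-(Complex.I * x)) ∂(dm k)

/-- The term `a_n E_n^k(ix)` of the Fourier–Heckman–Opdam series of `g`. -/
def term (k : ℝ) (g : ℝ → ℂ) (n : ℤ) (x : ℝ) : ℂ := coeff k g n * E k n (Complex.I * x)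

/-- The partial sum `S_N(g)(x) = ∑_{n=-N}^{N} a_n E_n^k(ix)`. -/
def partialSum (k : ℝ) (g : ℝ → ℂ) (N : ℕ) (x : ℝ) : ℂ :=
  ∑ n ∈ Finset.Icc (-(N : ℤ)) (N : ℤ), term k g n x

/-- The function `f(x) = (1 - cos x)^{-(k+1)/2}`. -/
def cex (k : ℝ) (x : ℝ) : ℂ := (((1 - Real.cos x) ^ (-(k + 1) / 2) : ℝ) : ℂ)

end HeckmanOpdam

end

namespace HeckmanOpdam

/-! Suppose first that k > 0. For n ≥ 1 the functions E_{±n}^k(ix) are combinations of φ_n(x) =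
p_n(cos x) and ψ_n = φ_n', where p_n is the Gegenbauer polynomial with p_n(1) = 1. On an even
function g the ψ_n parts of the terms of index n and -n cancel, and the two terms add up to the
orthogonal projection (∫ g φ_n dm_k / ‖φ_n‖₂²) φ_n (`term_add_term_neg`). Only norms of φ_n are then
needed.

Put N = n + k and q = 2 + 1/k, whose conjugate exponent is q' = 2 - 1/(k+1). Three estimates carry
the proof: ‖φ_n‖₂² ≲ N^{-2k} (`phiSq_le`), ‖φ_n‖₁ ≳ N^{-k} (`exists_le_integral_abs_phi`), and N^k
‖φ_n‖_q → ∞, with a logarithmic divergence (`tendsto_integral_abs_phi_rpow`). They come from the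
differential equation: u = sin^k · φ_n satisfies u'' + (N² + k(1-k)/sin²) u = 0, and its energy u'²
+ N²u² stays comparable to N^{2-2k} on [1/(2N), π/2] (`exists_energy_bounds`). An integration by
parts turns this into lower bounds for weighted integrals of u² (`exists_uf_mass`).

If all S_N were bounded by C on L^p, the projections on φ_n would be bounded by 2C on even
functions. Testing on the sign of φ_n when p ≥ q, and on |φ_n|^{q-2} φ_n when p ≤ q', would bound
‖φ_n‖₁ ‖φ_n‖_q / ‖φ_n‖₂², which is impossible. By Banach–Steinhaus, convergence for every g would
give such a C, so some g fails.

For f = (1 - cos x)^{-(k+1)/2} the moments ∫ f φ_n dm_k obey an explicit two-term recurrence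
(`cexMoment_succ`), hence are ≳ N^{-k}. The L^p norm of the n-th pair of terms is then at least a
constant times N^{-k} ‖φ_n‖₁ / ‖φ_n‖₂² ≳ 1.

For k = 0 the series is the classical Fourier series and p is 1 or ∞. The modulated sawtooth x
e^{iNx} makes S_N grow logarithmically at π, which settles p = ∞; the symmetry of S_N transfers this
to p = 1. -/

/-! ### Normalised Gegenbauer polynomials: recurrences and differential equation -/

/-- The Gegenbauer polynomials for the weight `(1 - t²)^{k - 1/2}`, normalised by `p_n(1) = 1`. -/
noncomputable def geg (k : ℝ) : ℕ → Polynomial ℝ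
  | 0 => 1
  | 1 => Polynomial.X
  | (n + 2) => Polynomial.C (1 / (n + 1 + 2 * k)) *
      (Polynomial.C (2 * (n + 1 + k)) * Polynomial.X * geg k (n + 1)
        - Polynomial.C ((n : ℝ) + 1) * geg k n)

/-- The value of the normalised Gegenbauer polynomial. -/
noncomputable def gv (k : ℝ) (n : ℕ) (t : ℝ) : ℝ := (geg k n).eval t

/-- The first derivative of the normalised Gegenbauer polynomial. -/
noncomputable def gd (k : ℝ) (n : ℕ) (t : ℝ) : ℝ := (geg k n).derivative.eval t

/-- The second derivative of the normalised Gegenbauer polynomial. -/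
noncomputable def gdd (k : ℝ) (n : ℕ) (t : ℝ) : ℝ := (geg k n).derivative.derivative.eval t

theorem hasDerivAt_gv (k : ℝ) (n : ℕ) (t : ℝ) : HasDerivAt (gv k n) (gd k n t) t :=
  (geg k n).hasDerivAt t

theorem hasDerivAt_gd (k : ℝ) (n : ℕ) (t : ℝ) : HasDerivAt (gd k n) (gdd k n t) t :=
  (geg k n).derivative.hasDerivAt t

@[fun_prop]
theorem continuous_gv (k : ℝ) (n : ℕ) : Continuous (gv k n) := (geg k n).continuous

@[fun_prop]
theorem continuous_gd (k : ℝ) (n : ℕ) : Continuous (gd k n) := (geg k n).derivative.continuous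

@[fun_prop]
theorem continuous_gdd (k : ℝ) (n : ℕ) : Continuous (gdd k n) :=
  (geg k n).derivative.derivative.continuous

@[simp] theorem gv_zero (k t : ℝ) : gv k 0 t = 1 := by simp [gv, geg]
@[simp] theorem gv_one (k t : ℝ) : gv k 1 t = t := by simp [gv, geg]
@[simp] theorem gd_zero (k t : ℝ) : gd k 0 t = 0 := by simp [gd, geg]
@[simp] theorem gd_one (k t : ℝ) : gd k 1 t = 1 := by simp [gd, geg]
@[simp] theorem gdd_zero (k t : ℝ) : gdd k 0 t = 0 := by simp [gdd, geg]

theorem gv_rec {k : ℝ} (hk : 0 ≤ k) (n : ℕ) (t : ℝ) :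
    (n + 1 + 2 * k) * gv k (n + 2) t
      = 2 * (n + 1 + k) * t * gv k (n + 1) t - (n + 1) * gv k n t := by
  have h : (n : ℝ) + 1 + 2 * k ≠ 0 := by positivity
  simp only [gv, geg, Polynomial.eval_mul, Polynomial.eval_sub, Polynomial.eval_C,
    Polynomial.eval_X]
  field_simp

theorem gd_rec {k : ℝ} (hk : 0 ≤ k) (n : ℕ) (t : ℝ) :
    (n + 1 + 2 * k) * gd k (n + 2) t
      = 2 * (n + 1 + k) * (gv k (n + 1) t + t * gd k (n + 1) t) - (n + 1) * gd k n t := by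
  have h : (n : ℝ) + 1 + 2 * k ≠ 0 := by positivity
  simp only [gd, gv, geg, Polynomial.derivative_mul, Polynomial.derivative_sub,
    Polynomial.derivative_C, Polynomial.derivative_X, Polynomial.eval_mul, Polynomial.eval_sub,
    Polynomial.eval_C, Polynomial.eval_X, Polynomial.eval_add, Polynomial.eval_zero,
    Polynomial.eval_one]
  field_simp
  ring

theorem gv_eval_one {k : ℝ} (hk : 0 ≤ k) (n : ℕ) : gv k n 1 = 1 := by
  induction n using Nat.twoStepInduction with
  | zero => simp
  | one => simp
  | more n h0 h1 =>
    have h : (n : ℝ) + 1 + 2 * k ≠ 0 := by positivity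
    have := gv_rec hk n 1
    rw [h0, h1] at this
    apply mul_left_cancel₀ h
    linarith

theorem gv_neg {k : ℝ} (hk : 0 ≤ k) (n : ℕ) (t : ℝ) : gv k n (-t) = (-1) ^ n * gv k n t := by
  induction n using Nat.twoStepInduction with
  | zero => simp
  | one => simp
  | more n h0 h1 =>
    have h : (n : ℝ) + 1 + 2 * k ≠ 0 := by positivity
    have e1 := gv_rec hk n t
    have e2 := gv_rec hk n (-t)
    rw [h0, h1] at e2
    apply mul_left_cancel₀ h
    linear_combination e2 - (-1) ^ n * e1

/-- The two identities are proved together because each inductive step needs both: combining them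
gives the formula for (1 - t²) p'_{n+1}, the differentiated three-term recurrence minus the second
gives the next first identity, and the next second one follows from these. Positivity of k allows
division by 2k + n at n = 0. -/
theorem gd_succ_and {k : ℝ} (hk : 0 < k) (n : ℕ) (t : ℝ) :
    (2 * k + n) * gd k (n + 1) t = (n + 1) * (t * gd k n t + (n + 2 * k) * gv k n t) ∧
    (2 * k + n) * (n + 1) * gv k (n + 1) t
      = (2 * k + n) * t * gd k (n + 1) t - (n + 1) * gd k n t := by
  induction n with
  | zero => constructor <;> simp
  | succ n ih =>
    obtain ⟨hA, hB⟩ := ih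
    have h1 := gv_rec hk.le n t
    have h2 := gd_rec hk.le n t
    have h3 : (1 - t ^ 2) * gd k (n + 1) t = (n + 1) * (gv k n t - t * gv k (n + 1) t) := by
      have h : 2 * k + (n : ℝ) ≠ 0 := by positivity
      apply mul_left_cancel₀ h
      linear_combination hA + t * hB
    have hA' : (2 * k + (n + 1 : ℕ)) * gd k (n + 1 + 1) t = ((n + 1 : ℕ) + 1) *
        (t * gd k (n + 1) t + ((n + 1 : ℕ) + 2 * k) * gv k (n + 1) t) := by
      push_cast
      linear_combination h2 - hB
    refine ⟨hA', ?_⟩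
    push_cast at hA' ⊢
    linear_combination (n + 2) * h1 - t * hA' + (n + 2) * h3

theorem gd_succ {k : ℝ} (hk : 0 < k) (n : ℕ) (t : ℝ) :
    (2 * k + n) * gd k (n + 1) t = (n + 1) * (t * gd k n t + (n + 2 * k) * gv k n t) :=
  (gd_succ_and hk n t).1

theorem gv_succ {k : ℝ} (hk : 0 < k) (n : ℕ) (t : ℝ) :
    (2 * k + n) * (n + 1) * gv k (n + 1) t
      = (2 * k + n) * t * gd k (n + 1) t - (n + 1) * gd k n t :=
  (gd_succ_and hk n t).2

theorem one_sub_sq_mul_gd {k : ℝ} (hk : 0 < k) (n : ℕ) (t : ℝ) :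
    (1 - t ^ 2) * gd k (n + 1) t = (n + 1) * (gv k n t - t * gv k (n + 1) t) := by
  have h : 2 * k + (n : ℝ) ≠ 0 := by positivity
  apply mul_left_cancel₀ h
  linear_combination gd_succ hk n t + t * gv_succ hk n t

/-- The factor 1 + t is the one produced by integrating by parts against (1 - cos x)^{-(k+1)/2};
this identity is what closes the recurrence for its moments. -/
theorem one_add_mul_gd {k : ℝ} (hk : 0 < k) (n : ℕ) (t : ℝ) :
    (1 + t) * ((2 * k + n) * gd k (n + 1) t - (n + 1) * gd k n t)
      = (n + 1) * (2 * k + n) * (gv k (n + 1) t + gv k n t) := by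
  linear_combination gd_succ hk n t - gv_succ hk n t

/-- The Gegenbauer differential equation. -/
theorem geg_ode {k : ℝ} (hk : 0 < k) (n : ℕ) (t : ℝ) :
    (1 - t ^ 2) * gdd k n t = (2 * k + 1) * t * gd k n t - n * (n + 2 * k) * gv k n t := by
  cases n with
  | zero => simp
  | succ n =>
    have h1 : HasDerivAt (fun t => (1 - t ^ 2) * gd k (n + 1) t)
        (-(2 * t) * gd k (n + 1) t + (1 - t ^ 2) * gdd k (n + 1) t) t := by
      refine (((hasDerivAt_pow 2 t).const_sub 1).mul (hasDerivAt_gd k (n + 1) t)).congr_deriv ?_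
      simp
    have h2 : HasDerivAt (fun t => (1 - t ^ 2) * gd k (n + 1) t)
        ((n + 1) * (gd k n t - (1 * gv k (n + 1) t + t * gd k (n + 1) t))) t := by
      simp_rw [one_sub_sq_mul_gd hk n]
      exact ((hasDerivAt_gv k n t).sub ((hasDerivAt_id t).mul
        (hasDerivAt_gv k (n + 1) t))).const_mul _
    have h3 := h1.unique h2
    have h4 := gv_succ hk n t
    push_cast
    linear_combination h3 + h4

/-! ### The angular variable: bounds on φ_n and ψ_n near 0 -/

/-- The Gegenbauer polynomial in the angular variable. -/
noncomputable def phi (k : ℝ) (n : ℕ) (x : ℝ) : ℝ := gv k n (Real.cos x)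

/-- The derivative of `phi`. -/
noncomputable def psi (k : ℝ) (n : ℕ) (x : ℝ) : ℝ := -Real.sin x * gd k n (Real.cos x)

@[fun_prop]
theorem continuous_phi (k : ℝ) (n : ℕ) : Continuous (phi k n) := by
  unfold phi; fun_prop

@[fun_prop]
theorem continuous_psi (k : ℝ) (n : ℕ) : Continuous (psi k n) := by
  unfold psi; fun_prop

theorem hasDerivAt_phi (k : ℝ) (n : ℕ) (x : ℝ) : HasDerivAt (phi k n) (psi k n x) x := by
  refine ((hasDerivAt_gv k n (Real.cos x)).comp x (Real.hasDerivAt_cos x)).congr_deriv ?_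
  rw [psi, mul_comm]

theorem hasDerivAt_psi {k : ℝ} (hk : 0 < k) (n : ℕ) (x : ℝ) :
    HasDerivAt (psi k n)
      (2 * k * Real.cos x * gd k n (Real.cos x) - n * (n + 2 * k) * phi k n x) x := by
  refine ((Real.hasDerivAt_sin x).neg.mul
    ((hasDerivAt_gd k n (Real.cos x)).comp x (Real.hasDerivAt_cos x))).congr_deriv ?_
  have h := geg_ode hk n (Real.cos x)
  have h2 := Real.sin_sq_add_cos_sq x
  simp only [phi, Pi.neg_apply, Function.comp]
  linear_combination h + gdd k n (Real.cos x) * h2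

/-- A Sonin-type argument: by the differential equation the left side has derivative -4k sin · cos ·
p_n'(cos)², so it decreases on [0, π/2] from its value at 0, where ψ_n = 0 and φ_n = 1. -/
theorem psi_sq_add_le {k : ℝ} (hk : 0 < k) (n : ℕ) {x : ℝ} (hx : x ∈ Set.Icc 0 (Real.pi / 2)) :
    psi k n x ^ 2 + n * (n + 2 * k) * phi k n x ^ 2 ≤ n * (n + 2 * k) := by
  have hd : ∀ y : ℝ, HasDerivAt
      (fun y => psi k n y ^ 2 + n * (n + 2 * k) * phi k n y ^ 2)
      (-(4 * k * Real.sin y * Real.cos y * gd k n (Real.cos y) ^ 2)) y := by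
    intro y
    refine (((hasDerivAt_psi hk n y).pow 2).add
      (((hasDerivAt_phi k n y).pow 2).const_mul _)).congr_deriv ?_
    simp only [psi]
    push_cast
    ring
  have hanti : AntitoneOn (fun y => psi k n y ^ 2 + n * (n + 2 * k) * phi k n y ^ 2)
      (Set.Icc 0 (Real.pi / 2)) := by
    refine antitoneOn_of_deriv_nonpos (convex_Icc _ _) (by fun_prop)
      (fun y _ => (hd y).differentiableAt.differentiableWithinAt) ?_
    intro y hy
    rw [interior_Icc] at hy
    rw [(hd y).deriv]
    have h1 := Real.sin_nonneg_of_nonneg_of_le_pi hy.1.le (by linarith [hy.2, Real.pi_pos])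
    have h2 := Real.cos_nonneg_of_neg_pi_div_two_le_of_le (by linarith [hy.1, Real.pi_pos]) hy.2.le
    have : 0 ≤ 4 * k * Real.sin y * Real.cos y * gd k n (Real.cos y) ^ 2 := by positivity
    linarith
  have := hanti (Set.left_mem_Icc.mpr (by positivity)) hx hx.1
  simpa [psi, phi, gv_eval_one hk.le] using this

theorem abs_phi_le_one {k : ℝ} (hk : 0 < k) {n : ℕ} (hn : 1 ≤ n) {x : ℝ}
    (hx : x ∈ Set.Icc 0 (Real.pi / 2)) : |phi k n x| ≤ 1 := by
  have h := psi_sq_add_le hk n hx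
  have hn' : (1 : ℝ) ≤ n := by exact_mod_cast hn
  have hl : 0 < (n : ℝ) * (n + 2 * k) := by positivity
  rw [← sq_le_one_iff_abs_le_one]
  by_contra! hc
  nlinarith [sq_nonneg (psi k n x)]

theorem psi_sq_le {k : ℝ} (hk : 0 < k) (n : ℕ) {x : ℝ}
    (hx : x ∈ Set.Icc 0 (Real.pi / 2)) : psi k n x ^ 2 ≤ (n + k) ^ 2 := by
  have h := psi_sq_add_le hk n hx
  have : 0 ≤ (n : ℝ) * (n + 2 * k) * phi k n x ^ 2 := by positivity
  nlinarith [sq_nonneg k]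

/-- The point `1 / (2 (n + k))` below which `phi k n` is at least `1 / 2`. -/
noncomputable def base (k : ℝ) (n : ℕ) : ℝ := 1 / (2 * (n + k))

theorem base_pos {k : ℝ} (hk : 0 < k) (n : ℕ) : 0 < base k n := by
  unfold base; positivity

theorem base_le_half {k : ℝ} (hk : 0 < k) {n : ℕ} (hn : 1 ≤ n) : base k n ≤ 1 / 2 := by
  have hn' : (1 : ℝ) ≤ n := by exact_mod_cast hn
  unfold base
  apply one_div_le_one_div_of_le <;> linarith

theorem base_mem {k : ℝ} (hk : 0 < k) {n : ℕ} (hn : 1 ≤ n) :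
    base k n ∈ Set.Icc 0 (Real.pi / 2) :=
  ⟨(base_pos hk n).le, by linarith [base_le_half hk hn, Real.pi_gt_three]⟩

/-- Since |ψ_n| ≤ n + k, φ_n cannot fall from 1 by more than 1/2 over a length 1/(2(n+k)). -/
theorem half_le_phi {k : ℝ} (hk : 0 < k) {n : ℕ} (hn : 1 ≤ n) :
    1 / 2 ≤ phi k n (base k n) := by
  have hd : ∀ y : ℝ, HasDerivAt (fun y => phi k n y + (n + k) * y) (psi k n y + (n + k)) y := by
    intro y
    refine ((hasDerivAt_phi k n y).add ((hasDerivAt_id y).const_mul ((n : ℝ) + k))).congr_deriv ?_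
    simp
  have hmono : MonotoneOn (fun y => phi k n y + (n + k) * y) (Set.Icc 0 (Real.pi / 2)) := by
    refine monotoneOn_of_deriv_nonneg (convex_Icc _ _) (by fun_prop)
      (fun y _ => (hd y).differentiableAt.differentiableWithinAt) ?_
    intro y hy
    rw [interior_Icc] at hy
    rw [(hd y).deriv]
    have h := psi_sq_le hk n ⟨hy.1.le, hy.2.le⟩
    have := (abs_le_of_sq_le_sq' h (by positivity)).1
    linarith
  have h := hmono (Set.left_mem_Icc.mpr (by positivity)) (base_mem hk hn) (base_mem hk hn).1
  have h2 : ((n : ℝ) + k) * base k n = 1 / 2 := by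
    unfold base; field_simp
  simp only [phi, Real.cos_zero, gv_eval_one hk.le, mul_zero] at h
  simp only [phi]
  linarith

/-! ### Liouville transform and energy estimates -/

/-- The Liouville transform of `phi`. -/
noncomputable def uf (k : ℝ) (n : ℕ) (x : ℝ) : ℝ := Real.sin x ^ k * phi k n x

/-- The derivative of `uf`. -/
noncomputable def vf (k : ℝ) (n : ℕ) (x : ℝ) : ℝ :=
  Real.sin x ^ k * (k * (Real.cos x / Real.sin x) * phi k n x + psi k n x)

theorem hasDerivAt_sin_rpow {k x : ℝ} (hx : 0 < Real.sin x) :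
    HasDerivAt (fun y => Real.sin y ^ k) (k * (Real.cos x / Real.sin x) * Real.sin x ^ k) x := by
  refine ((Real.hasDerivAt_sin x).rpow_const (Or.inl hx.ne')).congr_deriv ?_
  rw [Real.rpow_sub_one hx.ne']
  ring

theorem hasDerivAt_cot {x : ℝ} (hx : 0 < Real.sin x) :
    HasDerivAt (fun y => Real.cos y / Real.sin y) (-(1 / Real.sin x ^ 2)) x := by
  refine ((Real.hasDerivAt_cos x).div (Real.hasDerivAt_sin x) hx.ne').congr_deriv ?_
  have h2 := Real.sin_sq_add_cos_sq x
  field_simp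
  linarith

theorem hasDerivAt_uf {k : ℝ} (n : ℕ) {x : ℝ} (hx : 0 < Real.sin x) :
    HasDerivAt (uf k n) (vf k n x) x := by
  refine ((hasDerivAt_sin_rpow hx).mul (hasDerivAt_phi k n x)).congr_deriv ?_
  rw [vf]
  ring

/-- The factor sin^k removes the first-order term of the Gegenbauer equation, leaving an oscillator
of frequency n + k with the singular perturbation k(1-k)/sin². -/
theorem hasDerivAt_vf {k : ℝ} (hk : 0 < k) (n : ℕ) {x : ℝ} (hx : 0 < Real.sin x) :
    HasDerivAt (vf k n)
      (-((n + k) ^ 2 + k * (1 - k) / Real.sin x ^ 2) * uf k n x) x := by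
  refine ((hasDerivAt_sin_rpow hx).mul ((((hasDerivAt_cot hx).const_mul k).mul
    (hasDerivAt_phi k n x)).add (hasDerivAt_psi hk n x))).congr_deriv ?_
  have h2 := Real.sin_sq_add_cos_sq x
  have hc : Real.cos x ^ 2 = 1 - Real.sin x ^ 2 := by linarith
  simp only [uf, psi, Pi.add_apply, Pi.mul_apply]
  field_simp
  ring_nf
  rw [hc]
  ring

/-- The energy of `uf`. -/
noncomputable def energy (k : ℝ) (n : ℕ) (x : ℝ) : ℝ := vf k n x ^ 2 + (n + k) ^ 2 * uf k n x ^ 2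

theorem hasDerivAt_energy {k : ℝ} (hk : 0 < k) (n : ℕ) {x : ℝ} (hx : 0 < Real.sin x) :
    HasDerivAt (energy k n)
      (-(2 * (k * (1 - k) / Real.sin x ^ 2) * uf k n x * vf k n x)) x := by
  refine (((hasDerivAt_vf hk n hx).pow 2).add
    (((hasDerivAt_uf n hx).pow 2).const_mul _)).congr_deriv ?_
  push_cast
  ring

theorem two_mul_abs_uf_mul_vf_le {k : ℝ} (hk : 0 < k) (n : ℕ) (x : ℝ) :
    2 * (n + k) * |uf k n x * vf k n x| ≤ energy k n x := by
  have h : 0 ≤ ((n : ℝ) + k) := by positivity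
  rw [abs_mul, energy, ← sq_abs (uf k n x), ← sq_abs (vf k n x)]
  nlinarith [sq_nonneg ((n + k) * |uf k n x| - |vf k n x|)]

/-- Grönwall in both directions: under the differential inequality e · exp(h) is nonincreasing and e
· exp(-h) is nondecreasing. -/
theorem gronwall_two_sided {a b : ℝ} {e e' h h' : ℝ → ℝ}
    (he : ∀ x ∈ Set.Icc a b, HasDerivAt e (e' x) x) (hh : ∀ x ∈ Set.Icc a b, HasDerivAt h (h' x) x)
    (hle : ∀ x ∈ Set.Icc a b, |e' x| ≤ -h' x * e x) {x : ℝ} (hx : x ∈ Set.Icc a b) :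
    e x ≤ e a * Real.exp (h a - h x) ∧ e a * Real.exp (h x - h a) ≤ e x := by
  have ha : a ∈ Set.Icc a b := ⟨le_rfl, hx.1.trans hx.2⟩
  have d1 : ∀ y ∈ Set.Icc a b, HasDerivAt (fun y => e y * Real.exp (h y))
      (e' y * Real.exp (h y) + e y * (Real.exp (h y) * h' y)) y :=
    fun y hy => (he y hy).mul (hh y hy).exp
  have d2 : ∀ y ∈ Set.Icc a b, HasDerivAt (fun y => e y * Real.exp (-h y))
      (e' y * Real.exp (-h y) + e y * (Real.exp (-h y) * -h' y)) y :=
    fun y hy => (he y hy).mul (hh y hy).neg.exp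
  constructor
  · have hanti : AntitoneOn (fun y => e y * Real.exp (h y)) (Set.Icc a b) := by
      refine antitoneOn_of_deriv_nonpos (convex_Icc _ _)
        (fun y hy => (d1 y hy).continuousAt.continuousWithinAt)
        (fun y hy => (d1 y (interior_subset hy)).differentiableAt.differentiableWithinAt) ?_
      intro y hy
      rw [(d1 y (interior_subset hy)).deriv]
      have h1 := (abs_le.mp (hle y (interior_subset hy))).2
      nlinarith [Real.exp_pos (h y)]
    have := hanti ha hx hx.1
    rw [sub_eq_add_neg, Real.exp_add, Real.exp_neg, ← mul_assoc, ← div_eq_mul_inv,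
      le_div_iff₀ (Real.exp_pos _)]
    exact this
  · have hmono : MonotoneOn (fun y => e y * Real.exp (-h y)) (Set.Icc a b) := by
      refine monotoneOn_of_deriv_nonneg (convex_Icc _ _)
        (fun y hy => (d2 y hy).continuousAt.continuousWithinAt)
        (fun y hy => (d2 y (interior_subset hy)).differentiableAt.differentiableWithinAt) ?_
      intro y hy
      rw [(d2 y (interior_subset hy)).deriv]
      have h1 := (abs_le.mp (hle y (interior_subset hy))).1
      nlinarith [Real.exp_pos (-h y)]
    have h3 : e a * Real.exp (-h a) ≤ e x * Real.exp (-h x) := hmono ha hx hx.1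
    rw [Real.exp_neg (h x), ← div_eq_mul_inv, le_div_iff₀ (Real.exp_pos _)] at h3
    rw [sub_eq_neg_add, Real.exp_add, ← mul_assoc]
    exact h3

theorem sin_pos_of_base_le {k : ℝ} (hk : 0 < k) {n : ℕ} {x : ℝ}
    (hx : x ∈ Set.Icc (base k n) (Real.pi / 2)) : 0 < Real.sin x :=
  Real.sin_pos_of_pos_of_lt_pi ((base_pos hk n).trans_le hx.1) (by linarith [hx.2, Real.pi_pos])

theorem one_div_sin_le {k : ℝ} (hk : 0 < k) {n : ℕ} {x : ℝ}
    (hx : x ∈ Set.Icc (base k n) (Real.pi / 2)) : 1 / Real.sin x ≤ Real.pi * (n + k) := by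
  have h0 := base_pos hk n
  have h1 := Real.mul_le_sin (h0.le.trans hx.1) hx.2
  have h2 : 2 / Real.pi * base k n ≤ Real.sin x :=
    (mul_le_mul_of_nonneg_left hx.1 (by positivity)).trans h1
  have h3 : 2 / Real.pi * base k n = 1 / (Real.pi * (n + k)) := by
    unfold base; field_simp
  have h4 : 0 < Real.pi * ((n : ℝ) + k) := by positivity
  rw [h3] at h2
  exact (one_div_le (sin_pos_of_base_le hk hx) h4).mpr h2

/-- The logarithmic derivative of the energy is at most |k(1-k)| / (N sin²) with N = n + k. Its
primitive is a multiple of the cotangent, and cot(`base k n`) ≤ πN, so the factor N cancels and the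
energy changes by a factor bounded uniformly in n. This is why the interval starts at distance of
order 1/N from 0. -/
theorem energy_bounds {k : ℝ} (hk : 0 < k) {n : ℕ} (hn : 1 ≤ n) {x : ℝ}
    (hx : x ∈ Set.Icc (base k n) (Real.pi / 2)) :
    energy k n x ≤ energy k n (base k n) * Real.exp (|k * (1 - k)| * Real.pi) ∧
    energy k n (base k n) * Real.exp (-(|k * (1 - k)| * Real.pi)) ≤ energy k n x := by
  have hN : 0 < (n : ℝ) + k := by positivity
  have key := gronwall_two_sided (a := base k n) (b := Real.pi / 2) (e := energy k n)
    (h := fun y => |k * (1 - k)| / (n + k) * (Real.cos y / Real.sin y))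
    (h' := fun y => |k * (1 - k)| / (n + k) * -(1 / Real.sin y ^ 2))
    (fun y hy => hasDerivAt_energy hk n (sin_pos_of_base_le hk hy))
    (fun y hy => (hasDerivAt_cot (sin_pos_of_base_le hk hy)).const_mul _)
    (fun y hy => by
      have hs := sin_pos_of_base_le hk hy
      have h1 := two_mul_abs_uf_mul_vf_le hk n y
      rw [abs_neg, mul_assoc, abs_mul, abs_mul, abs_div, abs_of_pos (pow_pos hs 2), abs_two]
      have h2 : |uf k n y * vf k n y| ≤ energy k n y / (2 * (n + k)) := by
        rw [le_div_iff₀ (by positivity)]; linarith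
      refine (mul_le_mul_of_nonneg_left h2 (by positivity)).trans (le_of_eq ?_)
      field_simp) hx
  have hb : base k n ∈ Set.Icc (base k n) (Real.pi / 2) := ⟨le_rfl, (base_mem hk hn).2⟩
  have hsb := sin_pos_of_base_le hk hb
  have hsx := sin_pos_of_base_le hk hx
  have hc : Real.cos (base k n) / Real.sin (base k n) ≤ Real.pi * (n + k) :=
    (div_le_div_of_nonneg_right (Real.cos_le_one _) hsb.le).trans (one_div_sin_le hk hb)
  have hcx : 0 ≤ Real.cos x / Real.sin x :=
    div_nonneg (Real.cos_nonneg_of_neg_pi_div_two_le_of_le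
      (by linarith [hx.1, base_pos hk n, Real.pi_pos]) hx.2) hsx.le
  have hdiff : |k * (1 - k)| / (n + k) * (Real.cos (base k n) / Real.sin (base k n))
      - |k * (1 - k)| / (n + k) * (Real.cos x / Real.sin x) ≤ |k * (1 - k)| * Real.pi := by
    rw [← mul_sub]
    calc _ ≤ |k * (1 - k)| / (n + k) * (Real.pi * (n + k)) :=
          mul_le_mul_of_nonneg_left (by linarith) (by positivity)
      _ = _ := by field_simp
  have he : 0 ≤ energy k n (base k n) := by unfold energy; positivity
  refine ⟨key.1.trans (mul_le_mul_of_nonneg_left (Real.exp_le_exp.mpr hdiff) he),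
    le_trans (mul_le_mul_of_nonneg_left (Real.exp_le_exp.mpr ?_) he) key.2⟩
  linarith

/-- At the starting point sin lies between 1/(πN) and 1/N, the cotangent is at most πN, |ψ_n| ≤ N
and 1/2 ≤ φ_n ≤ 1, so every factor of the energy is under control. -/
theorem energy_base {k : ℝ} (hk : 0 < k) {n : ℕ} (hn : 1 ≤ n) :
    energy k n (base k n) ≤
      (2 * k ^ 2 * Real.pi ^ 2 + 3) * (n + k) ^ 2 * (n + k) ^ (-(2 * k)) ∧
    Real.pi ^ (-(2 * k)) / 4 * (n + k) ^ 2 * (n + k) ^ (-(2 * k)) ≤ energy k n (base k n) := by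
  have hb : base k n ∈ Set.Icc (base k n) (Real.pi / 2) := ⟨le_rfl, (base_mem hk hn).2⟩
  have hs := sin_pos_of_base_le hk hb
  have hN : 0 < (n : ℝ) + k := by positivity
  have hinv := one_div_sin_le hk hb
  set s := Real.sin (base k n) with hs_def
  set N := (n : ℝ) + k with hNdef
  have hS : (s ^ k) ^ 2 = s ^ (2 * k) := by
    rw [← Real.rpow_mul_natCast hs.le, mul_comm]; norm_num
  have hle : s ≤ 1 / N := by
    refine (Real.sin_le (base_pos hk n).le).trans ?_
    unfold base
    apply one_div_le_one_div_of_le hN; linarith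
  have hge : 1 / (Real.pi * N) ≤ s := (one_div_le hs (by positivity)).mp hinv
  have hSle : s ^ (2 * k) ≤ N ^ (-(2 * k)) := by
    rw [Real.rpow_neg hN.le, ← Real.inv_rpow hN.le, ← one_div]
    exact Real.rpow_le_rpow hs.le hle (by positivity)
  have hSge : Real.pi ^ (-(2 * k)) * N ^ (-(2 * k)) ≤ s ^ (2 * k) := by
    rw [← Real.mul_rpow Real.pi_pos.le hN.le, Real.rpow_neg (by positivity),
      ← Real.inv_rpow (by positivity), ← one_div]
    exact Real.rpow_le_rpow (by positivity) hge (by positivity)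
  have hphi1 := abs_phi_le_one hk hn (base_mem hk hn)
  have hphi2 := half_le_phi hk hn
  have hpsi := psi_sq_le hk n (base_mem hk hn)
  have hS0 : 0 < s ^ (2 * k) := Real.rpow_pos_of_pos hs _
  have hphisq : phi k n (base k n) ^ 2 ≤ 1 := by rwa [sq_le_one_iff_abs_le_one]
  have heq : energy k n (base k n) = s ^ (2 * k) *
      ((k * (Real.cos (base k n) / s) * phi k n (base k n) + psi k n (base k n)) ^ 2
        + N ^ 2 * phi k n (base k n) ^ 2) := by
    rw [energy, vf, uf, mul_pow, mul_pow, ← hs_def, hS]; ring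
  constructor
  · have hcot : (Real.cos (base k n) / s) ^ 2 ≤ (Real.pi * N) ^ 2 := by
      rw [div_pow]
      calc Real.cos (base k n) ^ 2 / s ^ 2 ≤ 1 / s ^ 2 :=
            div_le_div_of_nonneg_right (Real.cos_sq_le_one _) (by positivity)
        _ = (1 / s) ^ 2 := by rw [div_pow, one_pow]
        _ ≤ _ := pow_le_pow_left₀ (by positivity) hinv 2
    have hA : (k * (Real.cos (base k n) / s) * phi k n (base k n)) ^ 2
        ≤ k ^ 2 * Real.pi ^ 2 * N ^ 2 := by
      rw [mul_pow, mul_pow]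
      calc k ^ 2 * (Real.cos (base k n) / s) ^ 2 * phi k n (base k n) ^ 2
          ≤ k ^ 2 * (Real.pi * N) ^ 2 * 1 := by gcongr
        _ = _ := by ring
    have hB : (k * (Real.cos (base k n) / s) * phi k n (base k n) + psi k n (base k n)) ^ 2
        + N ^ 2 * phi k n (base k n) ^ 2 ≤ (2 * k ^ 2 * Real.pi ^ 2 + 3) * N ^ 2 := by
      have := add_sq_le (a := k * (Real.cos (base k n) / s) * phi k n (base k n))
        (b := psi k n (base k n))
      nlinarith [mul_le_mul_of_nonneg_left hphisq (sq_nonneg N)]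
    rw [heq]
    calc _ ≤ N ^ (-(2 * k)) * ((2 * k ^ 2 * Real.pi ^ 2 + 3) * N ^ 2) := by gcongr
      _ = _ := by ring
  · rw [heq]
    have hC : N ^ 2 / 4 ≤
        (k * (Real.cos (base k n) / s) * phi k n (base k n) + psi k n (base k n)) ^ 2
        + N ^ 2 * phi k n (base k n) ^ 2 := by
      have : 1 / 4 ≤ phi k n (base k n) ^ 2 := by nlinarith
      nlinarith [sq_nonneg (k * (Real.cos (base k n) / s) * phi k n (base k n)
        + psi k n (base k n)), mul_le_mul_of_nonneg_left this (sq_nonneg N)]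
    calc _ = (Real.pi ^ (-(2 * k)) * N ^ (-(2 * k))) * (N ^ 2 / 4) := by ring
      _ ≤ _ := by gcongr

/-- The energy is comparable to `(n + k)^{2 - 2k}` on `[base k n, π / 2]`. -/
theorem exists_energy_bounds {k : ℝ} (hk : 0 < k) : ∃ m M : ℝ, 0 < m ∧ 0 < M ∧
    ∀ n : ℕ, 1 ≤ n → ∀ x ∈ Set.Icc (base k n) (Real.pi / 2),
      m * ((n + k) ^ 2 * (n + k) ^ (-(2 * k))) ≤ energy k n x ∧
      energy k n x ≤ M * ((n + k) ^ 2 * (n + k) ^ (-(2 * k))) := by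
  refine ⟨Real.pi ^ (-(2 * k)) / 4 * Real.exp (-(|k * (1 - k)| * Real.pi)),
    (2 * k ^ 2 * Real.pi ^ 2 + 3) * Real.exp (|k * (1 - k)| * Real.pi),
    by positivity, by positivity, fun n hn x hx => ?_⟩
  obtain ⟨h1, h2⟩ := energy_bounds hk hn hx
  obtain ⟨h3, h4⟩ := energy_base hk hn
  constructor
  · refine le_trans (le_of_eq ?_) ((mul_le_mul_of_nonneg_right h4 (Real.exp_pos _).le).trans h2)
    ring
  · refine (h1.trans (mul_le_mul_of_nonneg_right h3 (Real.exp_pos _).le)).trans (le_of_eq ?_)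
    ring

/-- The parity of p_n in cos x reduces pointwise estimates to the first quadrant, through the angle
arccos |cos x|. -/
theorem exists_reduced_angle {k : ℝ} (hk : 0 < k) (n : ℕ) (x : ℝ) :
    ∃ y ∈ Set.Icc 0 (Real.pi / 2), Real.sin y = |Real.sin x| ∧ |phi k n y| = |phi k n x| := by
  refine ⟨Real.arccos |Real.cos x|, ⟨Real.arccos_nonneg _,
    Real.arccos_le_pi_div_two.mpr (abs_nonneg _)⟩, ?_, ?_⟩
  · rw [Real.sin_arccos, sq_abs, ← Real.sin_sq, Real.sqrt_sq_eq_abs]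
  · rw [phi, phi, Real.cos_arccos (by linarith [abs_nonneg (Real.cos x)]) (Real.abs_cos_le_one x)]
    rcases abs_choice (Real.cos x) with h | h
    · rw [h]
    · rw [h, gv_neg hk.le, abs_mul, abs_pow, abs_neg, abs_one, one_pow, one_mul]

/-- Beyond `base k n` the energy dominates (n+k)² u². Before it, |φ_n| ≤ 1 and sin ≤ 1/(n+k) give
the same order. -/
theorem exists_uf_sq_le {k : ℝ} (hk : 0 < k) : ∃ M : ℝ, 0 < M ∧ ∀ n : ℕ, 1 ≤ n → ∀ x : ℝ,
    |Real.sin x| ^ (2 * k) * phi k n x ^ 2 ≤ M * (n + k) ^ (-(2 * k)) := by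
  obtain ⟨m, M, hm, hM, h⟩ := exists_energy_bounds hk
  refine ⟨max M 1, by positivity, fun n hn x => ?_⟩
  have hN : 0 < (n : ℝ) + k := by positivity
  obtain ⟨y, hy, hs, hp⟩ := exists_reduced_angle hk n x
  have hs0 : 0 ≤ Real.sin y := hs ▸ abs_nonneg _
  rw [← hs, ← sq_abs, ← hp, sq_abs]
  rcases le_total (base k n) y with hb | hb
  · have h1 := (h n hn y ⟨hb, hy.2⟩).2
    have h2 : (n + k) ^ 2 * (Real.sin y ^ (2 * k) * phi k n y ^ 2) ≤ energy k n y := by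
      have : Real.sin y ^ (2 * k) = (Real.sin y ^ k) ^ 2 := by
        rw [← Real.rpow_mul_natCast hs0, mul_comm]; norm_num
      rw [energy, uf, this, mul_pow]
      nlinarith [sq_nonneg (vf k n y)]
    have h3 : ((n : ℝ) + k) ^ 2 * (Real.sin y ^ (2 * k) * phi k n y ^ 2)
        ≤ (n + k) ^ 2 * (M * (n + k) ^ (-(2 * k))) := by linarith
    refine (le_of_mul_le_mul_left h3 (by positivity)).trans ?_
    gcongr
    exact le_max_left _ _
  · have h1 : phi k n y ^ 2 ≤ 1 := by
      rw [sq_le_one_iff_abs_le_one]; exact abs_phi_le_one hk hn hy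
    have h2 : Real.sin y ≤ ((n : ℝ) + k)⁻¹ := by
      refine (Real.sin_le hy.1).trans (hb.trans ?_)
      unfold base
      rw [← one_div]
      apply one_div_le_one_div_of_le hN; linarith
    rw [Real.rpow_neg hN.le, ← Real.inv_rpow hN.le]
    calc Real.sin y ^ (2 * k) * phi k n y ^ 2 ≤ ((n : ℝ) + k)⁻¹ ^ (2 * k) * 1 := by gcongr
      _ = 1 * ((n : ℝ) + k)⁻¹ ^ (2 * k) := by ring
      _ ≤ _ := by gcongr; exact le_max_right _ _

/-- Equipartition of energy: integrating (u u' w)' shows that ∫ u² w has at least the order of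
N^{-2} ∫ (energy) · w, up to terms of size w(a)/N relative to the main one. The weight 1 will serve
the L¹ bound and the weight 1/sin the critical L^q bound. -/
theorem exists_uf_mass {k : ℝ} (hk : 0 < k) : ∃ c C : ℝ, 0 < c ∧ 0 < C ∧
    ∀ n : ℕ, 1 ≤ n → ∀ a b : ℝ, a ≤ b → base k n ≤ a → b ≤ Real.pi / 2 → ∀ w w' : ℝ → ℝ,
      (∀ x ∈ Set.Icc a b, HasDerivAt w (w' x) x) → ContinuousOn w' (Set.Icc a b) →
      (∀ x ∈ Set.Icc a b, w' x ≤ 0) → (∀ x ∈ Set.Icc a b, 0 ≤ w x) →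
      (n + k) ^ (-(2 * k)) * (c * (∫ x in a..b, w x) - C / (n + k) * w a)
        ≤ ∫ x in a..b, uf k n x ^ 2 * w x := by
  obtain ⟨m, M, hm, hM, h⟩ := exists_energy_bounds hk
  have hD : 0 < 2 + |k * (1 - k)| * Real.pi ^ 2 := by positivity
  refine ⟨m / (2 + |k * (1 - k)| * Real.pi ^ 2), M / (2 + |k * (1 - k)| * Real.pi ^ 2),
    by positivity, by positivity, fun n hn a b hab ha hb w w' hw hw'c hw' hw0 => ?_⟩
  have hN : 0 < (n : ℝ) + k := by positivity
  set N := (n : ℝ) + k with hNdef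
  have hmem : ∀ x ∈ Set.Icc a b, x ∈ Set.Icc (base k n) (Real.pi / 2) :=
    fun x hx => ⟨ha.trans hx.1, hx.2.trans hb⟩
  have hsin : ∀ x ∈ Set.Icc a b, 0 < Real.sin x := fun x hx => sin_pos_of_base_le hk (hmem x hx)
  have hwc : ContinuousOn w (Set.Icc a b) := fun x hx => (hw x hx).continuousAt.continuousWithinAt
  have huc : ContinuousOn (uf k n) (Set.Icc a b) := fun x hx =>
    (hasDerivAt_uf n (hsin x hx)).continuousAt.continuousWithinAt
  have hvc : ContinuousOn (vf k n) (Set.Icc a b) := fun x hx =>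
    (hasDerivAt_vf hk n (hsin x hx)).continuousAt.continuousWithinAt
  have hqc : ContinuousOn (fun x => N ^ 2 + k * (1 - k) / Real.sin x ^ 2) (Set.Icc a b) := by
    refine continuousOn_const.add (continuousOn_const.div (by fun_prop) fun x hx => ?_)
    exact pow_ne_zero _ (hsin x hx).ne'
  have hec : ContinuousOn (energy k n) (Set.Icc a b) := by
    unfold energy; fun_prop
  have huIcc := Set.uIcc_of_le hab
  -- Here u'² has been replaced by energy - N² u², which together with u u'' gives the factor 2N² +
  -- k(1-k)/sin².
  have hd : ∀ x ∈ Set.uIcc a b, HasDerivAt (fun x => uf k n x * vf k n x * w x)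
      (energy k n x * w x - (2 * N ^ 2 + k * (1 - k) / Real.sin x ^ 2) * (uf k n x ^ 2 * w x)
        + uf k n x * vf k n x * w' x) x := by
    intro x hx
    rw [huIcc] at hx
    refine (((hasDerivAt_uf n (hsin x hx)).mul (hasDerivAt_vf hk n (hsin x hx))).mul
      (hw x hx)).congr_deriv ?_
    simp only [energy, Pi.mul_apply, ← hNdef]
    ring
  have hqc2 : ContinuousOn (fun x => 2 * N ^ 2 + k * (1 - k) / Real.sin x ^ 2)
      (Set.Icc a b) := by
    refine continuousOn_const.add (continuousOn_const.div (by fun_prop) fun x hx => ?_)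
    exact pow_ne_zero _ (hsin x hx).ne'
  have hint : ∀ {g : ℝ → ℝ}, ContinuousOn g (Set.Icc a b) → IntervalIntegrable g volume a b :=
    fun hg => ContinuousOn.intervalIntegrable (by rwa [huIcc])
  have i1 : IntervalIntegrable (fun x => energy k n x * w x) volume a b := hint (hec.mul hwc)
  have i2 : IntervalIntegrable (fun x => (2 * N ^ 2 + k * (1 - k) / Real.sin x ^ 2) *
      (uf k n x ^ 2 * w x)) volume a b := hint (hqc2.mul ((huc.pow 2).mul hwc))
  have i3 : IntervalIntegrable (fun x => uf k n x * vf k n x * w' x) volume a b :=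
    hint ((huc.mul hvc).mul hw'c)
  have hftc := intervalIntegral.integral_eq_sub_of_hasDerivAt hd ((i1.sub i2).add i3)
  rw [intervalIntegral.integral_add (i1.sub i2) i3, intervalIntegral.integral_sub i1 i2] at hftc
  have hww : ∫ x in a..b, w' x = w b - w a :=
    intervalIntegral.integral_eq_sub_of_hasDerivAt (fun x hx => hw x (by rwa [huIcc] at hx))
      (hint hw'c)
  set B := N ^ (-(2 * k)) with hB
  have hB0 : 0 < B := Real.rpow_pos_of_pos hN _
  have huv : ∀ x ∈ Set.Icc a b, |uf k n x * vf k n x| ≤ M / 2 * (N * B) := by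
    intro x hx
    have h1 := two_mul_abs_uf_mul_vf_le hk n x
    have h2 := (h n hn x (hmem x hx)).2
    rw [← hNdef] at h1
    have h3 : N * |uf k n x * vf k n x| ≤ N * (M / 2 * (N * B)) := by
      nlinarith
    exact le_of_mul_le_mul_left h3 hN
  have e1 : m * (N ^ 2 * B) * ∫ x in a..b, w x ≤ ∫ x in a..b, energy k n x * w x := by
    rw [← intervalIntegral.integral_const_mul]
    refine intervalIntegral.integral_mono_on hab (hint (continuousOn_const.mul hwc)) i1 ?_
    intro x hx
    exact mul_le_mul_of_nonneg_right (h n hn x (hmem x hx)).1 (hw0 x hx)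
  have e2 : ∫ x in a..b, (2 * N ^ 2 + k * (1 - k) / Real.sin x ^ 2) * (uf k n x ^ 2 * w x)
      ≤ (2 + |k * (1 - k)| * Real.pi ^ 2) * N ^ 2 * ∫ x in a..b, uf k n x ^ 2 * w x := by
    rw [← intervalIntegral.integral_const_mul]
    refine intervalIntegral.integral_mono_on hab i2
      (hint (continuousOn_const.mul ((huc.pow 2).mul hwc))) ?_
    intro x hx
    refine mul_le_mul_of_nonneg_right ?_ (mul_nonneg (sq_nonneg _) (hw0 x hx))
    have h1 := one_div_sin_le hk (hmem x hx)
    have h2 : (1 / Real.sin x) ^ 2 ≤ (Real.pi * N) ^ 2 :=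
      pow_le_pow_left₀ (one_div_nonneg.mpr (hsin x hx).le) h1 2
    have h3 : k * (1 - k) / Real.sin x ^ 2 ≤ |k * (1 - k)| * (Real.pi * N) ^ 2 := by
      calc k * (1 - k) / Real.sin x ^ 2 = k * (1 - k) * (1 / Real.sin x) ^ 2 := by
            rw [div_pow, one_pow]; ring
        _ ≤ |k * (1 - k)| * (1 / Real.sin x) ^ 2 := by gcongr; exact le_abs_self _
        _ ≤ _ := by gcongr
    nlinarith
  have e3 : -(M / 2 * (N * B) * (w a - w b)) ≤ ∫ x in a..b, uf k n x * vf k n x * w' x := by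
    have : -(M / 2 * (N * B) * (w a - w b)) = ∫ x in a..b, M / 2 * (N * B) * w' x := by
      rw [intervalIntegral.integral_const_mul, hww]; ring
    rw [this]
    refine intervalIntegral.integral_mono_on hab (hint (continuousOn_const.mul hw'c)) i3 ?_
    intro x hx
    exact mul_le_mul_of_nonpos_right ((le_abs_self _).trans (huv x hx)) (hw' x hx)
  have ha' : a ∈ Set.Icc a b := ⟨le_rfl, hab⟩
  have hb' : b ∈ Set.Icc a b := ⟨hab, le_rfl⟩
  have e4 : -(M / 2 * (N * B) * w a) ≤ uf k n a * vf k n a * w a := by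
    have := mul_le_mul_of_nonneg_right (neg_le_of_abs_le (huv a ha')) (hw0 a ha')
    linarith
  have e5 : uf k n b * vf k n b * w b ≤ M / 2 * (N * B) * w b :=
    mul_le_mul_of_nonneg_right ((le_abs_self _).trans (huv b hb')) (hw0 b hb')
  -- As w is nonincreasing, the two boundary terms and the integral of u u' w' together cost at most
  -- (M/2) N B (2 w(a)); the contributions of w(b) cancel.
  have key : m * (N ^ 2 * B) * (∫ x in a..b, w x) - M * (N * B) * w a
      ≤ (2 + |k * (1 - k)| * Real.pi ^ 2) * N ^ 2 * ∫ x in a..b, uf k n x ^ 2 * w x := by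
    linarith
  rw [← div_le_iff₀' (by positivity)] at key
  refine le_trans (le_of_eq ?_) key
  field_simp

/-! ### Integration against dm_k and orthogonality of φ_n and ψ_n -/

theorem measurable_density (k : ℝ) : Measurable (fun x : ℝ => |Real.sin x| ^ (2 * k)) := by
  fun_prop

theorem integral_dm {F : Type*} [NormedAddCommGroup F] [NormedSpace ℝ F] (k : ℝ) (f : ℝ → F) :
    ∫ x, f x ∂(dm k) = ∫ x in -Real.pi..Real.pi, |Real.sin x| ^ (2 * k) • f x := by
  rw [dm, integral_withDensity_eq_integral_toReal_smul (measurable_density k).ennreal_ofReal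
    (Eventually.of_forall fun _ => ENNReal.ofReal_lt_top),
    intervalIntegral.integral_of_le (by linarith [Real.pi_pos]), integral_Icc_eq_integral_Ioc]
  refine integral_congr_ae (Eventually.of_forall fun x => ?_)
  simp only
  rw [ENNReal.toReal_ofReal (by positivity)]

theorem integral_dm_comp_neg {F : Type*} [NormedAddCommGroup F] [NormedSpace ℝ F] (k : ℝ)
    (f : ℝ → F) : ∫ x, f (-x) ∂(dm k) = ∫ x, f x ∂(dm k) := by
  have := intervalIntegral.integral_comp_neg (a := -Real.pi) (b := Real.pi)
    (fun x => |Real.sin x| ^ (2 * k) • f x)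
  rw [integral_dm, integral_dm]
  simpa using this

theorem integral_dm_odd {F : Type*} [NormedAddCommGroup F] [NormedSpace ℝ F] (k : ℝ)
    {f : ℝ → F} (hf : ∀ x, f (-x) = -f x) : ∫ x, f x ∂(dm k) = 0 := by
  have h := integral_dm_comp_neg k f
  simp_rw [hf, integral_neg] at h
  have h2 : (2 : ℝ) • ∫ x, f x ∂(dm k) = 0 := by
    rw [two_smul]; nth_rewrite 1 [← h]; simp
  simpa using h2

theorem integrable_dm_real {k : ℝ} (hk : 0 ≤ k) {f : ℝ → ℝ} (hf : Continuous f) :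
    Integrable f (dm k) := by
  have := (integrable_dm hk (f := fun x => (f x : ℂ)) (by fun_prop)).re
  simpa using this

theorem countable_sin_eq_zero : {x : ℝ | Real.sin x = 0}.Countable := by
  refine (Set.countable_range (fun m : ℤ => (m : ℝ) * Real.pi)).mono ?_
  intro x hx
  exact Real.sin_eq_zero_iff.mp hx

theorem hasDerivAt_abs_sin_rpow {k x : ℝ} (hx : Real.sin x ≠ 0) :
    HasDerivAt (fun y => |Real.sin y| ^ k)
      (k * (Real.cos x / Real.sin x) * |Real.sin x| ^ k) x := by
  rcases lt_or_gt_of_ne hx with h | h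
  · have h1 : HasDerivAt (fun y => (-Real.sin y) ^ k)
        (-Real.cos x * k * (-Real.sin x) ^ (k - 1)) x :=
      (Real.hasDerivAt_sin x).neg.rpow_const (Or.inl (by linarith [Pi.neg_apply Real.sin x]))
    have h2 : (fun y => |Real.sin y| ^ k) =ᶠ[𝓝 x] fun y => (-Real.sin y) ^ k := by
      filter_upwards [Real.continuous_sin.continuousAt.eventually_lt continuousAt_const h] with y hy
      rw [abs_of_neg hy]
    refine (h1.congr_of_eventuallyEq h2).congr_deriv ?_
    rw [Real.rpow_sub_one (by linarith), abs_of_neg h]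
    field_simp
  · have h2 : (fun y => |Real.sin y| ^ k) =ᶠ[𝓝 x] fun y => Real.sin y ^ k := by
      filter_upwards [continuousAt_const.eventually_lt Real.continuous_sin.continuousAt h] with y hy
      rw [abs_of_pos hy]
    rw [abs_of_pos h]
    exact (hasDerivAt_sin_rpow h).congr_of_eventuallyEq h2

/-- The integrand times the density is the derivative of |sin|^{2k} sin · q, which vanishes at ±π.
Differentiability is only claimed off the countable zero set of sin, which the fundamental theorem
tolerates. -/
theorem integral_dm_parts {k : ℝ} (hk : 0 ≤ k) {q q' : ℝ → ℝ} (hq : ∀ x, HasDerivAt q (q' x) x)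
    (hq' : Continuous q') :
    ∫ x, ((2 * k + 1) * Real.cos x * q x + Real.sin x * q' x) ∂(dm k) = 0 := by
  have hqc : Continuous q := continuous_iff_continuousAt.mpr fun x => (hq x).continuousAt
  have hw : Continuous fun x : ℝ => |Real.sin x| ^ (2 * k) :=
    Real.continuous_sin.abs.rpow_const fun _ => Or.inr (by positivity)
  rw [integral_dm, MeasureTheory.integral_eq_of_hasDerivAt_off_countable
    (fun x => |Real.sin x| ^ (2 * k) * (Real.sin x * q x)) _ countable_sin_eq_zero]
  · simp
  · fun_prop
  · intro x hx
    have hs : Real.sin x ≠ 0 := hx.2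
    refine ((hasDerivAt_abs_sin_rpow hs).mul
      ((Real.hasDerivAt_sin x).mul (hq x))).congr_deriv ?_
    simp only [Pi.mul_apply, smul_eq_mul]
    field_simp
    ring
  · exact (Continuous.intervalIntegrable (by fun_prop) _ _)

/-- Weak form of the eigenvalue equation, by parts with q = p_n'(cos) φ_m. The right side is
symmetric in n and m while the eigenvalues differ, whence orthogonality of both families. -/
theorem eigen_mul_integral_phi_mul_phi {k : ℝ} (hk : 0 < k) (n m : ℕ) :
    n * (n + 2 * k) * ∫ x, phi k n x * phi k m x ∂(dm k)
      = ∫ x, psi k n x * psi k m x ∂(dm k) := by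
  have h := integral_dm_parts hk.le (q := fun x => gd k n (Real.cos x) * phi k m x)
    (fun x => ((hasDerivAt_gd k n (Real.cos x)).comp x (Real.hasDerivAt_cos x)).mul
      (hasDerivAt_phi k m x)) (by simp only [Function.comp]; fun_prop)
  have h2 : ∀ x, (2 * k + 1) * Real.cos x * (gd k n (Real.cos x) * phi k m x) +
      Real.sin x * (gdd k n (Real.cos x) * -Real.sin x * phi k m x +
        (gd k n ∘ Real.cos) x * psi k m x)
      = n * (n + 2 * k) * (phi k n x * phi k m x) - psi k n x * psi k m x := by
    intro x
    have h3 := geg_ode hk n (Real.cos x)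
    have h4 := Real.sin_sq_add_cos_sq x
    simp only [phi, psi, Function.comp]
    linear_combination (-gv k m (Real.cos x)) * h3
      - gv k m (Real.cos x) * gdd k n (Real.cos x) * h4
  simp_rw [h2] at h
  rw [integral_sub (integrable_dm_real hk.le (by fun_prop))
    (integrable_dm_real hk.le (by fun_prop)), integral_const_mul] at h
  linarith

theorem integral_phi_mul_phi_of_ne {k : ℝ} (hk : 0 < k) {n m : ℕ} (h : n ≠ m) :
    ∫ x, phi k n x * phi k m x ∂(dm k) = 0 := by
  have h1 := eigen_mul_integral_phi_mul_phi hk n m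
  have h2 := eigen_mul_integral_phi_mul_phi hk m n
  simp_rw [mul_comm (phi k m _), mul_comm (psi k m _)] at h2
  rw [← h1, ← sub_eq_zero, ← sub_mul] at h2
  refine (mul_eq_zero.mp h2).resolve_left ?_
  have h3 : (m : ℝ) * (m + 2 * k) - n * (n + 2 * k) = (m - n) * (m + n + 2 * k) := by ring
  rw [h3]
  refine mul_ne_zero (sub_ne_zero.mpr (by exact_mod_cast h.symm)) (by positivity)

theorem integral_psi_mul_psi_of_ne {k : ℝ} (hk : 0 < k) {n m : ℕ} (h : n ≠ m) :
    ∫ x, psi k n x * psi k m x ∂(dm k) = 0 := by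
  rw [← eigen_mul_integral_phi_mul_phi hk, integral_phi_mul_phi_of_ne hk h, mul_zero]

@[simp] theorem phi_neg (k : ℝ) (n : ℕ) (x : ℝ) : phi k n (-x) = phi k n x := by simp [phi]
@[simp] theorem psi_neg (k : ℝ) (n : ℕ) (x : ℝ) : psi k n (-x) = -psi k n x := by simp [psi]

/-- The squared norm of `phi k n` in `L²(dm_k)`. -/
noncomputable def phiSq (k : ℝ) (n : ℕ) : ℝ := ∫ x, phi k n x ^ 2 ∂(dm k)

theorem integral_psi_sq {k : ℝ} (hk : 0 < k) (n : ℕ) :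
    ∫ x, psi k n x ^ 2 ∂(dm k) = n * (n + 2 * k) * phiSq k n := by
  simp_rw [phiSq, sq]
  rw [eigen_mul_integral_phi_mul_phi hk]

theorem phiSq_pos {k : ℝ} (hk : 0 < k) (n : ℕ) : 0 < phiSq k n := by
  rw [phiSq, integral_dm]
  simp only [smul_eq_mul]
  have hw : Continuous fun x : ℝ => |Real.sin x| ^ (2 * k) :=
    Real.continuous_sin.abs.rpow_const fun _ => Or.inr (by positivity)
  have hphi0 : phi k n 0 ≠ 0 := by simp [phi, gv_eval_one hk.le]
  have hev : ∀ᶠ x in 𝓝 (0 : ℝ), phi k n x ≠ 0 :=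
    (continuous_phi k n).continuousAt.eventually_ne hphi0
  obtain ⟨δ, hδ, hball⟩ := Metric.eventually_nhds_iff.mp hev
  -- The witness is taken near 0, where φ_n is close to 1, but not at 0, where the density vanishes.
  have hx0 : 0 < min (δ / 2) 1 := by positivity
  refine intervalIntegral.integral_pos (by linarith [Real.pi_pos]) (by fun_prop)
    (fun x _ => by positivity) ⟨min (δ / 2) 1, ⟨?_, ?_⟩, ?_⟩
  · linarith [Real.pi_pos]
  · linarith [min_le_right (δ / 2) 1, Real.pi_gt_three]
  · have h1 : phi k n (min (δ / 2) 1) ≠ 0 := by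
      apply hball
      rw [dist_zero_right, Real.norm_of_nonneg hx0.le]
      linarith [min_le_left (δ / 2) 1]
    have h2 : 0 < Real.sin (min (δ / 2) 1) := Real.sin_pos_of_pos_of_lt_pi hx0
      (by linarith [min_le_right (δ / 2) 1, Real.pi_gt_three])
    positivity

/-! ### Identification of the nonsymmetric polynomials -/

/-- The exponential `z ↦ e^{jz}`. -/
noncomputable def ez (j : ℤ) (z : ℂ) : ℂ := Complex.exp (j * z)

/-- The span of the exponentials below `n`. -/
noncomputable def lowerSpan (n : ℤ) : Submodule ℂ (ℂ → ℂ) := Submodule.span ℂ (ez '' (lower n))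

theorem ez_mem_lowerSpan {j n : ℤ} (h : Below j n) : ez j ∈ lowerSpan n :=
  Submodule.subset_span ⟨j, Finset.mem_coe.mpr (mem_lower.mpr h), rfl⟩

theorem lowerSpan_le {n : ℤ} {S : Submodule ℂ (ℂ → ℂ)} (h : ∀ j, Below j n → ez j ∈ S) :
    lowerSpan n ≤ S := by
  refine Submodule.span_le.mpr ?_
  rintro _ ⟨j, hj, rfl⟩
  exact h j (mem_lower.mp (Finset.mem_coe.mp hj))

theorem exists_coeff_of_mem_lowerSpan {n : ℤ} {F : ℂ → ℂ} (h : F ∈ lowerSpan n) :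
    ∃ c : ℤ → ℂ, ∀ z, F z = ∑ j ∈ lower n, c j * Complex.exp (j * z) := by
  obtain ⟨c, rfl⟩ := (Submodule.mem_span_image_finset_iff_exists_fun' ℂ).mp h
  exact ⟨c, fun z => by simp [ez, Finset.sum_apply]⟩

theorem below_natCast {j : ℤ} {n : ℕ} : Below j n ↔ |j| < n ∧ Even ((n : ℤ) - j) := by
  unfold Below
  rw [Int.even_iff, Int.even_iff]
  rcases abs_cases j with ⟨h, _⟩ | ⟨h, _⟩ <;> rw [h, Nat.abs_cast] <;> omega

/-- This is the asymmetry between the indices n and -n: the polynomial of index -n has one more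
orthogonality condition, against e^{inx}. -/
theorem below_neg_natCast {j : ℤ} {n : ℕ} (hn : 1 ≤ n) :
    Below j (-n) ↔ Below j n ∨ j = n := by
  unfold Below
  rw [Int.even_iff, Int.even_iff, abs_neg]
  rcases abs_cases j with ⟨h, _⟩ | ⟨h, _⟩ <;> rw [h, Nat.abs_cast] <;> omega

theorem cosh_mul_ez (j : ℤ) :
    (fun z => Complex.cosh z * ez j z) = (1 / 2 : ℂ) • (ez (j + 1) + ez (j - 1)) := by
  funext z
  have h1 : Complex.exp ((j + 1 : ℤ) * z) = Complex.exp (j * z) * Complex.exp z := by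
    rw [← Complex.exp_add]; congr 1; push_cast; ring
  have h2 : Complex.exp ((j - 1 : ℤ) * z) = Complex.exp (j * z) * Complex.exp (-z) := by
    rw [← Complex.exp_add]; congr 1; push_cast; ring
  simp only [ez, Pi.smul_apply, Pi.add_apply, smul_eq_mul, h1, h2, Complex.cosh]
  ring

theorem cosh_mul_mem {n : ℕ} {F : ℂ → ℂ} (h : F ∈ lowerSpan n) :
    (fun z => Complex.cosh z * F z) ∈ lowerSpan (n + 1 : ℕ) := by
  have : lowerSpan n ≤ (lowerSpan (n + 1 : ℕ)).comap (LinearMap.mulLeft ℂ Complex.cosh) := by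
    refine lowerSpan_le fun j hj => ?_
    change (fun z => Complex.cosh z * ez j z) ∈ lowerSpan (n + 1 : ℕ)
    rw [cosh_mul_ez]
    rw [below_natCast, Int.even_iff, abs_lt] at hj
    refine Submodule.smul_mem _ _ (Submodule.add_mem _ ?_ ?_) <;>
    · refine ez_mem_lowerSpan (below_natCast.mpr ?_)
      rw [Int.even_iff, abs_lt]
      push_cast
      omega
  exact this h

theorem lowerSpan_mono_two (n : ℕ) : lowerSpan n ≤ lowerSpan (n + 2 : ℕ) := by
  refine lowerSpan_le fun j hj => ez_mem_lowerSpan ?_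
  rw [below_natCast, Int.even_iff, abs_lt] at hj ⊢
  push_cast
  omega

theorem hasDerivAt_ez (j : ℤ) (z : ℂ) : HasDerivAt (ez j) (j * ez j z) z := by
  refine (((hasDerivAt_id z).const_mul (j : ℂ)).cexp).congr_deriv ?_
  simp [ez, mul_comm]

theorem deriv_mem_lowerSpan {n : ℤ} {F : ℂ → ℂ} (h : F ∈ lowerSpan n) :
    Differentiable ℂ F ∧ deriv F ∈ lowerSpan n := by
  induction h using Submodule.span_induction with
  | mem F hF =>
    obtain ⟨j, hj, rfl⟩ := hF
    refine ⟨fun z => (hasDerivAt_ez j z).differentiableAt, ?_⟩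
    have : deriv (ez j) = (j : ℂ) • ez j := by
      funext z
      rw [(hasDerivAt_ez j z).deriv]; rfl
    rw [this]
    exact Submodule.smul_mem _ _ (Submodule.subset_span ⟨j, hj, rfl⟩)
  | zero => exact ⟨differentiable_const _, by simp⟩
  | add F H _ _ hF hH =>
    refine ⟨hF.1.add hH.1, ?_⟩
    have : deriv (F + H) = deriv F + deriv H := by
      funext z
      exact deriv_add (hF.1 z) (hH.1 z)
    rw [this]
    exact Submodule.add_mem _ hF.2 hH.2
  | smul a F _ hF =>
    refine ⟨hF.1.const_smul a, ?_⟩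
    have : deriv (a • F) = a • deriv F := by
      funext z
      exact deriv_const_smul a (hF.1 z)
    rw [this]
    exact Submodule.smul_mem _ _ hF.2

/-- The Gegenbauer polynomial composed with `cosh`. -/
noncomputable def gegC (k : ℝ) (n : ℕ) (z : ℂ) : ℂ := (geg k n).aeval (Complex.cosh z)

/-- The derivative of `gegC`. -/
noncomputable def gegCd (k : ℝ) (n : ℕ) (z : ℂ) : ℂ :=
  Complex.sinh z * (geg k n).derivative.aeval (Complex.cosh z)

theorem hasDerivAt_gegC (k : ℝ) (n : ℕ) (z : ℂ) : HasDerivAt (gegC k n) (gegCd k n z) z := by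
  refine (((geg k n).hasDerivAt_aeval (Complex.cosh z)).comp z
    (Complex.hasDerivAt_cosh z)).congr_deriv ?_
  rw [gegCd, mul_comm]

theorem aeval_ofReal_eq (p : Polynomial ℝ) (x : ℝ) :
    p.aeval (x : ℂ) = ((p.eval x : ℝ) : ℂ) :=
  Polynomial.aeval_algebraMap_apply_eq_algebraMap_eval x p

theorem gegC_I_mul (k : ℝ) (n : ℕ) (x : ℝ) : gegC k n (Complex.I * x) = phi k n x := by
  rw [gegC, mul_comm, Complex.cosh_mul_I, ← Complex.ofReal_cos, phi, gv,
    aeval_ofReal_eq]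

theorem gegCd_I_mul (k : ℝ) (n : ℕ) (x : ℝ) :
    gegCd k n (Complex.I * x) = -(Complex.I * psi k n x) := by
  rw [gegCd, mul_comm Complex.I, Complex.cosh_mul_I, Complex.sinh_mul_I, ← Complex.ofReal_cos,
    psi, gd, aeval_ofReal_eq]
  push_cast
  ring

/-- Half the leading coefficient of `gegC`. -/
noncomputable def kap (k : ℝ) : ℕ → ℝ
  | 0 => 1 / 2
  | 1 => 1 / 2
  | (n + 2) => (n + 1 + k) / (n + 1 + 2 * k) * kap k (n + 1)

theorem kap_pos {k : ℝ} (hk : 0 ≤ k) (n : ℕ) : 0 < kap k n := by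
  induction n using Nat.twoStepInduction with
  | zero => norm_num [kap]
  | one => norm_num [kap]
  | more n _ h => rw [kap]; positivity

/-- By the three-term recurrence, as multiplication by cosh shifts exponents by ±1. For n = 0 the
two exponentials coincide, which is why `kap k 0` is 1/2. -/
theorem gegC_sub_mem {k : ℝ} (hk : 0 ≤ k) (n : ℕ) :
    gegC k n - (kap k n : ℂ) • (ez n + ez (-n)) ∈ lowerSpan n := by
  induction n using Nat.twoStepInduction with
  | zero =>
    convert Submodule.zero_mem _
    funext z
    simp [gegC, geg, kap, ez]
    norm_num
  | one =>
    convert Submodule.zero_mem _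
    funext z
    simp [gegC, geg, kap, ez, Complex.cosh]
    ring
  | more n h0 h1 =>
    have h2 := cosh_mul_mem h1
    have h3 := lowerSpan_mono_two n h0
    have h4 : ez n ∈ lowerSpan (n + 2 : ℕ) := by
      refine ez_mem_lowerSpan (below_natCast.mpr ?_)
      rw [Int.even_iff, abs_lt]; push_cast; omega
    have h5 : ez (-n) ∈ lowerSpan (n + 2 : ℕ) := by
      refine ez_mem_lowerSpan (below_natCast.mpr ?_)
      rw [Int.even_iff, abs_lt]; push_cast; omega
    have hne : (n : ℂ) + 1 + 2 * k ≠ 0 := by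
      have : (n : ℝ) + 1 + 2 * k ≠ 0 := by positivity
      exact_mod_cast this
    have e1 := cosh_mul_ez (n + 1 : ℕ)
    have e2 := cosh_mul_ez (-(n + 1 : ℕ))
    have key : gegC k (n + 2) - (kap k (n + 2) : ℂ) • (ez (n + 2 : ℕ) + ez (-(n + 2 : ℕ)))
        = (2 * (n + 1 + k) / (n + 1 + 2 * k) : ℂ) • (fun z => Complex.cosh z *
          (gegC k (n + 1) - (kap k (n + 1) : ℂ) • (ez (n + 1 : ℕ) + ez (-(n + 1 : ℕ)))) z)
        - ((n + 1) / (n + 1 + 2 * k) : ℂ) • (gegC k n - (kap k n : ℂ) • (ez n + ez (-n)))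
        + (kap k (n + 2) - (n + 1) / (n + 1 + 2 * k) * kap k n : ℂ) • (ez n + ez (-n)) := by
      funext z
      have e1z := congrFun e1 z
      have e2z := congrFun e2 z
      have hrec : gegC k (n + 2) z = 1 / (n + 1 + 2 * k) *
          (2 * (n + 1 + k) * Complex.cosh z * gegC k (n + 1) z - (n + 1) * gegC k n z) := by
        simp [gegC, geg]
      have i1 : (((n + 1 : ℕ) : ℤ) + 1) = ((n + 2 : ℕ) : ℤ) := by push_cast; ring
      have i2 : (((n + 1 : ℕ) : ℤ) - 1) = (n : ℤ) := by push_cast; ring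
      have i3 : (-((n + 1 : ℕ) : ℤ) + 1) = -(n : ℤ) := by push_cast; ring
      have i4 : (-((n + 1 : ℕ) : ℤ) - 1) = -((n + 2 : ℕ) : ℤ) := by push_cast; ring
      rw [i1, i2] at e1z
      rw [i3, i4] at e2z
      simp only [Pi.smul_apply, Pi.add_apply, Pi.sub_apply, smul_eq_mul] at e1z e2z ⊢
      have hkap : (kap k (n + 2) : ℂ) = (n + 1 + k) / (n + 1 + 2 * k) * kap k (n + 1) := by
        rw [kap]; push_cast; ring
      rw [hrec, hkap]
      field_simp
      linear_combination (-(2 : ℂ)) * (n + 1 + k) * kap k (n + 1) * (-e1z - e2z)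
    rw [key]
    refine Submodule.add_mem _ (Submodule.sub_mem _ (Submodule.smul_mem _ _ h2)
      (Submodule.smul_mem _ _ h3)) (Submodule.smul_mem _ _ (Submodule.add_mem _ h4 h5))

theorem gegCd_sub_mem {k : ℝ} (hk : 0 ≤ k) (n : ℕ) :
    gegCd k n - (kap k n * n : ℂ) • (ez n - ez (-n)) ∈ lowerSpan n := by
  have h := (deriv_mem_lowerSpan (gegC_sub_mem hk n)).2
  convert h using 1
  funext z
  have : HasDerivAt (gegC k n - (kap k n : ℂ) • (ez n + ez (-n)))
      (gegCd k n z - (kap k n : ℂ) • (((n : ℤ) : ℂ) * ez n z + ((-n : ℤ) : ℂ) * ez (-n) z)) z :=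
    (hasDerivAt_gegC k n z).sub (((hasDerivAt_ez n z).add (hasDerivAt_ez (-n) z)).const_smul _)
  rw [this.deriv]
  simp only [Pi.smul_apply, Pi.sub_apply, smul_eq_mul]
  push_cast
  ring

/-- The span of the Gegenbauer functions and their derivatives of degree below `n`. -/
noncomputable def gegSpan (k : ℝ) (n : ℕ) : Submodule ℂ (ℂ → ℂ) :=
  Submodule.span ℂ {F | ∃ m < n, F = gegC k m ∨ F = gegCd k m}

theorem gegSpan_mono (k : ℝ) {m n : ℕ} (h : m ≤ n) : gegSpan k m ≤ gegSpan k n :=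
  Submodule.span_mono fun _ ⟨j, hj, hF⟩ => ⟨j, hj.trans_le h, hF⟩

/-- Modulo lower exponentials, `gegC` and `gegCd` are multiples of e^{nz} + e^{-nz} and n(e^{nz} -
e^{-nz}); solving this 2 × 2 system isolates each exponential. -/
theorem ez_add_sub_mem {k : ℝ} (hk : 0 ≤ k) {n : ℕ} (hn : 1 ≤ n) :
    (1 / (2 * kap k n) : ℂ) • (gegC k n + (1 / n : ℂ) • gegCd k n) - ez n ∈ lowerSpan n ∧
    (1 / (2 * kap k n) : ℂ) • (gegC k n - (1 / n : ℂ) • gegCd k n) - ez (-n) ∈ lowerSpan n := by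
  have h1 := gegC_sub_mem hk n
  have h2 := gegCd_sub_mem hk n
  have hκ : (kap k n : ℂ) ≠ 0 := by exact_mod_cast (kap_pos hk n).ne'
  have hn0 : (n : ℂ) ≠ 0 := by exact_mod_cast (by omega : n ≠ 0)
  constructor
  · convert Submodule.smul_mem _ (1 / (2 * kap k n) : ℂ)
      (Submodule.add_mem _ h1 (Submodule.smul_mem _ (1 / n : ℂ) h2)) using 1
    funext z
    simp only [Pi.smul_apply, Pi.add_apply, Pi.sub_apply, smul_eq_mul]
    field_simp
    ring
  · convert Submodule.smul_mem _ (1 / (2 * kap k n) : ℂ)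
      (Submodule.sub_mem _ h1 (Submodule.smul_mem _ (1 / n : ℂ) h2)) using 1
    funext z
    simp only [Pi.smul_apply, Pi.add_apply, Pi.sub_apply, smul_eq_mul]
    field_simp
    ring

theorem lowerSpan_le_gegSpan {k : ℝ} (hk : 0 ≤ k) (n : ℕ) : lowerSpan n ≤ gegSpan k n := by
  induction n using Nat.strong_induction_on with
  | _ n ih =>
    refine lowerSpan_le fun j hj => ?_
    rw [below_natCast] at hj
    have hm : j.natAbs < n := by have := hj.1; rw [Int.abs_eq_natAbs] at this; omega
    have hG : gegC k j.natAbs ∈ gegSpan k n := Submodule.subset_span ⟨_, hm, Or.inl rfl⟩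
    have hGd : gegCd k j.natAbs ∈ gegSpan k n := Submodule.subset_span ⟨_, hm, Or.inr rfl⟩
    rcases Nat.eq_zero_or_pos j.natAbs with h0 | h0
    · have hj0 : j = 0 := by omega
      subst hj0
      convert hG using 1
      funext z
      simp [gegC, geg, ez]
    · have h := ez_add_sub_mem hk h0
      have hle := (ih _ hm).trans (gegSpan_mono k hm.le)
      rcases Int.natAbs_eq j with hjj | hjj
      · rw [hjj]
        have h3 := Submodule.sub_mem _ (Submodule.smul_mem _ (1 / (2 * kap k j.natAbs) : ℂ)
          (Submodule.add_mem _ hG (Submodule.smul_mem _ (1 / j.natAbs : ℂ) hGd))) (hle h.1)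
        rwa [sub_sub_cancel] at h3
      · rw [hjj]
        have h3 := Submodule.sub_mem _ (Submodule.smul_mem _ (1 / (2 * kap k j.natAbs) : ℂ)
          (Submodule.sub_mem _ hG (Submodule.smul_mem _ (1 / j.natAbs : ℂ) hGd))) (hle h.2)
        rwa [sub_sub_cancel] at h3

theorem gegCd_continuous (k : ℝ) (n : ℕ) : Continuous (gegCd k n) := by
  unfold gegCd
  exact Complex.continuous_sinh.mul ((geg k n).derivative.continuous_aeval.comp
    Complex.continuous_cosh)

theorem gegC_continuous (k : ℝ) (n : ℕ) : Continuous (gegC k n) := by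
  unfold gegC
  exact (geg k n).continuous_aeval.comp Complex.continuous_cosh

/-- The continuous functions orthogonal to a given continuous function. -/
noncomputable def orth {k : ℝ} (hk : 0 ≤ k) {f : ℝ → ℂ} (hf : Continuous f) :
    Submodule ℂ (ℂ → ℂ) where
  carrier := {H | Continuous H ∧ innerK k f (fun x => H (Complex.I * x)) = 0}
  zero_mem' := ⟨continuous_const, by simp [innerK]⟩
  add_mem' := by
    rintro F H ⟨hF, hF0⟩ ⟨hH, hH0⟩
    refine ⟨hF.add hH, ?_⟩
    simp only [innerK, Pi.add_apply, map_add, mul_add] at hF0 hH0 ⊢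
    rw [integral_add, hF0, hH0, add_zero]
    · exact integrable_dm hk (hf.mul (Complex.continuous_conj.comp (by fun_prop)))
    · exact integrable_dm hk (hf.mul (Complex.continuous_conj.comp (by fun_prop)))
  smul_mem' := by
    rintro a F ⟨hF, hF0⟩
    refine ⟨hF.const_smul a, ?_⟩
    simp only [innerK, Pi.smul_apply, smul_eq_mul, map_mul] at hF0 ⊢
    simp_rw [mul_left_comm _ ((starRingEnd ℂ) a)]
    rw [integral_const_mul, hF0, mul_zero]

theorem integral_ofReal_dm (k : ℝ) (f : ℝ → ℝ) :
    ∫ x, (f x : ℂ) ∂(dm k) = ((∫ x, f x ∂(dm k) : ℝ) : ℂ) := integral_ofReal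

theorem integral_phi_mul_psi (k : ℝ) (n m : ℕ) :
    ∫ x, phi k n x * psi k m x ∂(dm k) = 0 :=
  integral_dm_odd k fun x => by simp

/-- The function `a φ + b ψ` built from `phi` and its derivative. -/
noncomputable def comb (k : ℝ) (n : ℕ) (a b : ℂ) (x : ℝ) : ℂ := a * phi k n x + b * psi k n x

@[fun_prop]
theorem continuous_comb (k : ℝ) (n : ℕ) (a b : ℂ) : Continuous (comb k n a b) := by
  unfold comb; fun_prop

theorem integral_comb_mul_comb {k : ℝ} (hk : 0 < k) (n m : ℕ) (a b c d : ℂ) :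
    ∫ x, comb k n a b x * comb k m c d x ∂(dm k)
      = a * c * ((∫ x, phi k n x * phi k m x ∂(dm k) : ℝ) : ℂ)
        + b * d * ((∫ x, psi k n x * psi k m x ∂(dm k) : ℝ) : ℂ) := by
  have h : ∀ x, comb k n a b x * comb k m c d x
      = a * c * ((phi k n x * phi k m x : ℝ) : ℂ) + b * d * ((psi k n x * psi k m x : ℝ) : ℂ)
        + (a * d * ((phi k n x * psi k m x : ℝ) : ℂ)
          + b * c * ((phi k m x * psi k n x : ℝ) : ℂ)) := by
    intro x
    simp only [comb]
    push_cast
    ring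
  simp_rw [h]
  rw [integral_add, integral_add, integral_add, integral_const_mul, integral_const_mul,
    integral_const_mul, integral_const_mul]
  · simp only [integral_ofReal_dm, integral_phi_mul_psi]
    simp
  all_goals exact integrable_dm hk.le (by fun_prop)

/-- Exponentials below n lie in the span of the Gegenbauer functions and their derivatives of degree
m < n, and φ_n, ψ_n are orthogonal to φ_m, ψ_m there; φ and ψ are mutually orthogonal by parity. -/
theorem innerK_ez_eq_zero {k : ℝ} (hk : 0 < k) (n : ℕ) (a b : ℂ) {j : ℤ} (hj : Below j n) :
    innerK k (comb k n a b) (fun x => ez j (Complex.I * x)) = 0 := by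
  have hle : gegSpan k n ≤ orth hk.le (continuous_comb k n a b) := by
    refine Submodule.span_le.mpr ?_
    rintro F ⟨m, hm, rfl | rfl⟩
    · refine ⟨gegC_continuous k m, ?_⟩
      have h := integral_comb_mul_comb hk n m a b 1 0
      rw [integral_phi_mul_phi_of_ne hk hm.ne'] at h
      simp only [innerK, gegC_I_mul, Complex.conj_ofReal]
      simpa [comb] using h
    · refine ⟨gegCd_continuous k m, ?_⟩
      have h := integral_comb_mul_comb hk n m a b 0 Complex.I
      rw [integral_psi_mul_psi_of_ne hk hm.ne'] at h
      simp only [innerK, gegCd_I_mul, map_neg, map_mul, Complex.conj_ofReal, Complex.conj_I]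
      simpa [comb] using h
  exact (hle (lowerSpan_le_gegSpan hk.le n (ez_mem_lowerSpan hj))).2

theorem E_eq_of_isNonsymmetric {k : ℝ} (hk : 0 ≤ k) {n : ℤ} {F : ℂ → ℂ}
    (h : IsNonsymmetric k n F) : E k n = F :=
  (existsUnique_nonsymmetric hk n).unique (isNonsymmetric_E hk n) h

theorem isNonsymmetric_pos {k : ℝ} (hk : 0 < k) {n : ℕ} (hn : 1 ≤ n) :
    IsNonsymmetric k n ((1 / (2 * kap k n) : ℂ) • (gegC k n + (1 / n : ℂ) • gegCd k n)) := by
  refine ⟨?_, fun j hj => ?_⟩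
  · obtain ⟨c, hc⟩ := exists_coeff_of_mem_lowerSpan (ez_add_sub_mem hk.le hn).1
    refine ⟨c, fun z => ?_⟩
    rw [← hc z, Pi.sub_apply, ez]
    ring
  · have h := innerK_ez_eq_zero hk n (1 / (2 * kap k n)) (-(Complex.I / (2 * kap k n * n))) hj
    simp only [innerK, ez, exp_I] at h ⊢
    rw [← h]
    congr 1
    funext x
    congr 1
    simp only [Pi.smul_apply, Pi.add_apply, smul_eq_mul, gegC_I_mul, gegCd_I_mul, comb]
    ring

theorem E_pos_apply {k : ℝ} (hk : 0 < k) {n : ℕ} (hn : 1 ≤ n) (x : ℝ) :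
    E k n (Complex.I * x)
      = (1 / (2 * kap k n) : ℂ) * comb k n 1 (-(Complex.I / n)) x := by
  rw [E_eq_of_isNonsymmetric hk.le (isNonsymmetric_pos hk hn)]
  simp only [Pi.smul_apply, Pi.add_apply, smul_eq_mul, gegC_I_mul, gegCd_I_mul, comb]
  ring

/-- The coefficient 1/(n+2k) is forced by orthogonality to the polynomial of index n, because ‖ψ_n‖²
= n(n+2k) ‖φ_n‖². The prefactor normalises the coefficient of e^{-nz}; that of e^{nz} becomes
k/(n+k). -/
theorem isNonsymmetric_neg {k : ℝ} (hk : 0 < k) {n : ℕ} (hn : 1 ≤ n) :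
    IsNonsymmetric k (-n) (((n + 2 * k) / (2 * kap k n * (n + k)) : ℂ) •
      (gegC k n - (1 / (n + 2 * k) : ℂ) • gegCd k n)) := by
  have hκ : (kap k n : ℂ) ≠ 0 := by exact_mod_cast (kap_pos hk.le n).ne'
  have hn0 : (n : ℂ) ≠ 0 := by exact_mod_cast (by omega : n ≠ 0)
  have hnr : (0 : ℝ) < n := by exact_mod_cast hn
  have h1 : (n : ℂ) + k ≠ 0 := by
    have : (n : ℝ) + k ≠ 0 := by positivity
    exact_mod_cast this
  have h2 : (n : ℂ) + 2 * k ≠ 0 := by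
    have : (n : ℝ) + 2 * k ≠ 0 := by positivity
    exact_mod_cast this
  have hle : lowerSpan n ≤ lowerSpan (-n) := lowerSpan_le fun j hj =>
    ez_mem_lowerSpan ((below_neg_natCast hn).mpr (Or.inl hj))
  have hmem := ez_add_sub_mem hk.le hn
  have hcomb : ∀ x : ℝ, (((n + 2 * k) / (2 * kap k n * (n + k)) : ℂ) •
      (gegC k n - (1 / (n + 2 * k) : ℂ) • gegCd k n)) (Complex.I * x)
      = comb k n ((n + 2 * k) / (2 * kap k n * (n + k)))
        (Complex.I / (2 * kap k n * (n + k))) x := by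
    intro x
    simp only [Pi.smul_apply, Pi.sub_apply, smul_eq_mul, gegC_I_mul, gegCd_I_mul, comb]
    field_simp
    ring
  refine ⟨?_, fun j hj => ?_⟩
  · have hmem2 : ((n + 2 * k) / (2 * kap k n * (n + k)) : ℂ) •
        (gegC k n - (1 / (n + 2 * k) : ℂ) • gegCd k n) - ez (-n) ∈ lowerSpan (-n) := by
      have h3 : ez n ∈ lowerSpan (-n) :=
        ez_mem_lowerSpan ((below_neg_natCast hn).mpr (Or.inr rfl))
      convert Submodule.add_mem _ (Submodule.add_mem _ (hle hmem.2)
        (Submodule.smul_mem _ (k / (n + k) : ℂ) (hle hmem.1)))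
        (Submodule.smul_mem _ (k / (n + k) : ℂ) h3) using 1
      funext z
      simp only [Pi.smul_apply, Pi.add_apply, Pi.sub_apply, smul_eq_mul]
      field_simp
      ring
    obtain ⟨c, hc⟩ := exists_coeff_of_mem_lowerSpan hmem2
    refine ⟨c, fun z => ?_⟩
    rw [← hc z, Pi.sub_apply, ez]
    push_cast
    ring
  · have hexp : (fun x : ℝ => Complex.exp (Complex.I * (j * x)))
        = fun x : ℝ => ez j (Complex.I * x) := by
      funext x; rw [ez, exp_I]
    simp_rw [hcomb, hexp]
    rcases (below_neg_natCast hn).mp hj with hj | rfl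
    · exact innerK_ez_eq_zero hk n _ _ hj
    -- Modulo `lowerSpan n`, whose elements are already orthogonal, e^{nz} equals the polynomial of
    -- index n, so orthogonality is tested on the latter.
    · have hO : ∀ w ∈ lowerSpan n, w ∈ orth hk.le (continuous_comb k n
          ((n + 2 * k) / (2 * kap k n * (n + k))) (Complex.I / (2 * kap k n * (n + k)))) := by
        refine fun w hw => lowerSpan_le (fun j hj => ?_) hw
        exact ⟨by unfold ez; fun_prop, innerK_ez_eq_zero hk n _ _ hj⟩
      have hE : (1 / (2 * kap k n) : ℂ) • (gegC k n + (1 / n : ℂ) • gegCd k n) ∈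
          orth hk.le (continuous_comb k n
          ((n + 2 * k) / (2 * kap k n * (n + k))) (Complex.I / (2 * kap k n * (n + k)))) := by
        refine ⟨((gegC_continuous k n).add ((gegCd_continuous k n).const_smul _)).const_smul _, ?_⟩
        have h := integral_comb_mul_comb hk n n ((n + 2 * k) / (2 * kap k n * (n + k)))
          (Complex.I / (2 * kap k n * (n + k))) (1 / (2 * kap k n))
          (Complex.I / (2 * kap k n * n))
        rw [← eigen_mul_integral_phi_mul_phi hk] at h
        rw [innerK]
        convert h using 1
        · congr 1
          funext x
          congr 1
          simp only [Pi.smul_apply, Pi.add_apply, smul_eq_mul, gegC_I_mul, gegCd_I_mul, comb,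
            map_mul, map_add, map_div₀, map_one, map_neg, Complex.conj_ofReal, Complex.conj_I,
            Complex.conj_natCast, map_ofNat]
          ring
        · push_cast
          field_simp
          rw [Complex.I_sq]
          ring
      have := Submodule.sub_mem _ hE (hO _ hmem.1)
      rw [sub_sub_cancel] at this
      exact this.2

theorem E_neg_apply {k : ℝ} (hk : 0 < k) {n : ℕ} (hn : 1 ≤ n) (x : ℝ) :
    E k (-n) (Complex.I * x)
      = ((n + 2 * k) / (2 * kap k n * (n + k)) : ℂ) *
        comb k n 1 (Complex.I / (n + 2 * k)) x := by
  rw [E_eq_of_isNonsymmetric hk.le (isNonsymmetric_neg hk hn)]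
  simp only [Pi.smul_apply, Pi.sub_apply, smul_eq_mul, gegC_I_mul, gegCd_I_mul, comb]
  ring

/-! ### Terms of the series of an even function -/

theorem gam_sq_of_comb {k : ℝ} (hk : 0 < k) (n : ℕ) {m : ℤ} {r s : ℝ}
    (h : ∀ x : ℝ, E k m (Complex.I * x) = (r : ℂ) * comb k n 1 (Complex.I * s) x) :
    (gam k m : ℂ) ^ 2 = ((r ^ 2 * (1 + s ^ 2 * (n * (n + 2 * k))) * phiSq k n : ℝ) : ℂ)⁻¹ := by
  have h1 : ∫ x : ℝ, ‖E k m (Complex.I * x)‖ ^ 2 ∂(dm k)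
      = r ^ 2 * (1 + s ^ 2 * (n * (n + 2 * k))) * phiSq k n := by
    have h2 : ∀ x : ℝ, ‖E k m (Complex.I * x)‖ ^ 2
        = r ^ 2 * phi k n x ^ 2 + r ^ 2 * s ^ 2 * psi k n x ^ 2 := by
      intro x
      rw [h, ← Complex.normSq_eq_norm_sq, Complex.normSq_apply, comb]
      simp
      ring
    simp_rw [h2]
    rw [integral_add, integral_const_mul, integral_const_mul, integral_psi_sq hk]
    · simp only [phiSq]; ring
    all_goals exact integrable_dm_real hk.le (by fun_prop)
  have h0 : 0 ≤ ∫ x : ℝ, ‖E k m (Complex.I * x)‖ ^ 2 ∂(dm k) :=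
    integral_nonneg fun x => by positivity
  rw [← Complex.ofReal_pow, gam, inv_pow, Real.sq_sqrt h0, h1, Complex.ofReal_inv]

/-- For even g the integral against ψ_n vanishes, and the normalising factor r cancels against
`gam`. -/
theorem term_of_even {k : ℝ} (hk : 0 < k) (n : ℕ) {m : ℤ} {r s : ℝ}
    (h : ∀ x : ℝ, E k m (Complex.I * x) = (r : ℂ) * comb k n 1 (Complex.I * s) x) {g : ℝ → ℂ}
    (hg : Integrable g (dm k)) (hgeven : ∀ x, g (-x) = g x) (hr : r ≠ 0) (x : ℝ) :
    term k g m x = (∫ y, g y * phi k n y ∂(dm k)) /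
      (((1 + s ^ 2 * (n * (n + 2 * k))) * phiSq k n : ℝ) : ℂ) * comb k n 1 (Complex.I * s) x := by
  have h1 : ∀ y : ℝ, g y * E k m (-(Complex.I * y))
      = r * (g y * phi k n y) - r * Complex.I * s * (g y * psi k n y) := by
    intro y
    have := h (-y)
    rw [Complex.ofReal_neg, mul_neg] at this
    rw [this, comb, phi_neg, psi_neg]
    push_cast
    ring
  have hbdd : ∀ {q : ℝ → ℝ}, Continuous q → Integrable (fun y => g y * (q y : ℂ)) (dm k) := by
    intro q hq
    obtain ⟨C, hC⟩ := (isCompact_Icc (a := -Real.pi) (b := Real.pi)).exists_bound_of_continuousOn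
      hq.continuousOn
    refine hg.mul_bdd (c := C) (Complex.continuous_ofReal.comp hq).aestronglyMeasurable ?_
    refine (withDensity_absolutelyContinuous _ _).ae_le ?_
    refine (ae_restrict_iff' measurableSet_Icc).mpr (Eventually.of_forall fun y hy => ?_)
    simpa using hC y hy
  have h2 : ∫ y, g y * psi k n y ∂(dm k) = 0 := integral_dm_odd k fun y => by
    rw [hgeven, psi_neg]; push_cast; ring
  have hr' : (r : ℂ) ≠ 0 := by exact_mod_cast hr
  rw [term, coeff, gam_sq_of_comb hk n h, h]
  simp_rw [h1]
  rw [integral_sub ((hbdd (continuous_phi k n)).const_mul _)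
    ((hbdd (continuous_psi k n)).const_mul _), integral_const_mul, integral_const_mul, h2]
  push_cast
  -- When the denominator vanishes both sides are 0, by the convention for division by zero.
  by_cases h0 : (1 + (s : ℂ) ^ 2 * (n * (n + 2 * k))) * phiSq k n = 0
  · rw [mul_assoc ((r : ℂ) ^ 2), h0]; simp
  · field_simp
    ring

/-- For even `g` the two terms of degree `±n` add up to the projection on `phi k n`. -/
theorem term_add_term_neg {k : ℝ} (hk : 0 < k) {n : ℕ} (hn : 1 ≤ n) {g : ℝ → ℂ}
    (hg : Integrable g (dm k)) (hgeven : ∀ x, g (-x) = g x) (x : ℝ) :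
    term k g n x + term k g (-n) x
      = (∫ y, g y * phi k n y ∂(dm k)) / phiSq k n * phi k n x := by
  have hnr : (0 : ℝ) < n := by exact_mod_cast hn
  have hκ := kap_pos hk.le n
  have hn0 : (n : ℂ) ≠ 0 := by exact_mod_cast (by omega : n ≠ 0)
  have h1 : (n : ℂ) + k ≠ 0 := by
    have : (n : ℝ) + k ≠ 0 := by positivity
    exact_mod_cast this
  have h2 : (n : ℂ) + 2 * k ≠ 0 := by
    have : (n : ℝ) + 2 * k ≠ 0 := by positivity
    exact_mod_cast this
  have h3 : (phiSq k n : ℂ) ≠ 0 := by exact_mod_cast (phiSq_pos hk n).ne'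
  rw [term_of_even hk n (r := 1 / (2 * kap k n)) (s := -(1 / n))
      (fun x => by rw [E_pos_apply hk hn]; push_cast; congr 2; ring) hg hgeven (by positivity),
    term_of_even hk n (r := (n + 2 * k) / (2 * kap k n * (n + k))) (s := 1 / (n + 2 * k))
      (fun x => by rw [E_neg_apply hk hn]; push_cast; congr 2; ring) hg hgeven (by positivity)]
  have h4 : (n : ℂ) + (n + 2 * k) ≠ 0 := by
    have : (n : ℝ) + (n + 2 * k) ≠ 0 := by positivity
    exact_mod_cast this
  -- The two φ_n parts get weights n/(2(n+k)) and (n+2k)/(2(n+k)), which sum to 1; the ψ_n parts get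
  -- opposite coefficients.
  have e1 : (((1 + (-(1 / n : ℝ)) ^ 2 * (n * (n + 2 * k))) * phiSq k n : ℝ) : ℂ)
      = 2 * (n + k) / n * phiSq k n := by
    push_cast; field_simp; ring
  have e2 : (((1 + (1 / (n + 2 * k) : ℝ) ^ 2 * (n * (n + 2 * k))) * phiSq k n : ℝ) : ℂ)
      = 2 * (n + k) / (n + 2 * k) * phiSq k n := by
    push_cast; field_simp; ring
  rw [e1, e2, comb, comb]
  push_cast
  field_simp
  ring

/-! ### The endpoint exponents and the integrability of f -/

theorem two_sub_eq {k : ℝ} (hk : 0 ≤ k) :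
    (2 : ℝ≥0∞) - 1 / (ENNReal.ofReal k + 1) = ENNReal.ofReal ((2 * k + 1) / (k + 1)) := by
  have h1 : ENNReal.ofReal k + 1 = ENNReal.ofReal (k + 1) := by
    rw [ENNReal.ofReal_add hk zero_le_one, ENNReal.ofReal_one]
  rw [h1, ← ENNReal.ofReal_one, ← ENNReal.ofReal_div_of_pos (by positivity),
    show (2 : ℝ≥0∞) = ENNReal.ofReal 2 by norm_num, ← ENNReal.ofReal_sub _ (by positivity)]
  congr 1
  field_simp
  ring

theorem two_add_eq {k : ℝ} (hk : 0 < k) :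
    (2 : ℝ≥0∞) + 1 / ENNReal.ofReal k = ENNReal.ofReal ((2 * k + 1) / k) := by
  rw [← ENNReal.ofReal_one, ← ENNReal.ofReal_div_of_pos hk,
    show (2 : ℝ≥0∞) = ENNReal.ofReal 2 by norm_num,
    ← ENNReal.ofReal_add (by norm_num) (by positivity)]
  congr 1
  field_simp

theorem integrable_dm_iff {k : ℝ} {f : ℝ → ℝ} :
    Integrable f (dm k) ↔
      IntegrableOn (fun x => |Real.sin x| ^ (2 * k) * f x) (Set.Icc (-Real.pi) Real.pi) := by
  rw [dm, integrable_withDensity_iff_integrable_smul' (measurable_density k).ennreal_ofReal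
    (Eventually.of_forall fun _ => ENNReal.ofReal_lt_top), IntegrableOn]
  refine integrable_congr (Eventually.of_forall fun x => ?_)
  simp only [smul_eq_mul]
  rw [ENNReal.toReal_ofReal (by positivity)]

theorem integrableOn_abs_rpow {s : ℝ} (hs : -1 < s) (R : ℝ) (hR : 0 ≤ R) :
    IntegrableOn (fun x : ℝ => |x| ^ s) (Set.Icc (-R) R) := by
  have h1 : IntervalIntegrable (fun x : ℝ => |x| ^ s) volume 0 R := by
    refine (intervalIntegral.intervalIntegrable_rpow' (a := 0) (b := R) hs).congr_uIoo ?_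
    intro x hx
    rw [Set.uIoo_of_le hR] at hx
    simp only [abs_of_pos hx.1]
  have h2 : IntervalIntegrable (fun x : ℝ => |x| ^ s) volume (-R) 0 := by
    have := ((IntervalIntegrable.iff_comp_neg (by simp)).mp h1).symm
    simpa using this
  exact (intervalIntegrable_iff_integrableOn_Icc_of_le (by linarith)).mp (h2.trans h1)

/-- The real-valued function underlying `cex`. -/
noncomputable def cexR (k : ℝ) (x : ℝ) : ℝ := (1 - Real.cos x) ^ (-(k + 1) / 2)

theorem cex_eq (k x : ℝ) : cex k x = (cexR k x : ℂ) := rfl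

theorem cexR_nonneg (k x : ℝ) : 0 ≤ cexR k x :=
  Real.rpow_nonneg (by linarith [Real.cos_le_one x]) _

theorem measurable_cexR (k : ℝ) : Measurable (cexR k) := by
  unfold cexR; fun_prop

theorem abs_rpow_two_mul (x s : ℝ) : |x| ^ (2 * s) = (x ^ 2) ^ s := by
  rw [Real.rpow_mul (abs_nonneg _), ← sq_abs x]; norm_num

theorem cexR_le {k x : ℝ} (hk : 0 < k) (hx : |x| ≤ Real.pi) (hx0 : x ≠ 0) :
    cexR k x ≤ (2 / Real.pi ^ 2) ^ (-(k + 1) / 2) * |x| ^ (-(k + 1)) := by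
  have h1 := Real.cos_le_one_sub_mul_cos_sq hx
  have hx2 : 0 < x ^ 2 := by positivity
  have h2 : |x| ^ (-(k + 1)) = (x ^ 2) ^ (-(k + 1) / 2) := by
    rw [← abs_rpow_two_mul]; congr 1; ring
  rw [h2, ← Real.mul_rpow (by positivity) hx2.le]
  exact Real.rpow_le_rpow_of_nonpos (by positivity) (by linarith) (by linarith)

theorem le_cexR {k x : ℝ} (hk : 0 < k) (hx : |x| ≤ Real.pi) (hx0 : x ≠ 0) :
    (1 / 2 : ℝ) ^ (-(k + 1) / 2) * |x| ^ (-(k + 1)) ≤ cexR k x := by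
  have h1 := Real.cos_le_one_sub_mul_cos_sq hx
  have h3 := Real.one_sub_sq_div_two_le_cos (x := x)
  have hx2 : 0 < x ^ 2 := by positivity
  have h2 : |x| ^ (-(k + 1)) = (x ^ 2) ^ (-(k + 1) / 2) := by
    rw [← abs_rpow_two_mul]; congr 1; ring
  rw [h2, ← Real.mul_rpow (by positivity) hx2.le]
  have h4 : 0 < 2 / Real.pi ^ 2 * x ^ 2 := by positivity
  exact Real.rpow_le_rpow_of_nonpos (by linarith) (by linarith) (by linarith)

/-- On [-π, π] the integrand times the density is O(|x|^{2k-(k+1)q}), and the condition on q says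
that this exponent exceeds -1. -/
theorem integrable_cexR_rpow {k q : ℝ} (hk : 0 < k) (hq : 0 ≤ q)
    (hq1 : q < (2 * k + 1) / (k + 1)) : Integrable (fun x => cexR k x ^ q) (dm k) := by
  rw [lt_div_iff₀ (by positivity)] at hq1
  rw [integrable_dm_iff]
  have hs : -1 < 2 * k - (k + 1) * q := by linarith
  refine ((integrableOn_abs_rpow hs Real.pi Real.pi_pos.le).const_mul
    (((2 / Real.pi ^ 2) ^ (-(k + 1) / 2)) ^ q)).mono' ?_ ?_
  · exact ((measurable_density k).mul ((measurable_cexR k).pow_const q)).aestronglyMeasurable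
  · filter_upwards [ae_restrict_mem measurableSet_Icc, ae_restrict_of_ae
      (Measure.ae_ne volume (0 : ℝ))] with x hx hx0
    have hx' : |x| ≤ Real.pi := abs_le.mpr hx
    have hxp : 0 < |x| := abs_pos.mpr hx0
    rw [Real.norm_of_nonneg (mul_nonneg (by positivity) (Real.rpow_nonneg (cexR_nonneg k x) _))]
    have h1 : |Real.sin x| ^ (2 * k) ≤ |x| ^ (2 * k) :=
      Real.rpow_le_rpow (abs_nonneg _) Real.abs_sin_le_abs (by positivity)
    have h2 := Real.rpow_le_rpow (cexR_nonneg k x) (cexR_le hk hx' hx0) hq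
    rw [Real.mul_rpow (by positivity) (by positivity), ← Real.rpow_mul (abs_nonneg x)] at h2
    calc |Real.sin x| ^ (2 * k) * cexR k x ^ q
        ≤ |x| ^ (2 * k) * (((2 / Real.pi ^ 2) ^ (-(k + 1) / 2)) ^ q * |x| ^ (-(k + 1) * q)) :=
          mul_le_mul h1 h2 (Real.rpow_nonneg (cexR_nonneg k x) _) (by positivity)
      _ = ((2 / Real.pi ^ 2) ^ (-(k + 1) / 2)) ^ q * |x| ^ (2 * k - (k + 1) * q) := by
          rw [sub_eq_add_neg, Real.rpow_add hxp]; ring_nf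

/-- At the endpoint exponent the integrand times the density dominates a multiple of 1/x on (0, 1].
-/
theorem not_integrable_cexR_rpow {k : ℝ} (hk : 0 < k) :
    ¬ Integrable (fun x => cexR k x ^ ((2 * k + 1) / (k + 1))) (dm k) := by
  rw [integrable_dm_iff]
  intro h
  set q := (2 * k + 1) / (k + 1) with hq
  have hq0 : 0 ≤ q := by positivity
  have hqk : (k + 1) * q = 2 * k + 1 := by rw [hq]; field_simp
  set c : ℝ := (2 / Real.pi) ^ (2 * k) * ((1 / 2 : ℝ) ^ (-(k + 1) / 2)) ^ q with hc
  have hc0 : 0 < c := by positivity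
  have hsub : Set.Icc (0 : ℝ) 1 ⊆ Set.Icc (-Real.pi) Real.pi :=
    Set.Icc_subset_Icc (by linarith [Real.pi_pos]) (by linarith [Real.pi_gt_three])
  have h1 : IntegrableOn (fun x : ℝ => c * x⁻¹) (Set.Icc 0 1) := by
    refine (h.mono_set hsub).mono' (by fun_prop) ?_
    filter_upwards [ae_restrict_mem measurableSet_Icc, ae_restrict_of_ae
      (Measure.ae_ne volume (0 : ℝ))] with x hx hx0
    have hxp : 0 < x := lt_of_le_of_ne hx.1 hx0.symm
    have hx' : |x| ≤ Real.pi := abs_le.mpr (hsub hx)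
    rw [Real.norm_of_nonneg (by positivity)]
    have h2 := Real.mul_le_sin hx.1 (by linarith [hx.2, Real.pi_gt_three])
    have h3 : (2 / Real.pi * x) ^ (2 * k) ≤ |Real.sin x| ^ (2 * k) :=
      Real.rpow_le_rpow (by positivity) (h2.trans (le_abs_self _)) (by positivity)
    have h4 := Real.rpow_le_rpow (by positivity) (le_cexR hk hx' hx0) hq0
    rw [Real.mul_rpow (by positivity) (by positivity), ← Real.rpow_mul (abs_nonneg x),
      abs_of_pos hxp, neg_mul, hqk] at h4
    rw [Real.mul_rpow (by positivity) hxp.le] at h3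
    refine le_trans (le_of_eq ?_) (mul_le_mul h3 h4 (by positivity) (by positivity))
    have h5 : x⁻¹ = x ^ (2 * k) * x ^ (-(2 * k + 1)) := by
      rw [← Real.rpow_add hxp, ← Real.rpow_neg_one]; congr 1; ring
    rw [hc, h5]
    ring
  have h2 : IntervalIntegrable (fun x : ℝ => x⁻¹) volume 0 1 := by
    rw [intervalIntegrable_iff_integrableOn_Icc_of_le zero_le_one]
    have := h1.const_mul c⁻¹
    refine this.congr (Eventually.of_forall fun x => ?_)
    field_simp
  rw [intervalIntegrable_inv_iff] at h2
  simp at h2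

theorem memLp_cex_iff {k : ℝ} (hk : 0 < k) {p : ℝ≥0∞} (hp1 : 1 ≤ p) :
    MemLp (cex k) p (dm k) ↔ p < 2 - 1 / (ENNReal.ofReal k + 1) := by
  have := isFiniteMeasure_dm hk.le
  have hm : AEStronglyMeasurable (cex k) (dm k) :=
    (Complex.measurable_ofReal.comp (measurable_cexR k)).aestronglyMeasurable
  have hn : ∀ x, ‖cex k x‖ = cexR k x := fun x => by
    rw [cex_eq, Complex.norm_real, Real.norm_of_nonneg (cexR_nonneg k x)]
  rw [two_sub_eq hk.le]
  have hq0 : 0 < (2 * k + 1) / (k + 1) := by positivity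
  constructor
  · intro h
    by_contra! hle
    -- The measure is finite, so membership for a larger exponent implies it at the endpoint
    -- exponent.
    have h1 := h.mono_exponent hle
    rw [← integrable_norm_rpow_iff hm (by simpa using hq0) ENNReal.ofReal_ne_top,
      ENNReal.toReal_ofReal hq0.le] at h1
    simp_rw [hn] at h1
    exact not_integrable_cexR_rpow hk h1
  · intro h
    have hpt : p ≠ ∞ := ne_top_of_lt h
    have hp0 : p ≠ 0 := (zero_lt_one.trans_le hp1).ne'
    rw [← integrable_norm_rpow_iff hm hp0 hpt]
    simp_rw [hn]
    refine integrable_cexR_rpow hk ENNReal.toReal_nonneg ?_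
    rwa [ENNReal.lt_ofReal_iff_toReal_lt hpt] at h

theorem integrable_cexR {k : ℝ} (hk : 0 < k) : Integrable (cexR k) (dm k) := by
  have h : (1 : ℝ) < (2 * k + 1) / (k + 1) := by
    rw [lt_div_iff₀ (by positivity)]; linarith
  simpa using integrable_cexR_rpow hk zero_le_one h

theorem integrable_cexR_mul {k : ℝ} (hk : 0 < k) {q : ℝ → ℝ} (hq : Continuous q) :
    Integrable (fun x => cexR k x * q x) (dm k) := by
  obtain ⟨C, hC⟩ := (isCompact_Icc (a := -Real.pi) (b := Real.pi)).exists_bound_of_continuousOn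
    hq.continuousOn
  refine (integrable_cexR hk).mul_bdd (c := C) hq.aestronglyMeasurable ?_
  refine (withDensity_absolutelyContinuous _ _).ae_le ?_
  exact (ae_restrict_iff' measurableSet_Icc).mpr (Eventually.of_forall fun y hy => hC y hy)

theorem one_sub_cos_pos {x : ℝ} (hx : |x| ≤ Real.pi) (hx0 : x ≠ 0) : 0 < 1 - Real.cos x := by
  have h1 := Real.cos_le_one_sub_mul_cos_sq hx
  have h4 : 0 < 2 / Real.pi ^ 2 * x ^ 2 := by positivity
  linarith

theorem hasDerivAt_cexR {k x : ℝ} (hx : 0 < 1 - Real.cos x) :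
    HasDerivAt (cexR k) (-((k + 1) / 2) * (Real.sin x / (1 - Real.cos x)) * cexR k x) x := by
  refine (((Real.hasDerivAt_cos x).const_sub 1).rpow_const (Or.inl hx.ne')).congr_deriv ?_
  rw [Real.rpow_sub_one hx.ne', cexR]
  ring

/-- The only problem is at 0, where the function is O(|x|^k); this makes the boundary function of
the next integration by parts continuous despite the singularity of f. -/
theorem continuousOn_sin_mul_cexR {k : ℝ} (hk : 0 < k) :
    ContinuousOn (fun x => |Real.sin x| ^ (2 * k) * Real.sin x * cexR k x)
      (Set.Icc (-Real.pi) Real.pi) := by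
  have hw : Continuous fun x : ℝ => |Real.sin x| ^ (2 * k) :=
    Real.continuous_sin.abs.rpow_const fun _ => Or.inr (by positivity)
  intro x hx
  have hx' : |x| ≤ Real.pi := abs_le.mpr hx
  rcases eq_or_ne x 0 with rfl | hx0
  · rw [ContinuousWithinAt]
    simp only [Real.sin_zero, mul_zero, zero_mul]
    have hlim : Tendsto (fun y : ℝ => (2 / Real.pi ^ 2) ^ (-(k + 1) / 2) * |y| ^ k)
        (𝓝[Set.Icc (-Real.pi) Real.pi] 0) (𝓝 0) := by
      have : Continuous fun y : ℝ => (2 / Real.pi ^ 2) ^ (-(k + 1) / 2) * |y| ^ k :=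
        continuous_const.mul (continuous_abs.rpow_const fun _ => Or.inr hk.le)
      have h := this.tendsto 0
      rw [abs_zero, Real.zero_rpow hk.ne', mul_zero] at h
      exact h.mono_left nhdsWithin_le_nhds
    refine squeeze_zero_norm' ?_ hlim
    filter_upwards [self_mem_nhdsWithin] with y hy
    rcases eq_or_ne y 0 with rfl | hy0
    · simp; positivity
    · have hyp : 0 < |y| := abs_pos.mpr hy0
      rw [norm_mul, norm_mul, Real.norm_of_nonneg (cexR_nonneg k y), Real.norm_eq_abs,
        Real.norm_eq_abs, abs_of_nonneg (by positivity : 0 ≤ |Real.sin y| ^ (2 * k))]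
      have h1 : |Real.sin y| ^ (2 * k) ≤ |y| ^ (2 * k) :=
        Real.rpow_le_rpow (abs_nonneg _) Real.abs_sin_le_abs (by positivity)
      have h2 := cexR_le hk (abs_le.mpr hy) hy0
      calc |Real.sin y| ^ (2 * k) * |Real.sin y| * cexR k y
          ≤ |y| ^ (2 * k) * |y| * ((2 / Real.pi ^ 2) ^ (-(k + 1) / 2) * |y| ^ (-(k + 1))) :=
            mul_le_mul (mul_le_mul h1 Real.abs_sin_le_abs (abs_nonneg _) (by positivity)) h2
              (cexR_nonneg k y) (by positivity)
        _ = (2 / Real.pi ^ 2) ^ (-(k + 1) / 2) * |y| ^ k := by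
            have : |y| ^ k = |y| ^ (2 * k) * |y| * |y| ^ (-(k + 1)) := by
              rw [← Real.rpow_add_one hyp.ne', ← Real.rpow_add hyp]; congr 1; ring
            rw [this]; ring
  · have := (hasDerivAt_cexR (k := k) (one_sub_cos_pos hx' hx0)).continuousAt
    have h2 : ContinuousAt (fun x : ℝ => |Real.sin x| ^ (2 * k) * Real.sin x) x := by fun_prop
    exact (h2.mul this).continuousWithinAt

/-! ### Moments of f against the Gegenbauer polynomials -/

/-- The moments of `cexR` against the Gegenbauer polynomials. -/
noncomputable def cexMoment (k : ℝ) (n : ℕ) : ℝ := ∫ x, cexR k x * phi k n x ∂(dm k)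

/-- The integration by parts of the eigenvalue identity with f in place of φ_m. Since f' =
-((k+1)/2) (sin/(1-cos)) f and sin²/(1-cos) = 1 + cos, the singular quotient disappears. -/
theorem eigen_mul_cexMoment {k : ℝ} (hk : 0 < k) (n : ℕ) :
    n * (n + 2 * k) * cexMoment k n = (k + 1) / 2 *
      ∫ x, cexR k x * ((1 + Real.cos x) * gd k n (Real.cos x)) ∂(dm k) := by
  have hi1 := integrable_cexR_mul hk (continuous_phi k n)
  have hi2 := integrable_cexR_mul hk
    (q := fun x => (1 + Real.cos x) * gd k n (Real.cos x)) (by fun_prop)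
  have hi := (hi1.const_mul (n * (n + 2 * k))).sub (hi2.const_mul ((k + 1) / 2))
  have h0 : ∫ x, (n * (n + 2 * k) * (cexR k x * phi k n x) - (k + 1) / 2 *
      (cexR k x * ((1 + Real.cos x) * gd k n (Real.cos x)))) ∂(dm k) = 0 := by
    rw [integral_dm, MeasureTheory.integral_eq_of_hasDerivAt_off_countable
      (fun x => |Real.sin x| ^ (2 * k) * Real.sin x * cexR k x * gd k n (Real.cos x)) _
      countable_sin_eq_zero]
    · simp
    · rw [Set.uIcc_of_le (by linarith [Real.pi_pos])]
      exact (continuousOn_sin_mul_cexR hk).mul (by fun_prop)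
    · intro x hx
      have hs : Real.sin x ≠ 0 := hx.2
      have hx1 : |x| ≤ Real.pi := by
        have := hx.1
        rw [min_eq_left (by linarith [Real.pi_pos]), max_eq_right (by linarith [Real.pi_pos])]
          at this
        exact abs_le.mpr ⟨this.1.le, this.2.le⟩
      have hx0 : x ≠ 0 := by rintro rfl; simp at hs
      have hc := one_sub_cos_pos hx1 hx0
      refine ((((hasDerivAt_abs_sin_rpow hs).mul (Real.hasDerivAt_sin x)).mul
        (hasDerivAt_cexR hc)).mul ((hasDerivAt_gd k n (Real.cos x)).comp x
          (Real.hasDerivAt_cos x))).congr_deriv ?_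
      have h3 := geg_ode hk n (Real.cos x)
      have h4 := Real.sin_sq_add_cos_sq x
      have h5 : Real.sin x * (Real.sin x / (1 - Real.cos x)) = 1 + Real.cos x := by
        field_simp; linarith
      have h6 : Real.cos x / Real.sin x * Real.sin x = Real.cos x := by field_simp
      simp only [Pi.mul_apply, smul_eq_mul, Function.comp, phi]
      linear_combination (-(|Real.sin x| ^ (2 * k) * cexR k x)) * h3
        - |Real.sin x| ^ (2 * k) * cexR k x * gdd k n (Real.cos x) * h4
        - |Real.sin x| ^ (2 * k) * cexR k x * gd k n (Real.cos x) * ((k + 1) / 2) * h5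
        + |Real.sin x| ^ (2 * k) * cexR k x * gd k n (Real.cos x) * (2 * k) * h6
    · rw [intervalIntegrable_iff_integrableOn_Icc_of_le (by linarith [Real.pi_pos])]
      exact integrable_dm_iff.mp hi
  rw [integral_sub (hi1.const_mul _) (hi2.const_mul _), integral_const_mul,
    integral_const_mul] at h0
  rw [cexMoment]
  linarith

/-- Combining the preceding identity at n and n + 1 through `one_add_mul_gd` eliminates the
integrals of derivatives. -/
theorem cexMoment_succ {k : ℝ} (hk : 0 < k) (n : ℕ) :
    (n + (k + 1) / 2 + k) * cexMoment k (n + 1) = (n + (k + 1) / 2) * cexMoment k n := by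
  have h1 := eigen_mul_cexMoment hk n
  have h2 := eigen_mul_cexMoment hk (n + 1)
  have hi := fun m => integrable_cexR_mul hk
    (q := fun x => (1 + Real.cos x) * gd k m (Real.cos x)) (by fun_prop)
  have h3 : (2 * k + n) * (∫ x, cexR k x * ((1 + Real.cos x) * gd k (n + 1) (Real.cos x)) ∂(dm k))
      - (n + 1) * ∫ x, cexR k x * ((1 + Real.cos x) * gd k n (Real.cos x)) ∂(dm k)
      = (n + 1) * (2 * k + n) * (cexMoment k (n + 1) + cexMoment k n) := by
    rw [cexMoment, cexMoment, ← integral_add (integrable_cexR_mul hk (by fun_prop))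
      (integrable_cexR_mul hk (by fun_prop)), ← integral_const_mul, ← integral_const_mul,
      ← integral_const_mul, ← integral_sub ((hi _).const_mul _) ((hi _).const_mul _)]
    congr 1
    funext x
    have := one_add_mul_gd hk n (Real.cos x)
    simp only [phi]
    linear_combination cexR k x * this
  have hne : ((n : ℝ) + 1) * (2 * k + n) ≠ 0 := by positivity
  apply mul_left_cancel₀ hne
  push_cast at h2
  linear_combination (2 * k + n) * h2 - (n + 1) * h1 + (k + 1) / 2 * h3

theorem cexMoment_zero_pos {k : ℝ} (hk : 0 < k) : 0 < cexMoment k 0 := by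
  have := isFiniteMeasure_dm hk.le
  have h1 : 0 < phiSq k 0 := phiSq_pos hk 0
  have h2 : (2 : ℝ) ^ (-(k + 1) / 2) * phiSq k 0 ≤ cexMoment k 0 := by
    rw [phiSq, cexMoment, ← integral_const_mul]
    refine integral_mono_ae ((integrable_dm_real hk.le (by fun_prop)).const_mul _)
      (integrable_cexR_mul hk (by fun_prop)) ?_
    refine (withDensity_absolutelyContinuous _ _).ae_le ?_
    filter_upwards [ae_restrict_mem measurableSet_Icc, ae_restrict_of_ae
      (Measure.ae_ne volume (0 : ℝ))] with x hx hx0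
    have hc := one_sub_cos_pos (abs_le.mpr hx) hx0
    simp only [phi, gv_zero, one_pow, mul_one]
    exact Real.rpow_le_rpow_of_nonpos hc (by linarith [Real.neg_one_le_cos x]) (by linarith)
  exact (by positivity : 0 < (2 : ℝ) ^ (-(k + 1) / 2) * phiSq k 0).trans_le h2

theorem cexMoment_pos {k : ℝ} (hk : 0 < k) (n : ℕ) : 0 < cexMoment k n := by
  induction n with
  | zero => exact cexMoment_zero_pos hk
  | succ n ih =>
    have h := cexMoment_succ hk n
    have h1 : 0 < (n : ℝ) + (k + 1) / 2 + k := by positivity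
    have h2 : 0 < (n + (k + 1) / 2) * cexMoment k n := by positivity
    rw [← h] at h2
    exact (mul_pos_iff_of_pos_left h1).mp h2

/-- The recurrence makes the moments a quotient of shifted factorials of order n^{-k}. The lower
bound follows from a monotone product, with no asymptotics of the Gamma function. -/
theorem exists_le_cexMoment {k : ℝ} (hk : 0 < k) :
    ∃ c : ℝ, 0 < c ∧ ∀ n : ℕ, 1 ≤ n → c * (n + k) ^ (-k) ≤ cexMoment k n := by
  set a := (k + 1) / 2 with ha
  -- With x = n + a one has M_n = (1 + k/x) M_{n+1}, so the product increases once 1 + k/x ≤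
  -- (x/(x-1))^k; this follows from log(x/(x-1)) ≥ 1/x.
  have hmono : ∀ n : ℕ, 1 ≤ n →
      cexMoment k 1 * a ^ k ≤ cexMoment k n * (n + a - 1) ^ k := by
    intro n hn
    induction n, hn using Nat.le_induction with
    | base => simp
    | succ n hn ih =>
      refine ih.trans ?_
      have hn' : (1 : ℝ) ≤ n := by exact_mod_cast hn
      have h := cexMoment_succ hk n
      rw [← ha] at h
      set x := (n : ℝ) + a with hx
      have hx1 : 0 < x - 1 := by rw [hx, ha]; linarith
      have hx0 : 0 < x := by linarith
      have h1 : (1 + k / x) * (x - 1) ^ k ≤ x ^ k := by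
        have h2 : 1 + k / x ≤ (x / (x - 1)) ^ k := by
          rw [Real.rpow_def_of_pos (by positivity)]
          have h3 : 1 / x ≤ Real.log (x / (x - 1)) := by
            have := Real.one_sub_inv_le_log_of_pos (show 0 < x / (x - 1) by positivity)
            refine le_trans (le_of_eq ?_) this
            field_simp
            ring
          have h4 : k / x ≤ Real.log (x / (x - 1)) * k := by
            calc k / x = 1 / x * k := by ring
              _ ≤ _ := by gcongr
          have := Real.add_one_le_exp (Real.log (x / (x - 1)) * k)
          linarith
        rw [Real.div_rpow hx0.le hx1.le, le_div_iff₀ (by positivity)] at h2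
        exact h2
      have h5 : cexMoment k n = (1 + k / x) * cexMoment k (n + 1) := by
        apply mul_left_cancel₀ hx0.ne'
        rw [← h]
        field_simp
      have h6 : ((n + 1 : ℕ) : ℝ) + a - 1 = x := by push_cast; ring
      rw [h6, h5]
      have := mul_le_mul_of_nonneg_left h1 (cexMoment_pos hk (n + 1)).le
      linarith
  have ha0 : 0 < a := by positivity
  refine ⟨cexMoment k 1 * a ^ k, by have := cexMoment_pos hk 1; positivity, fun n hn => ?_⟩
  have hn' : (1 : ℝ) ≤ n := by exact_mod_cast hn
  have h1 : 0 < (n : ℝ) + a - 1 := by linarith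
  have h2 := hmono n hn
  have h3 : cexMoment k n * ((n : ℝ) + a - 1) ^ k ≤ cexMoment k n * (n + k) ^ k := by
    have := cexMoment_pos hk n
    gcongr
    linarith
  rw [Real.rpow_neg (by positivity), ← div_eq_mul_inv, div_le_iff₀ (by positivity)]
  linarith

/-! ### L², L¹ and critical L^q norms of φ_n -/

theorem phiSq_le {k : ℝ} (hk : 0 < k) :
    ∃ C : ℝ, 0 < C ∧ ∀ n : ℕ, 1 ≤ n → phiSq k n ≤ C * (n + k) ^ (-(2 * k)) := by
  obtain ⟨M, hM, h⟩ := exists_uf_sq_le hk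
  refine ⟨2 * Real.pi * M, by positivity, fun n hn => ?_⟩
  have hw : Continuous fun x : ℝ => |Real.sin x| ^ (2 * k) :=
    Real.continuous_sin.abs.rpow_const fun _ => Or.inr (by positivity)
  rw [phiSq, integral_dm]
  calc ∫ x in -Real.pi..Real.pi, |Real.sin x| ^ (2 * k) • phi k n x ^ 2
      ≤ ∫ _x in -Real.pi..Real.pi, M * (n + k) ^ (-(2 * k)) := by
        refine intervalIntegral.integral_mono_on (by linarith [Real.pi_pos])
          (Continuous.intervalIntegrable (by fun_prop) _ _) (by simp) fun x _ => h n hn x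
    _ = _ := by
        rw [intervalIntegral.integral_const, smul_eq_mul]; ring

theorem exists_le_of_eventually_le {r : ℕ → ℝ} (hpos : ∀ n, 0 < r n) {c : ℝ} (hc : 0 < c)
    (h : ∀ᶠ n in atTop, c ≤ r n) : ∃ c' : ℝ, 0 < c' ∧ ∀ n, c' ≤ r n := by
  obtain ⟨n0, hn0⟩ := eventually_atTop.mp h
  have hne : (Finset.range (n0 + 1)).Nonempty := ⟨0, by simp⟩
  refine ⟨min c ((Finset.range (n0 + 1)).inf' hne r), lt_min hc ?_, fun n => ?_⟩
  · exact (Finset.lt_inf'_iff hne).mpr fun i _ => hpos i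
  · rcases le_total n0 n with h1 | h1
    · exact (min_le_left _ _).trans (hn0 n h1)
    · exact (min_le_right _ _).trans (Finset.inf'_le _ (by simp; omega))

theorem integral_interval_le_integral_dm {k : ℝ} (hk : 0 < k) {f : ℝ → ℝ} (hf : Continuous f)
    (hf0 : ∀ x, 0 ≤ f x) {a b : ℝ} (ha : 0 ≤ a) (hab : a ≤ b) (hb : b ≤ Real.pi / 2) :
    ∫ x in a..b, Real.sin x ^ (2 * k) * f x ≤ ∫ x, f x ∂(dm k) := by
  have hw : Continuous fun x : ℝ => |Real.sin x| ^ (2 * k) :=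
    Real.continuous_sin.abs.rpow_const fun _ => Or.inr (by positivity)
  have hpi := Real.pi_pos
  have h1 : ∫ x in a..b, Real.sin x ^ (2 * k) * f x
      = ∫ x in a..b, |Real.sin x| ^ (2 * k) • f x := by
    refine intervalIntegral.integral_congr fun x hx => ?_
    rw [Set.uIcc_of_le hab] at hx
    have : 0 ≤ Real.sin x :=
      Real.sin_nonneg_of_nonneg_of_le_pi (ha.trans hx.1) (by linarith [hx.2])
    simp only [smul_eq_mul, abs_of_nonneg this]
  rw [h1, integral_dm]
  refine intervalIntegral.integral_mono_interval (by linarith) hab (by linarith)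
    (Eventually.of_forall fun x => ?_) (Continuous.intervalIntegrable (by fun_prop) _ _)
  have := hf0 x
  simp only [Pi.zero_apply, smul_eq_mul]
  positivity

theorem sin_rpow_two_mul {x k : ℝ} (hx : 0 ≤ Real.sin x) :
    Real.sin x ^ (2 * k) = (Real.sin x ^ k) ^ 2 := by
  rw [← Real.rpow_mul_natCast hx, mul_comm]; norm_num

theorem integral_abs_phi_pos {k : ℝ} (hk : 0 < k) (n : ℕ) : 0 < ∫ x, |phi k n x| ∂(dm k) := by
  obtain ⟨C, hC⟩ := (isCompact_Icc (a := -Real.pi) (b := Real.pi)).exists_bound_of_continuousOn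
    (continuous_phi k n).continuousOn
  have h1 : phiSq k n ≤ (|C| + 1) * ∫ x, |phi k n x| ∂(dm k) := by
    rw [phiSq, ← integral_const_mul]
    refine integral_mono_ae (integrable_dm_real hk.le (by fun_prop))
      (integrable_dm_real hk.le (by fun_prop)) ?_
    refine (withDensity_absolutelyContinuous _ _).ae_le ?_
    filter_upwards [ae_restrict_mem measurableSet_Icc] with x hx
    rw [← sq_abs, sq]
    refine mul_le_mul_of_nonneg_right ?_ (abs_nonneg _)
    exact (hC x hx).trans ((le_abs_self C).trans (by linarith))
  have h2 := (phiSq_pos hk n).trans_le h1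
  exact (mul_pos_iff_of_pos_left (by positivity)).mp h2

theorem tendsto_natCast_add (k : ℝ) : Tendsto (fun n : ℕ => (n : ℝ) + k) atTop atTop :=
  tendsto_atTop_add_const_right _ _ tendsto_natCast_atTop_atTop

/-- On [1, π/2] sin is bounded below, u² has mass ≳ N^{-2k} and |u| ≲ N^{-k}; dividing the mass of
u² by the supremum of |u| bounds the integral of |φ_n| from below. -/
theorem exists_le_integral_abs_phi {k : ℝ} (hk : 0 < k) :
    ∃ c : ℝ, 0 < c ∧ ∀ n : ℕ, c * (n + k) ^ (-k) ≤ ∫ x, |phi k n x| ∂(dm k) := by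
  obtain ⟨M, hM, hMle⟩ := exists_uf_sq_le hk
  obtain ⟨c, C, hc, hC, hmass⟩ := exists_uf_mass hk
  have hpi := Real.pi_gt_three
  have hs1 : 0 < Real.sin 1 := Real.sin_pos_of_pos_of_lt_pi one_pos (by linarith)
  set D := √M * (Real.sin 1 ^ k)⁻¹ with hD
  have hD0 : 0 < D := by positivity
  have hN : ∀ n : ℕ, 0 < (n : ℝ) + k := fun n => by positivity
  suffices hev : ∀ᶠ n : ℕ in atTop,
      c / (4 * D) ≤ (∫ x, |phi k n x| ∂(dm k)) * (n + k) ^ k by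
    obtain ⟨c', hc', h⟩ := exists_le_of_eventually_le
      (r := fun n : ℕ => (∫ x, |phi k n x| ∂(dm k)) * (n + k) ^ k)
      (fun n => mul_pos (integral_abs_phi_pos hk n) (Real.rpow_pos_of_pos (hN n) _))
      (by positivity) hev
    refine ⟨c', hc', fun n => ?_⟩
    rw [Real.rpow_neg (hN n).le, ← div_eq_mul_inv, div_le_iff₀ (Real.rpow_pos_of_pos (hN n) _)]
    exact h n
  -- The threshold 4C/c makes the error C/N at most c/4, while π/2 - 1 ≥ 1/2; half of the main term
  -- survives.
  filter_upwards [eventually_ge_atTop 1,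
    (tendsto_natCast_add k).eventually_ge_atTop (4 * C / c)] with n hn hnC
  have hb : base k n ≤ 1 := (base_le_half hk hn).trans (by norm_num)
  have h1 := hmass n hn 1 (Real.pi / 2) (by linarith) hb le_rfl (fun _ => 1) (fun _ => 0)
    (fun x _ => hasDerivAt_const x 1) continuousOn_const (fun _ _ => le_rfl)
    (fun _ _ => zero_le_one)
  simp only [mul_one, intervalIntegral.integral_const, smul_eq_mul] at h1
  set N := (n : ℝ) + k with hNdef
  have hN0 : 0 < N := hN n
  have hB : N ^ (-(2 * k)) = N ^ (-k) * N ^ (-k) := by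
    rw [← Real.rpow_add hN0]; congr 1; ring
  have hB0 : 0 < N ^ (-k) := Real.rpow_pos_of_pos hN0 _
  have h2 : c / 4 ≤ c * (Real.pi / 2 - 1) - C / N := by
    have : C / N ≤ c / 4 := by
      rw [div_le_iff₀ hc] at hnC
      rw [div_le_div_iff₀ hN0 (by norm_num)]; linarith
    nlinarith
  have h3 : ∫ x in (1 : ℝ)..Real.pi / 2, uf k n x ^ 2
      ≤ D * N ^ (-k) * ∫ x in (1 : ℝ)..Real.pi / 2, Real.sin x ^ (2 * k) * |phi k n x| := by
    rw [← intervalIntegral.integral_const_mul]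
    have hsc : Continuous fun x => Real.sin x ^ k :=
      Real.continuous_sin.rpow_const fun _ => Or.inr hk.le
    have hsc2 : Continuous fun x => Real.sin x ^ (2 * k) :=
      Real.continuous_sin.rpow_const fun _ => Or.inr (by positivity)
    refine intervalIntegral.integral_mono_on (by linarith)
      (Continuous.intervalIntegrable (by unfold uf; fun_prop) _ _)
      (Continuous.intervalIntegrable (by fun_prop) _ _) fun x hx => ?_
    have hsx : Real.sin 1 ≤ Real.sin x :=
      Real.sin_le_sin_of_le_of_le_pi_div_two (by linarith) hx.2 hx.1
    have hsx0 : 0 < Real.sin x := hs1.trans_le hsx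
    have h4 := hMle n hn x
    rw [abs_of_pos hsx0, sin_rpow_two_mul hsx0.le, hB] at h4
    have h5 : Real.sin x ^ k * |phi k n x| ≤ √M * N ^ (-k) := by
      refine (abs_le_of_sq_le_sq' ?_ (by positivity)).2
      rw [mul_pow, mul_pow, sq_abs, Real.sq_sqrt hM.le, sq (N ^ (-k))]
      exact h4
    have h6 : Real.sin 1 ^ k ≤ Real.sin x ^ k := Real.rpow_le_rpow hs1.le hsx hk.le
    have h7 : 0 < Real.sin 1 ^ k := Real.rpow_pos_of_pos hs1 _
    rw [uf, sin_rpow_two_mul hsx0.le, ← sq_abs, abs_mul,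
      abs_of_pos (Real.rpow_pos_of_pos hsx0 k), hD]
    calc (Real.sin x ^ k * |phi k n x|) ^ 2
        ≤ √M * N ^ (-k) * (Real.sin x ^ k * |phi k n x|) := by
          rw [sq]; gcongr
      _ = √M * N ^ (-k) * (1 * (Real.sin x ^ k * |phi k n x|)) := by ring
      _ ≤ √M * N ^ (-k) * ((Real.sin 1 ^ k)⁻¹ * Real.sin x ^ k
            * (Real.sin x ^ k * |phi k n x|)) := by
          gcongr
          rw [inv_mul_eq_div, one_le_div h7]; exact h6
      _ = _ := by ring
  have h4 := integral_interval_le_integral_dm hk (f := fun x => |phi k n x|) (by fun_prop)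
    (fun x => abs_nonneg _) zero_le_one (by linarith : (1 : ℝ) ≤ Real.pi / 2) le_rfl
  have h5 : N ^ (-k) * N ^ (-k) * (c / 4) ≤ D * N ^ (-k) * ∫ x, |phi k n x| ∂(dm k) := by
    rw [← hB]
    calc _ ≤ N ^ (-(2 * k)) * (c * (Real.pi / 2 - 1) - C / N) := by gcongr
      _ ≤ _ := h1
      _ ≤ _ := h3
      _ ≤ _ := by gcongr
  have h6 : N ^ (-k) * (c / 4) ≤ D * ∫ x, |phi k n x| ∂(dm k) := by
    refine le_of_mul_le_mul_left ?_ hB0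
    linarith
  have h7 : N ^ (-k) * N ^ k = 1 := by rw [← Real.rpow_add hN0]; simp
  rw [div_le_iff₀ (by positivity)]
  have h8 := mul_le_mul_of_nonneg_right h6 (Real.rpow_nonneg hN0.le k)
  nlinarith

/-- A tangent-type lower bound for powers with exponent at least two. -/
theorem rpow_tangent {q a U : ℝ} (hq : 2 ≤ q) (ha : 0 < a) (hU : 0 ≤ U) :
    a ^ (q - 2) * (U ^ 2 - a ^ 2) ≤ U ^ q := by
  rcases le_total U a with h | h
  · have h1 : U ^ 2 - a ^ 2 ≤ 0 := by nlinarith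
    have h2 : 0 ≤ U ^ q := Real.rpow_nonneg hU _
    have h3 : 0 ≤ a ^ (q - 2) := Real.rpow_nonneg ha.le _
    nlinarith
  · have hU0 : 0 < U := ha.trans_le h
    have h1 : a ^ (q - 2) ≤ U ^ (q - 2) := Real.rpow_le_rpow ha.le h (by linarith)
    have h2 : U ^ q = U ^ (q - 2) * U ^ 2 := by
      rw [← Real.rpow_two, ← Real.rpow_add hU0]; congr 1; ring
    rw [h2]
    have h3 : 0 ≤ a ^ (q - 2) := Real.rpow_nonneg ha.le _
    nlinarith [sq_nonneg a, mul_nonneg h3 (sq_nonneg a),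
      mul_le_mul_of_nonneg_right h1 (sq_nonneg U)]

/-- The critical exponent `2 + 1 / k`. -/
noncomputable def critExp (k : ℝ) : ℝ := (2 * k + 1) / k

theorem two_le_critExp {k : ℝ} (hk : 0 < k) : 2 ≤ critExp k := by
  rw [critExp, le_div_iff₀ hk]; linarith

theorem log_le_integral_inv_sin {k : ℝ} (hk : 0 < k) {n : ℕ} (hn : 1 ≤ n) :
    Real.log (n + k) ≤ ∫ x in base k n..Real.pi / 2, 1 / Real.sin x := by
  have hb := base_mem hk hn
  have hb0 := base_pos hk n
  have hN : 0 < (n : ℝ) + k := by positivity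
  have h1 : ∫ x in base k n..Real.pi / 2, x⁻¹ = Real.log (Real.pi / 2 / base k n) :=
    integral_inv_of_pos hb0 (by positivity)
  have h2 : (n : ℝ) + k ≤ Real.pi / 2 / base k n := by
    unfold base
    rw [div_div_eq_mul_div, div_one]
    nlinarith [Real.pi_gt_three]
  refine (Real.log_le_log hN h2).trans (h1.symm.le.trans ?_)
  refine intervalIntegral.integral_mono_on hb.2 ?_ ?_ fun x hx => ?_
  · refine ContinuousOn.intervalIntegrable ?_
    rw [Set.uIcc_of_le hb.2]
    exact continuousOn_id.inv₀ fun x hx => (hb0.trans_le hx.1).ne'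
  · refine ContinuousOn.intervalIntegrable ?_
    rw [Set.uIcc_of_le hb.2]
    exact continuousOn_const.div (by fun_prop) fun x hx => (sin_pos_of_base_le hk hx).ne'
  · rw [← one_div]
    exact one_div_le_one_div_of_le (sin_pos_of_base_le hk hx)
      (Real.sin_le (hb0.le.trans hx.1))

/-- Since k q = 2k + 1 for q = `critExp k`, sin^{2k} |φ_n|^q = |u|^q / sin on the first quadrant.
With u of size N^{-k} in mean, integrating 1/sin from 1/(2N) produces log N; `rpow_tangent` passes
from u² to |u|^q pointwise. -/
theorem tendsto_integral_abs_phi_rpow {k : ℝ} (hk : 0 < k) :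
    Tendsto (fun n : ℕ => (n + k) ^ (2 * k + 1) * ∫ x, |phi k n x| ^ critExp k ∂(dm k))
      atTop atTop := by
  obtain ⟨c, C, hc, hC, hmass⟩ := exists_uf_mass hk
  -- With a² = c/2, the subtracted term in the tangent bound uses up only half of the logarithm.
  set a := √(c / 2) with ha
  have ha0 : 0 < a := by positivity
  have ha2 : a ^ 2 = c / 2 := Real.sq_sqrt (by positivity)
  have hq := two_le_critExp hk
  have hq0 : 0 ≤ critExp k := by linarith
  have hkq : k * critExp k = 2 * k + 1 := by rw [critExp]; field_simp
  have hlim : Tendsto (fun n : ℕ => a ^ (critExp k - 2) * (c / 2 * Real.log (n + k)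
      + -(C * Real.pi))) atTop atTop := by
    refine Tendsto.const_mul_atTop (by positivity) (tendsto_atTop_add_const_right _ _ ?_)
    exact Tendsto.const_mul_atTop (by positivity)
      (Real.tendsto_log_atTop.comp (tendsto_natCast_add k))
  refine tendsto_atTop_mono' _ ?_ hlim
  filter_upwards [eventually_ge_atTop 1] with n hn
  have hN : 0 < (n : ℝ) + k := by positivity
  have hb := base_mem hk hn
  have hbb : base k n ∈ Set.Icc (base k n) (Real.pi / 2) := ⟨le_rfl, hb.2⟩
  have hsin : ∀ x ∈ Set.Icc (base k n) (Real.pi / 2), 0 < Real.sin x :=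
    fun x hx => sin_pos_of_base_le hk hx
  have h1 := hmass n hn (base k n) (Real.pi / 2) hb.2 le_rfl le_rfl (fun x => 1 / Real.sin x)
    (fun x => -Real.cos x / Real.sin x ^ 2)
    (fun x hx => by
      simp only [one_div]
      exact (Real.hasDerivAt_sin x).inv (hsin x hx).ne')
    (ContinuousOn.div (by fun_prop) (by fun_prop) fun x hx => pow_ne_zero _ (hsin x hx).ne')
    (fun x hx => div_nonpos_of_nonpos_of_nonneg (neg_nonpos.mpr
      (Real.cos_nonneg_of_neg_pi_div_two_le_of_le
        (by linarith [hx.1, base_pos hk n, Real.pi_pos]) hx.2)) (sq_nonneg _))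
    (fun x hx => one_div_nonneg.mpr (hsin x hx).le)
  have hlog := log_le_integral_inv_sin hk hn
  have hws := one_div_sin_le hk hbb
  set N := (n : ℝ) + k with hNdef
  set W := ∫ x in base k n..Real.pi / 2, 1 / Real.sin x with hW
  have huc : ContinuousOn (fun x => uf k n x ^ 2 * (1 / Real.sin x))
      (Set.uIcc (base k n) (Real.pi / 2)) := by
    rw [Set.uIcc_of_le hb.2]
    have hsc : Continuous fun x => Real.sin x ^ k :=
      Real.continuous_sin.rpow_const fun _ => Or.inr hk.le
    refine ContinuousOn.mul (by unfold uf; fun_prop) (continuousOn_const.div (by fun_prop)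
      fun x hx => (hsin x hx).ne')
  have hwc : ContinuousOn (fun x => 1 / Real.sin x)
      (Set.uIcc (base k n) (Real.pi / 2)) := by
    rw [Set.uIcc_of_le hb.2]
    exact continuousOn_const.div (by fun_prop) fun x hx => (hsin x hx).ne'
  have hNN : N ^ (2 * k) * N ^ (-(2 * k)) = 1 := by rw [← Real.rpow_add hN]; simp
  have h2 : c * W - C * Real.pi
      ≤ N ^ (2 * k) * ∫ x in base k n..Real.pi / 2, uf k n x ^ 2 * (1 / Real.sin x) := by
    have h3 := mul_le_mul_of_nonneg_left h1 (Real.rpow_nonneg hN.le (2 * k))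
    rw [← mul_assoc, hNN, one_mul] at h3
    refine le_trans ?_ h3
    have : C / N * (1 / Real.sin (base k n)) ≤ C * Real.pi := by
      calc C / N * (1 / Real.sin (base k n)) ≤ C / N * (Real.pi * N) := by gcongr
        _ = C * Real.pi := by field_simp
    linarith
  have h3 : a ^ (critExp k - 2) * (N ^ (2 * k) *
        (∫ x in base k n..Real.pi / 2, uf k n x ^ 2 * (1 / Real.sin x)) - a ^ 2 * W)
      ≤ N ^ (2 * k + 1) * ∫ x in base k n..Real.pi / 2,
        Real.sin x ^ (2 * k) * |phi k n x| ^ critExp k := by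
    rw [hW, ← intervalIntegral.integral_const_mul, ← intervalIntegral.integral_const_mul,
      ← intervalIntegral.integral_sub (huc.intervalIntegrable.const_mul _)
        (hwc.intervalIntegrable.const_mul _), ← intervalIntegral.integral_const_mul,
      ← intervalIntegral.integral_const_mul]
    have hsc2 : Continuous fun x => Real.sin x ^ (2 * k) :=
      Real.continuous_sin.rpow_const fun _ => Or.inr (by positivity)
    have hpc : Continuous fun x => |phi k n x| ^ critExp k :=
      (continuous_phi k n).abs.rpow_const fun _ => Or.inr hq0
    refine intervalIntegral.integral_mono_on hb.2
      (((huc.intervalIntegrable.const_mul _).sub (hwc.intervalIntegrable.const_mul _)).const_mul _)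
      (Continuous.intervalIntegrable (by fun_prop) _ _) fun x hx => ?_
    have hs := hsin x hx
    have h4 := rpow_tangent hq ha0 (U := N ^ k * (Real.sin x ^ k * |phi k n x|)) (by positivity)
    rw [Real.mul_rpow (by positivity) (by positivity),
      Real.mul_rpow (by positivity) (by positivity), ← Real.rpow_mul hN.le, ← Real.rpow_mul hs.le,
      hkq, Real.rpow_add_one hs.ne'] at h4
    have h5 : N ^ (2 * k) = (N ^ k) ^ 2 := by
      rw [← Real.rpow_mul_natCast hN.le, mul_comm]; norm_num
    have h6 := mul_le_mul_of_nonneg_right h4 (one_div_nonneg.mpr hs.le)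
    rw [mul_pow, mul_pow, sq_abs, ← h5] at h6
    calc _ = a ^ (critExp k - 2) * (N ^ (2 * k) * ((Real.sin x ^ k) ^ 2 * phi k n x ^ 2) - a ^ 2)
          * (1 / Real.sin x) := by rw [uf]; ring
      _ ≤ _ := h6
      _ = _ := by field_simp
  have hpc : Continuous fun x => |phi k n x| ^ critExp k :=
    (continuous_phi k n).abs.rpow_const fun _ => Or.inr hq0
  have h4 := integral_interval_le_integral_dm hk hpc (fun x => by positivity) hb.1 hb.2 le_rfl
  refine le_trans ?_ (h3.trans (mul_le_mul_of_nonneg_left h4 (by positivity)))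
  refine mul_le_mul_of_nonneg_left ?_ (by positivity)
  rw [ha2]
  nlinarith

/-! ### Partial sums and comparison of L^p norms -/

theorem continuous_E {k : ℝ} (hk : 0 ≤ k) (n : ℤ) : Continuous (E k n) := by
  obtain ⟨c, hc⟩ := (isNonsymmetric_E hk n).triangular
  rw [funext hc]
  fun_prop

theorem continuous_term {k : ℝ} (hk : 0 ≤ k) (g : ℝ → ℂ) (n : ℤ) : Continuous (term k g n) := by
  have := continuous_E hk n
  unfold term
  fun_prop

theorem continuous_partialSum {k : ℝ} (hk : 0 ≤ k) (g : ℝ → ℂ) (N : ℕ) :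
    Continuous (partialSum k g N) := by
  unfold partialSum
  exact continuous_finsetSum _ fun n _ => continuous_term hk g n

theorem partialSum_succ (k : ℝ) (g : ℝ → ℂ) (n : ℕ) (x : ℝ) :
    partialSum k g (n + 1) x = partialSum k g n x
      + (term k g (n + 1 : ℕ) x + term k g (-(n + 1 : ℕ)) x) := by
  have h : Finset.Icc (-((n + 1 : ℕ) : ℤ)) ((n + 1 : ℕ) : ℤ) =
      insert ((n + 1 : ℕ) : ℤ) (insert (-((n + 1 : ℕ) : ℤ)) (Finset.Icc (-(n : ℤ)) (n : ℤ))) := by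
    ext j
    simp only [Finset.mem_Icc, Finset.mem_insert]
    push_cast
    omega
  rw [partialSum, h, Finset.sum_insert, Finset.sum_insert, partialSum]
  · ring
  · simp
  · simp only [Finset.mem_insert, Finset.mem_Icc]
    push_cast
    omega

theorem exists_eLpNorm_le {k : ℝ} (hk : 0 ≤ k) {p q : ℝ≥0∞} (hpq : p ≤ q) :
    ∃ K : ℝ≥0, 0 < K ∧ ∀ f : ℝ → ℝ, AEStronglyMeasurable f (dm k) →
      eLpNorm f p (dm k) ≤ K * eLpNorm f q (dm k) := by
  have := isFiniteMeasure_dm hk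
  by_cases hp0 : p = 0
  · exact ⟨1, one_pos, fun f _ => by simp [hp0]⟩
  have hexp : 0 ≤ 1 / p.toReal - 1 / q.toReal := by
    rcases eq_or_ne q ∞ with rfl | hq
    · simp
    · have h1 : 0 < p.toReal := ENNReal.toReal_pos hp0 (ne_top_of_le_ne_top hq hpq)
      have h2 : p.toReal ≤ q.toReal := ENNReal.toReal_mono hq hpq
      exact sub_nonneg.mpr (one_div_le_one_div_of_le h1 h2)
  have hfin : dm k Set.univ ^ (1 / p.toReal - 1 / q.toReal) ≠ ∞ :=
    ENNReal.rpow_ne_top_of_nonneg hexp (measure_ne_top _ _)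
  -- The added 1 only ensures that the constant is positive, so that it can be a divisor.
  refine ⟨(dm k Set.univ ^ (1 / p.toReal - 1 / q.toReal)).toNNReal + 1, by positivity,
    fun f hf => ?_⟩
  refine (eLpNorm_le_eLpNorm_mul_rpow_measure_univ hpq hf).trans ?_
  rw [mul_comm]
  gcongr
  rw [ENNReal.coe_add, ENNReal.coe_toNNReal hfin]
  exact le_self_add

theorem eLpNorm_one_phi {k : ℝ} (hk : 0 < k) (n : ℕ) :
    eLpNorm (phi k n) 1 (dm k) = ENNReal.ofReal (∫ x, |phi k n x| ∂(dm k)) := by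
  rw [eLpNorm_one_eq_lintegral_enorm, ← ofReal_integral_norm_eq_lintegral_enorm
    (integrable_dm_real hk.le (continuous_phi k n))]
  rfl

theorem eLpNorm_const_mul_phi (k : ℝ) (n : ℕ) (p : ℝ≥0∞) (c : ℝ) :
    eLpNorm (fun x => (c : ℂ) * phi k n x) p (dm k)
      = ENNReal.ofReal |c| * eLpNorm (phi k n) p (dm k) := by
  have h1 : eLpNorm (fun x => (c : ℂ) * phi k n x) p (dm k)
      = eLpNorm (c • phi k n) p (dm k) := by
    refine eLpNorm_congr_norm_ae (Eventually.of_forall fun x => ?_)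
    simp
  rw [h1, eLpNorm_const_smul, Real.enorm_eq_ofReal_abs]

theorem term_add_term_neg_ofReal {k : ℝ} (hk : 0 < k) {n : ℕ} (hn : 1 ≤ n) {h : ℝ → ℝ}
    (hh : Integrable h (dm k)) (heven : ∀ x, h (-x) = h x) (x : ℝ) :
    term k (fun y => (h y : ℂ)) n x + term k (fun y => (h y : ℂ)) (-n) x
      = (((∫ y, h y * phi k n y ∂(dm k)) / phiSq k n : ℝ) : ℂ) * phi k n x := by
  rw [term_add_term_neg hk hn (g := fun y => (h y : ℂ)) hh.ofReal (fun x => by rw [heven])]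
  congr 1
  rw [Complex.ofReal_div, ← integral_ofReal_dm]
  push_cast
  rfl

/-- On an even function the difference of consecutive partial sums is the projection on φ_n, so its
norm costs two applications of the bound. -/
theorem le_eLpNorm_of_partialSum_bound {k : ℝ} (hk : 0 < k) {p : ℝ≥0∞} (hp1 : 1 ≤ p) {C : ℝ≥0}
    (hC : ∀ (N : ℕ) (g : ℝ → ℂ), MemLp g p (dm k) →
      eLpNorm (partialSum k g N) p (dm k) ≤ C * eLpNorm g p (dm k)) {n : ℕ} (hn : 1 ≤ n)
    {h : ℝ → ℝ} (hh : MemLp h p (dm k)) (heven : ∀ x, h (-x) = h x) :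
    ENNReal.ofReal (|∫ y, h y * phi k n y ∂(dm k)| / phiSq k n) * eLpNorm (phi k n) p (dm k)
      ≤ 2 * C * eLpNorm h p (dm k) := by
  have := isFiniteMeasure_dm hk.le
  have hm : MemLp (fun y => (h y : ℂ)) p (dm k) := hh.ofReal
  have hnorm : eLpNorm (fun y => (h y : ℂ)) p (dm k) = eLpNorm h p (dm k) :=
    eLpNorm_congr_norm_ae (Eventually.of_forall fun x => by simp)
  rw [← abs_of_pos (phiSq_pos hk n), ← abs_div, ← eLpNorm_const_mul_phi]
  obtain ⟨m, rfl⟩ : ∃ m, n = m + 1 := ⟨n - 1, by omega⟩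
  have h1 : (fun x => (((∫ y, h y * phi k (m + 1) y ∂(dm k)) / phiSq k (m + 1) : ℝ) : ℂ)
      * phi k (m + 1) x) = partialSum k (fun y => (h y : ℂ)) (m + 1)
        - partialSum k (fun y => (h y : ℂ)) m := by
    funext x
    rw [Pi.sub_apply, partialSum_succ, ← term_add_term_neg_ofReal hk hn
      (hh.integrable hp1) heven]
    ring
  rw [h1]
  refine (eLpNorm_sub_le (continuous_partialSum hk.le _ _).aestronglyMeasurable
    (continuous_partialSum hk.le _ _).aestronglyMeasurable hp1).trans ?_
  refine (add_le_add (hC _ _ hm) (hC _ _ hm)).trans (le_of_eq ?_)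
  rw [hnorm]
  ring

theorem eLpNorm_critExp_phi {k : ℝ} (hk : 0 < k) (n : ℕ) :
    eLpNorm (phi k n) (ENNReal.ofReal (critExp k)) (dm k)
      = ENNReal.ofReal ((∫ x, |phi k n x| ^ critExp k ∂(dm k)) ^ (1 / critExp k)) := by
  have hq : 0 < critExp k := by linarith [two_le_critExp hk]
  have := isFiniteMeasure_dm hk.le
  have hmem : MemLp (phi k n) (ENNReal.ofReal (critExp k)) (dm k) := by
    rw [← integrable_norm_rpow_iff (continuous_phi k n).aestronglyMeasurable (by simpa using hq)
      ENNReal.ofReal_ne_top, ENNReal.toReal_ofReal hq.le]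
    exact integrable_dm_real hk.le
      ((continuous_phi k n).norm.rpow_const fun _ => Or.inr hq.le)
  rw [hmem.eLpNorm_eq_integral_rpow_norm (by simpa using hq) ENNReal.ofReal_ne_top,
    ENNReal.toReal_ofReal hq.le, one_div]
  rfl

/-! ### Unboundedness of the partial sums for k > 0 -/

theorem exists_ratio_bound {k : ℝ} (hk : 0 < k) : ∃ c : ℝ, 0 < c ∧ ∀ n : ℕ, 1 ≤ n →
    c * (n + k) ^ k ≤ (∫ x, |phi k n x| ∂(dm k)) / phiSq k n := by
  obtain ⟨c, hc, h1⟩ := exists_le_integral_abs_phi hk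
  obtain ⟨C, hC, h2⟩ := phiSq_le hk
  refine ⟨c / C, by positivity, fun n hn => ?_⟩
  have hN : 0 < (n : ℝ) + k := by positivity
  rw [le_div_iff₀ (phiSq_pos hk n)]
  calc c / C * (n + k) ^ k * phiSq k n
      ≤ c / C * (n + k) ^ k * (C * (n + k) ^ (-(2 * k))) := by gcongr; exact h2 n hn
    _ = c * (n + k) ^ (-k) := by
        have : ((n : ℝ) + k) ^ (-k) = (n + k) ^ k * (n + k) ^ (-(2 * k)) := by
          rw [← Real.rpow_add hN]; congr 1; ring
        rw [this]; field_simp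
    _ ≤ _ := h1 n

theorem tendsto_critNorm {k : ℝ} (hk : 0 < k) :
    Tendsto (fun n : ℕ => (n + k) ^ k *
      (∫ x, |phi k n x| ^ critExp k ∂(dm k)) ^ (1 / critExp k)) atTop atTop := by
  have hq : 0 < critExp k := by linarith [two_le_critExp hk]
  refine ((tendsto_rpow_atTop (one_div_pos.mpr hq)).comp
    (tendsto_integral_abs_phi_rpow hk)).congr fun n => ?_
  have hN : 0 ≤ (n : ℝ) + k := by positivity
  have h0 : 0 ≤ ∫ x, |phi k n x| ^ critExp k ∂(dm k) := integral_nonneg fun x => by positivity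
  rw [Function.comp, Real.mul_rpow (by positivity) h0, ← Real.rpow_mul hN]
  congr 2
  rw [critExp]
  field_simp

/-- The common contradiction for both ranges of p: ‖φ_n‖₁ / ‖φ_n‖₂² ≳ N^k, whereas N^k ‖φ_n‖_q is
unbounded. -/
theorem not_bounded_of_eventually_le {k : ℝ} (hk : 0 < k) (D : ℝ)
    (h : ∀ n : ℕ, 1 ≤ n → (∫ x, |phi k n x| ∂(dm k)) / phiSq k n *
      (∫ x, |phi k n x| ^ critExp k ∂(dm k)) ^ (1 / critExp k) ≤ D) : False := by
  obtain ⟨c, hc, hr⟩ := exists_ratio_bound hk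
  obtain ⟨n, hn1, hn2⟩ := ((eventually_ge_atTop 1).and
    ((tendsto_critNorm hk).eventually_gt_atTop (D / c))).exists
  rw [div_lt_iff₀ hc] at hn2
  have h0 : 0 ≤ (∫ x, |phi k n x| ^ critExp k ∂(dm k)) ^ (1 / critExp k) :=
    Real.rpow_nonneg (integral_nonneg fun x => by positivity) _
  have := mul_le_mul_of_nonneg_right (hr n hn1) h0
  linarith [h n hn1]

theorem eLpNorm_one_const_ne_top {k : ℝ} (hk : 0 ≤ k) (p : ℝ≥0∞) :
    eLpNorm (fun _ : ℝ => (1 : ℝ)) p (dm k) ≠ ∞ := by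
  have := isFiniteMeasure_dm hk
  exact (memLp_const 1).eLpNorm_ne_top

/-- The test function is the sign of φ_n: it pairs with φ_n to ‖φ_n‖₁, its norm is bounded in n, and
‖φ_n‖_p controls ‖φ_n‖_q because p ≥ q. -/
theorem not_bounded_of_ge {k : ℝ} (hk : 0 < k) {p : ℝ≥0∞} (hp1 : 1 ≤ p)
    (hp : ENNReal.ofReal (critExp k) ≤ p) :
    ¬ ∃ C : ℝ≥0, ∀ (N : ℕ) (g : ℝ → ℂ), MemLp g p (dm k) →
      eLpNorm (partialSum k g N) p (dm k) ≤ C * eLpNorm g p (dm k) := by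
  rintro ⟨C, hC⟩
  have := isFiniteMeasure_dm hk.le
  obtain ⟨K, hK, hKle⟩ := exists_eLpNorm_le hk.le hp
  have hfin : (K : ℝ≥0∞) * (2 * C * eLpNorm (fun _ : ℝ => (1 : ℝ)) p (dm k)) ≠ ∞ := by
    have := eLpNorm_one_const_ne_top hk.le p
    finiteness
  refine not_bounded_of_eventually_le hk
    ((K : ℝ≥0∞) * (2 * C * eLpNorm (fun _ : ℝ => (1 : ℝ)) p (dm k))).toReal fun n hn => ?_
  rw [← ENNReal.ofReal_le_iff_le_toReal hfin, ENNReal.ofReal_mul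
    (div_nonneg (integral_nonneg fun _ => abs_nonneg _) (phiSq_pos hk n).le),
    ← eLpNorm_critExp_phi hk]
  have hm : Measurable fun x => phi k n x / |phi k n x| :=
    (continuous_phi k n).measurable.div (continuous_phi k n).abs.measurable
  have hle : ∀ x, ‖(phi k n x / |phi k n x|)‖ ≤ ‖(1 : ℝ)‖ := by
    intro x
    simpa using div_self_le_one |phi k n x|
  have hmem : MemLp (fun x => (phi k n x / |phi k n x|)) p (dm k) :=
    (memLp_const (1 : ℝ)).mono hm.aestronglyMeasurable (Eventually.of_forall hle)
  have h1 := le_eLpNorm_of_partialSum_bound hk hp1 hC hn hmem (fun x => by rw [phi_neg])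
  have h2 : ∀ x, (phi k n x / |phi k n x|) * phi k n x = |phi k n x| := by
    intro x
    rw [div_mul_eq_mul_div, ← abs_mul_abs_self, mul_self_div_self]
  simp_rw [h2] at h1
  rw [abs_of_nonneg (integral_nonneg fun _ => abs_nonneg _)] at h1
  calc _ ≤ ENNReal.ofReal ((∫ x, |phi k n x| ∂(dm k)) / phiSq k n) *
        (K * eLpNorm (phi k n) p (dm k)) := by
        gcongr; exact hKle _ (continuous_phi k n).aestronglyMeasurable
    _ = K * (ENNReal.ofReal ((∫ x, |phi k n x| ∂(dm k)) / phiSq k n) *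
        eLpNorm (phi k n) p (dm k)) := by ring
    _ ≤ K * (2 * C * eLpNorm (fun x => (phi k n x / |phi k n x|)) p (dm k)) := by
        gcongr
    _ ≤ _ := by
        gcongr
        exact eLpNorm_mono hle

/-- The dual choice: |φ_n|^{q-2} φ_n is extremal for Hölder's inequality between L^q and its
conjugate L^{p0}, and ‖φ_n‖_p is only bounded below by a multiple of ‖φ_n‖₁. -/
theorem not_bounded_of_le {k : ℝ} (hk : 0 < k) {p : ℝ≥0∞} (hp1 : 1 ≤ p)
    (hp : p ≤ ENNReal.ofReal ((2 * k + 1) / (k + 1))) :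
    ¬ ∃ C : ℝ≥0, ∀ (N : ℕ) (g : ℝ → ℂ), MemLp g p (dm k) →
      eLpNorm (partialSum k g N) p (dm k) ≤ C * eLpNorm g p (dm k) := by
  rintro ⟨C, hC⟩
  have := isFiniteMeasure_dm hk.le
  set p0 := (2 * k + 1) / (k + 1) with hp0
  have hp0pos : 0 < p0 := by positivity
  have hq2 := two_le_critExp hk
  have hq : 0 < critExp k := by linarith
  obtain ⟨K, hK, hKle⟩ := exists_eLpNorm_le hk.le hp
  obtain ⟨K', hK', hKle'⟩ := exists_eLpNorm_le hk.le hp1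
  refine not_bounded_of_eventually_le hk (K' * (2 * C * K)) fun n hn => ?_
  set X := ∫ x, |phi k n x| ^ critExp k ∂(dm k) with hX
  have hX0 : 0 < X := by
    have h := phiSq_pos hk n
    by_contra! hle
    have h0 : ∀ x, 0 ≤ |phi k n x| ^ critExp k := fun x => by positivity
    have hzero : X = 0 := le_antisymm hle (integral_nonneg h0)
    rw [hX, integral_eq_zero_iff_of_nonneg h0 (integrable_dm_real hk.le
      ((continuous_phi k n).abs.rpow_const fun _ => Or.inr hq.le))] at hzero
    have : phiSq k n = 0 := by
      refine integral_eq_zero_of_ae ?_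
      filter_upwards [hzero] with x hx
      have hx' : |phi k n x| ^ critExp k = 0 := hx
      rw [Real.rpow_eq_zero (abs_nonneg _) hq.ne', abs_eq_zero] at hx'
      simp [hx']
    linarith
  set h : ℝ → ℝ := fun x => |phi k n x| ^ (critExp k - 2) * phi k n x with hh
  have hhc : Continuous h :=
    ((continuous_phi k n).abs.rpow_const fun _ => Or.inr (by linarith)).mul (continuous_phi k n)
  have habs : ∀ x, ‖h x‖ ^ p0 = |phi k n x| ^ critExp k := by
    intro x
    rcases eq_or_ne (phi k n x) 0 with h0 | h0
    · simp [hh, h0, Real.zero_rpow hp0pos.ne', Real.zero_rpow hq.ne']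
    · have hpos : 0 < |phi k n x| := abs_pos.mpr h0
      rw [Real.norm_eq_abs, hh, abs_mul, abs_of_pos (Real.rpow_pos_of_pos hpos _),
        ← Real.rpow_add_one hpos.ne', ← Real.rpow_mul hpos.le]
      congr 1
      rw [critExp, hp0]
      field_simp
      ring
  have hmem0 : MemLp h (ENNReal.ofReal p0) (dm k) := by
    rw [← integrable_norm_rpow_iff hhc.aestronglyMeasurable (by simpa using hp0pos)
      ENNReal.ofReal_ne_top, ENNReal.toReal_ofReal hp0pos.le]
    exact integrable_dm_real hk.le (hhc.norm.rpow_const fun _ => Or.inr hp0pos.le)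
  have hnorm0 : eLpNorm h (ENNReal.ofReal p0) (dm k) = ENNReal.ofReal (X ^ (1 / p0)) := by
    rw [hmem0.eLpNorm_eq_integral_rpow_norm (by simpa using hp0pos) ENNReal.ofReal_ne_top,
      ENNReal.toReal_ofReal hp0pos.le, one_div]
    simp_rw [habs]
    rfl
  have h1 := le_eLpNorm_of_partialSum_bound hk hp1 hC hn (hmem0.mono_exponent hp)
    (fun x => by rw [hh]; simp only [phi_neg])
  have h2 : ∀ x, h x * phi k n x = |phi k n x| ^ critExp k := by
    intro x
    rcases eq_or_ne (phi k n x) 0 with h0 | h0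
    · simp [h0, Real.zero_rpow hq.ne']
    · have hpos : 0 < |phi k n x| := abs_pos.mpr h0
      rw [hh]
      simp only
      rw [mul_assoc, ← sq, ← sq_abs, ← Real.rpow_natCast, ← Real.rpow_add hpos]
      congr 1
      push_cast
      ring
  simp_rw [h2] at h1
  rw [← hX, abs_of_pos hX0] at h1
  have hI := integral_abs_phi_pos hk n
  have hP := phiSq_pos hk n
  have h3 : ENNReal.ofReal (X / phiSq k n * ∫ x, |phi k n x| ∂(dm k))
      ≤ ENNReal.ofReal (K' * (2 * C * K) * X ^ (1 / p0)) := by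
    rw [ENNReal.ofReal_mul (by positivity), ← eLpNorm_one_phi hk]
    calc _ ≤ ENNReal.ofReal (X / phiSq k n) * (K' * eLpNorm (phi k n) p (dm k)) := by
          gcongr; exact hKle' _ (continuous_phi k n).aestronglyMeasurable
      _ = K' * (ENNReal.ofReal (X / phiSq k n) * eLpNorm (phi k n) p (dm k)) := by ring
      _ ≤ K' * (2 * C * eLpNorm h p (dm k)) := by gcongr
      _ ≤ K' * (2 * C * (K * eLpNorm h (ENNReal.ofReal p0) (dm k))) := by
          gcongr; exact hKle _ hhc.aestronglyMeasurable
      _ = _ := by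
          rw [hnorm0, ENNReal.ofReal_mul (by positivity), ENNReal.ofReal_mul (by positivity),
            ENNReal.ofReal_mul (by positivity), ENNReal.ofReal_mul (by positivity),
            ENNReal.ofReal_coe_nnreal, ENNReal.ofReal_coe_nnreal, ENNReal.ofReal_coe_nnreal,
            ENNReal.ofReal_ofNat]
          ring
  have h4 := (ENNReal.ofReal_le_ofReal_iff (by positivity)).mp h3
  have h5 : X = X ^ (1 / p0) * X ^ (1 / critExp k) := by
    rw [← Real.rpow_add hX0]
    have : 1 / p0 + 1 / critExp k = 1 := by rw [critExp, hp0]; field_simp; ring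
    rw [this, Real.rpow_one]
  have hXp : 0 < X ^ (1 / p0) := Real.rpow_pos_of_pos hX0 _
  refine le_of_mul_le_mul_left ?_ hXp
  calc X ^ (1 / p0) * ((∫ x, |phi k n x| ∂(dm k)) / phiSq k n * X ^ (1 / critExp k))
      = X ^ (1 / p0) * X ^ (1 / critExp k) / phiSq k n * ∫ x, |phi k n x| ∂(dm k) := by ring
    _ = X / phiSq k n * ∫ x, |phi k n x| ∂(dm k) := by rw [← h5]
    _ ≤ _ := h4
    _ = _ := by ring

/-! ### Non-decay of the terms of f -/

/-- The decay N^{-k} of the moments is exactly compensated by ‖φ_n‖₁ / ‖φ_n‖₂² ≳ N^k; replacing the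
L^p norm by the L¹ norm handles all p ≥ 1 at once. -/
theorem exists_le_eLpNorm_term_cex {k : ℝ} (hk : 0 < k) {p : ℝ≥0∞} (hp1 : 1 ≤ p) :
    ∃ A : ℝ, 0 < A ∧ ∀ n : ℕ, 1 ≤ n → ENNReal.ofReal A ≤
      eLpNorm (fun x => term k (cex k) n x + term k (cex k) (-n) x) p (dm k) := by
  obtain ⟨c, hc, hcm⟩ := exists_le_cexMoment hk
  obtain ⟨c', hc', hr⟩ := exists_ratio_bound hk
  obtain ⟨K, hK, hKle⟩ := exists_eLpNorm_le hk.le hp1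
  refine ⟨c * c' / K, by positivity, fun n hn => ?_⟩
  have hN : 0 < (n : ℝ) + k := by positivity
  have hP := phiSq_pos hk n
  have hM := cexMoment_pos hk n
  have hI := integral_abs_phi_pos hk n
  have h1 : (fun x => term k (cex k) n x + term k (cex k) (-n) x)
      = fun x => ((cexMoment k n / phiSq k n : ℝ) : ℂ) * phi k n x := by
    funext x
    exact term_add_term_neg_ofReal hk hn (integrable_cexR hk) (fun x => by simp [cexR]) x
  rw [h1, eLpNorm_const_mul_phi, abs_of_pos (by positivity)]
  have h2 : c * c' ≤ cexMoment k n / phiSq k n * ∫ x, |phi k n x| ∂(dm k) := by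
    have h3 : ((n : ℝ) + k) ^ (-k) * (n + k) ^ k = 1 := by rw [← Real.rpow_add hN]; simp
    calc c * c' = (c * (n + k) ^ (-k)) * (c' * (n + k) ^ k) := by
          rw [mul_mul_mul_comm, h3, mul_one]
      _ ≤ cexMoment k n * ((∫ x, |phi k n x| ∂(dm k)) / phiSq k n) := by
          gcongr
          · exact hcm n hn
          · exact hr n hn
      _ = _ := by ring
  have hK0 : (K : ℝ≥0∞) ≠ 0 := by exact_mod_cast hK.ne'
  rw [ENNReal.ofReal_div_of_pos (by exact_mod_cast hK), ENNReal.ofReal_coe_nnreal]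
  refine ENNReal.div_le_of_le_mul ?_
  calc ENNReal.ofReal (c * c')
      ≤ ENNReal.ofReal (cexMoment k n / phiSq k n * ∫ x, |phi k n x| ∂(dm k)) :=
        ENNReal.ofReal_le_ofReal h2
    _ = ENNReal.ofReal (cexMoment k n / phiSq k n) * eLpNorm (phi k n) 1 (dm k) := by
        rw [ENNReal.ofReal_mul (by positivity), eLpNorm_one_phi hk]
    _ ≤ ENNReal.ofReal (cexMoment k n / phiSq k n) * (K * eLpNorm (phi k n) p (dm k)) := by
        gcongr; exact hKle _ (continuous_phi k n).aestronglyMeasurable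
    _ = _ := by ring

theorem not_tendsto_of_le {A : ℝ} (hA : 0 < A) {u : ℕ → ℝ≥0∞}
    (h : ∀ n, 1 ≤ n → ENNReal.ofReal A ≤ u n) : ¬ Tendsto u atTop (𝓝 0) := by
  intro ht
  obtain ⟨n, hn1, hn2⟩ := ((eventually_ge_atTop 1).and
    (ht.eventually_lt_const (ENNReal.ofReal_pos.mpr hA))).exists
  exact absurd (h n hn1) (not_le.mpr hn2)

/-- If the partial sums converge, then the terms tend to zero. -/
theorem tendsto_term_of_tendsto_partialSum {k : ℝ} (hk : 0 ≤ k) {p : ℝ≥0∞} (hp1 : 1 ≤ p)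
    {g : ℝ → ℂ} (hg : MemLp g p (dm k))
    (h : Tendsto (fun N : ℕ => eLpNorm (fun x => partialSum k g N x - g x) p (dm k))
      atTop (𝓝 0)) :
    Tendsto (fun n : ℕ => eLpNorm (fun x => term k g (n + 1 : ℕ) x
      + term k g (-(n + 1 : ℕ)) x) p (dm k)) atTop (𝓝 0) := by
  have h2 := (h.comp (tendsto_add_atTop_nat 1)).add h
  rw [add_zero] at h2
  refine tendsto_of_tendsto_of_tendsto_of_le_of_le tendsto_const_nhds h2
    (fun _ => zero_le) fun n => ?_
  have h3 : (fun x => term k g (n + 1 : ℕ) x + term k g (-(n + 1 : ℕ)) x)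
      = (fun x => partialSum k g (n + 1) x - g x) - fun x => partialSum k g n x - g x := by
    funext x
    rw [Pi.sub_apply, partialSum_succ]
    ring
  rw [h3]
  have hm : ∀ N, AEStronglyMeasurable (fun x => partialSum k g N x - g x) (dm k) := fun N =>
    (continuous_partialSum hk g N).aestronglyMeasurable.sub hg.1
  exact eLpNorm_sub_le (hm _) (hm _) hp1

/-! ### Partial sum operators on L^p and the uniform boundedness principle -/

theorem exists_bound_of_continuous {e : ℝ → ℂ} (he : Continuous e) (k : ℝ) :
    ∃ B : ℝ, ∀ᵐ x ∂(dm k), ‖e x‖ ≤ B := by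
  obtain ⟨B, hB⟩ := (isCompact_Icc (a := -Real.pi) (b := Real.pi)).exists_bound_of_continuousOn
    he.continuousOn
  refine ⟨B, (withDensity_absolutelyContinuous _ _).ae_le ?_⟩
  exact (ae_restrict_iff' measurableSet_Icc).mpr (Eventually.of_forall hB)

theorem integrable_mul_continuous {k : ℝ} {g e : ℝ → ℂ} (hg : Integrable g (dm k))
    (he : Continuous e) : Integrable (fun x => g x * e x) (dm k) := by
  obtain ⟨B, hB⟩ := exists_bound_of_continuous he k
  exact hg.mul_bdd he.aestronglyMeasurable hB

theorem memLp_of_continuous {k : ℝ} (hk : 0 ≤ k) (p : ℝ≥0∞) {e : ℝ → ℂ} (he : Continuous e) :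
    MemLp e p (dm k) := by
  have := isFiniteMeasure_dm hk
  obtain ⟨B, hB⟩ := exists_bound_of_continuous he k
  exact MemLp.of_bound he.aestronglyMeasurable B hB

theorem coeff_congr {k : ℝ} {f g : ℝ → ℂ} (h : f =ᵐ[dm k] g) (n : ℤ) :
    coeff k f n = coeff k g n := by
  rw [coeff, coeff]
  congr 1
  refine integral_congr_ae ?_
  filter_upwards [h] with x hx
  rw [hx]

/-- The coefficient functional on `L^p(dm_k)`. -/
noncomputable def coeffLp {k : ℝ} (hk : 0 ≤ k) (p : ℝ≥0∞) [Fact (1 ≤ p)] (n : ℤ) :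
    Lp ℂ p (dm k) →L[ℂ] ℂ :=
  have := isFiniteMeasure_dm hk
  have hint : ∀ f : Lp ℂ p (dm k), Integrable f (dm k) :=
    fun f => (Lp.memLp f).integrable Fact.out
  have hcont : Continuous fun x : ℝ => E k n (-(Complex.I * x)) :=
    (continuous_E hk n).comp (by fun_prop)
  LinearMap.mkContinuousOfExistsBound
    { toFun := fun f => coeff k f n
      map_add' := fun f g => by
        rw [coeff_congr (Lp.coeFn_add f g), coeff, coeff, coeff, ← mul_add,
          ← integral_add (integrable_mul_continuous (hint f) hcont)
            (integrable_mul_continuous (hint g) hcont)]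
        simp only [Pi.add_apply, add_mul]
      map_smul' := fun a f => by
        rw [coeff_congr (Lp.coeFn_smul a f), coeff, coeff, RingHom.id_apply, smul_eq_mul]
        simp only [Pi.smul_apply, smul_eq_mul, mul_assoc]
        rw [integral_const_mul, mul_left_comm] } <| by
    obtain ⟨B, hB⟩ := exists_bound_of_continuous hcont k
    obtain ⟨K, hK, hKle⟩ := exists_eLpNorm_le hk (Fact.out : 1 ≤ p)
    refine ⟨‖(gam k n : ℂ) ^ 2‖ * (|B| * K), fun f => ?_⟩
    simp only [LinearMap.coe_mk, AddHom.coe_mk]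
    rw [coeff, norm_mul, mul_assoc]
    refine mul_le_mul_of_nonneg_left ?_ (norm_nonneg _)
    have h1 : ∫ x, ‖f x‖ ∂(dm k) ≤ K * ‖f‖ := by
      have h2 := hKle (fun x => ‖f x‖) (Lp.aestronglyMeasurable f).norm
      rw [eLpNorm_norm, eLpNorm_norm, eLpNorm_one_eq_lintegral_enorm,
        ← ofReal_integral_norm_eq_lintegral_enorm (hint f)] at h2
      rw [Lp.norm_def]
      have h3 := ENNReal.toReal_mono
        (ENNReal.mul_ne_top ENNReal.coe_ne_top (Lp.eLpNorm_ne_top f)) h2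
      rwa [ENNReal.toReal_ofReal (integral_nonneg fun _ => norm_nonneg _), ENNReal.toReal_mul,
        ENNReal.coe_toReal] at h3
    calc ‖∫ x : ℝ, f x * E k n (-(Complex.I * x)) ∂(dm k)‖
        ≤ ∫ x, |B| * ‖f x‖ ∂(dm k) := by
          refine norm_integral_le_of_norm_le ((hint f).norm.const_mul _) ?_
          filter_upwards [hB] with x hx
          rw [norm_mul, mul_comm]
          exact mul_le_mul_of_nonneg_right (hx.trans (le_abs_self B)) (norm_nonneg _)
      _ = |B| * ∫ x, ‖f x‖ ∂(dm k) := integral_const_mul _ _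
      _ ≤ |B| * (K * ‖f‖) := by gcongr
      _ = _ := by ring

theorem coeffLp_apply {k : ℝ} (hk : 0 ≤ k) (p : ℝ≥0∞) [Fact (1 ≤ p)] (n : ℤ)
    (f : Lp ℂ p (dm k)) : coeffLp hk p n f = coeff k f n := rfl

/-- The partial sum operator on `L^p(dm_k)`. -/
noncomputable def partialSumLp {k : ℝ} (hk : 0 ≤ k) (p : ℝ≥0∞) [Fact (1 ≤ p)] (N : ℕ) :
    Lp ℂ p (dm k) →L[ℂ] Lp ℂ p (dm k) :=
  ∑ n ∈ Finset.Icc (-(N : ℤ)) (N : ℤ), (coeffLp hk p n).smulRight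
    ((memLp_of_continuous hk p (e := fun x : ℝ => E k n (Complex.I * x))
      ((continuous_E hk n).comp (by fun_prop))).toLp _)

theorem partialSumLp_ae {k : ℝ} (hk : 0 ≤ k) (p : ℝ≥0∞) [Fact (1 ≤ p)] (N : ℕ)
    (f : Lp ℂ p (dm k)) : partialSumLp hk p N f =ᵐ[dm k] partialSum k f N := by
  have hmem : ∀ n : ℤ, MemLp (fun x : ℝ => E k n (Complex.I * x)) p (dm k) := fun n =>
    memLp_of_continuous hk p ((continuous_E hk n).comp (by fun_prop))
  have h1 : partialSumLp hk p N f = ∑ n ∈ Finset.Icc (-(N : ℤ)) (N : ℤ),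
      coeff k f n • (hmem n).toLp _ := by
    simp [partialSumLp, coeffLp_apply]
  have h2 : ∀ᵐ x ∂(dm k), ∀ n : ℤ,
      (coeff k f n • (hmem n).toLp _ : Lp ℂ p (dm k)) x = term k f n x := by
    rw [ae_all_iff]
    intro n
    filter_upwards [Lp.coeFn_smul (coeff k f n) ((hmem n).toLp _), (hmem n).coeFn_toLp]
      with x hx1 hx2
    rw [hx1, Pi.smul_apply, hx2, smul_eq_mul, term]
  rw [h1]
  filter_upwards [Lp.coeFn_finsetSum (Finset.Icc (-(N : ℤ)) (N : ℤ))
    (fun n => coeff k f n • (hmem n).toLp _), h2] with x hx1 hx2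
  rw [hx1, Finset.sum_apply, partialSum]
  exact Finset.sum_congr rfl fun n _ => hx2 n

/-- Convergence of all partial sums forces the partial sum operators to be uniformly bounded. -/
theorem exists_bound_of_forall_tendsto {k : ℝ} (hk : 0 ≤ k) {p : ℝ≥0∞} (hp1 : 1 ≤ p)
    (h : ∀ g : ℝ → ℂ, MemLp g p (dm k) → Tendsto (fun N : ℕ =>
      eLpNorm (fun x => partialSum k g N x - g x) p (dm k)) atTop (𝓝 0)) :
    ∃ C : ℝ≥0, ∀ (N : ℕ) (g : ℝ → ℂ), MemLp g p (dm k) →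
      eLpNorm (partialSum k g N) p (dm k) ≤ C * eLpNorm g p (dm k) := by
  have : Fact (1 ≤ p) := ⟨hp1⟩
  obtain ⟨C, hC⟩ := banach_steinhaus (g := partialSumLp hk p) fun f => by
    have hlim : Tendsto (fun N => partialSumLp hk p N f) atTop (𝓝 f) := by
      rw [Lp.tendsto_Lp_iff_tendsto_eLpNorm']
      refine (h f (Lp.memLp f)).congr fun N => eLpNorm_congr_ae ?_
      filter_upwards [partialSumLp_ae hk p N f] with x hx
      rw [Pi.sub_apply, hx]
    obtain ⟨C, hC⟩ := hlim.norm.bddAbove_range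
    exact ⟨C, fun N => hC ⟨N, rfl⟩⟩
  refine ⟨C.toNNReal, fun N g hg => ?_⟩
  have h1 : partialSum k (hg.toLp g) N = partialSum k g N := by
    funext x
    simp only [partialSum, term, coeff_congr hg.coeFn_toLp]
  have h2 := (partialSumLp hk p N).le_of_opNorm_le (hC N) (hg.toLp g)
  rw [Lp.norm_def, Lp.norm_def, eLpNorm_congr_ae (partialSumLp_ae hk p N _), h1,
    eLpNorm_congr_ae hg.coeFn_toLp] at h2
  have h0 : 0 ≤ C := (norm_nonneg _).trans (hC 0)
  have hfin : eLpNorm (partialSum k g N) p (dm k) ≠ ∞ :=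
    (memLp_of_continuous hk p (continuous_partialSum hk g N)).eLpNorm_ne_top
  rw [← ENNReal.ofReal_toReal hfin, ← ENNReal.ofReal_toReal hg.eLpNorm_ne_top,
    show ((C.toNNReal : ℝ≥0) : ℝ≥0∞) = ENNReal.ofReal C from rfl, ← ENNReal.ofReal_mul h0]
  exact ENNReal.ofReal_le_ofReal h2

/-! ### The case k = 0: classical Fourier series at p = 1 and p = ∞ -/

theorem dm_zero : dm 0 = volume.restrict (Set.Icc (-Real.pi) Real.pi) := by
  simp [dm]

theorem E_zero (n : ℤ) : E 0 n = fun z => Complex.exp (n * z) := by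
  refine E_eq_of_isNonsymmetric le_rfl ⟨⟨0, fun z => by simp⟩, fun j hj => ?_⟩
  have hne : n - j ≠ 0 := by
    rintro h
    obtain rfl : n = j := by omega
    rcases hj with hj | hj
    · exact lt_irrefl _ hj.1
    · exact lt_irrefl _ hj.2
  have h := integral_exp_int (n - j)
  rw [if_neg hne] at h
  rw [innerK, dm_zero, ← h]
  congr 1
  funext x
  rw [conj_exp, exp_I, ← Complex.exp_add]
  congr 1
  push_cast
  ring

/-- The unnormalised Fourier pairing `∫ g(x) e^{imx} dx`. -/
noncomputable def fpair (g : ℝ → ℂ) (m : ℤ) : ℂ :=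
  ∫ x, g x * Complex.exp (Complex.I * (m * x)) ∂(dm 0)

theorem term_zero (g : ℝ → ℂ) (m : ℤ) (x : ℝ) :
    term 0 g m x = fpair g (-m) / (2 * Real.pi) * Complex.exp (Complex.I * (m * x)) := by
  have h1 : ∫ x : ℝ, ‖E 0 m (Complex.I * x)‖ ^ 2 ∂(dm 0) = 2 * Real.pi := by
    have : ∀ x : ℝ, ‖E 0 m (Complex.I * x)‖ ^ 2 = 1 := fun x => by
      rw [E_zero]
      beta_reduce
      rw [exp_I, mul_comm Complex.I, ← Complex.ofReal_intCast, ← Complex.ofReal_mul,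
        Complex.norm_exp_ofReal_mul_I, one_pow]
    simp_rw [this]
    rw [integral_dm]
    simp [two_mul]
  have h2 : (gam 0 m : ℂ) ^ 2 = (2 * Real.pi : ℂ)⁻¹ := by
    rw [← Complex.ofReal_pow, gam, h1, inv_pow, Real.sq_sqrt (by positivity)]
    push_cast
    rfl
  have h3 : ∫ x : ℝ, g x * E 0 m (-(Complex.I * x)) ∂(dm 0) = fpair g (-m) := by
    rw [fpair]
    congr 1
    funext x
    rw [E_zero]
    beta_reduce
    congr 2
    push_cast
    ring
  rw [term, coeff, h2, h3, E_zero]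
  beta_reduce
  rw [exp_I]
  ring

theorem integral_mul_partialSum_zero {f : ℝ → ℂ} (hf : Integrable f (dm 0)) (g : ℝ → ℂ) (N : ℕ) :
    ∫ x, f x * partialSum 0 g N x ∂(dm 0)
      = ∑ m ∈ Finset.Icc (-(N : ℤ)) (N : ℤ), fpair f m * fpair g (-m) / (2 * Real.pi) := by
  have h : ∀ x, f x * partialSum 0 g N x = ∑ m ∈ Finset.Icc (-(N : ℤ)) (N : ℤ),
      fpair g (-m) / (2 * Real.pi) * (f x * Complex.exp (Complex.I * (m * x))) := by
    intro x
    rw [partialSum, Finset.mul_sum]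
    refine Finset.sum_congr rfl fun m _ => ?_
    rw [term_zero]
    ring
  simp_rw [h]
  rw [integral_finsetSum _ fun m _ =>
    (integrable_mul_continuous hf (by fun_prop)).const_mul _]
  refine Finset.sum_congr rfl fun m _ => ?_
  rw [integral_const_mul, fpair, fpair]
  ring

/-- Symmetry of the Dirichlet kernel, seen as the reindexing m ↦ -m; it will transfer the growth on
bounded functions to L¹. -/
theorem integral_mul_partialSum_symm {f g : ℝ → ℂ} (hf : Integrable f (dm 0))
    (hg : Integrable g (dm 0)) (N : ℕ) :
    ∫ x, f x * partialSum 0 g N x ∂(dm 0) = ∫ x, g x * partialSum 0 f N x ∂(dm 0) := by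
  rw [integral_mul_partialSum_zero hf, integral_mul_partialSum_zero hg]
  refine Finset.sum_nbij' (fun m => -m) (fun m => -m) ?_ ?_ ?_ ?_ ?_
  · intro m hm; simp only [Finset.mem_Icc] at hm ⊢; omega
  · intro m hm; simp only [Finset.mem_Icc] at hm ⊢; omega
  · simp
  · simp
  · intro m _
    rw [neg_neg]
    ring

theorem exp_int_mul_neg_pi (j : ℤ) :
    Complex.exp (Complex.I * (j * ((-Real.pi : ℝ) : ℂ)))
      = Complex.exp (Complex.I * (j * (Real.pi : ℝ))) := by
  rw [Complex.exp_eq_exp_iff_exists_int]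
  exact ⟨-j, by push_cast; ring⟩

/-- The Fourier coefficients of the modulated sawtooth. -/
theorem integral_mul_exp_int {j : ℤ} (hj : j ≠ 0) :
    ∫ x in -Real.pi..Real.pi, (x : ℂ) * Complex.exp (Complex.I * (j * x))
      = 2 * Real.pi * Complex.exp (Complex.I * (j * (Real.pi : ℝ))) / (Complex.I * j) := by
  have hjc : (j : ℂ) ≠ 0 := by exact_mod_cast hj
  have hI := Complex.I_ne_zero
  have hd : ∀ x : ℝ, HasDerivAt (fun x : ℝ => (x : ℂ) * Complex.exp (Complex.I * (j * x))
      / (Complex.I * j) - Complex.exp (Complex.I * (j * x)) / (Complex.I * j) ^ 2)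
      ((x : ℂ) * Complex.exp (Complex.I * (j * x))) x := by
    intro x
    have h0 : HasDerivAt (fun x : ℝ => (x : ℂ)) 1 x := Complex.ofRealCLM.hasDerivAt
    have h1 : HasDerivAt (fun x : ℝ => Complex.exp (Complex.I * (j * x)))
        (Complex.exp (Complex.I * (j * x)) * (Complex.I * (j * 1))) x :=
      ((h0.const_mul (j : ℂ)).const_mul Complex.I).cexp
    refine (((h0.mul h1).div_const _).sub (h1.div_const _)).congr_deriv ?_
    field_simp
    ring
  rw [intervalIntegral.integral_eq_sub_of_hasDerivAt (fun x _ => hd x)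
    (Continuous.intervalIntegrable (by fun_prop) _ _), exp_int_mul_neg_pi]
  push_cast
  field_simp
  ring

/-- The modulated sawtooth `x e^{iNx}`. -/
noncomputable def saw (N : ℕ) (x : ℝ) : ℂ := x * Complex.exp (Complex.I * ((N : ℤ) * x))

theorem continuous_saw (N : ℕ) : Continuous (saw N) := by
  unfold saw; fun_prop

theorem fpair_saw (N : ℕ) {m : ℤ} (hm : (N : ℤ) - m ≠ 0) :
    fpair (saw N) (-m) = 2 * Real.pi *
      Complex.exp (Complex.I * (((N : ℤ) - m : ℤ) * (Real.pi : ℝ)))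
        / (Complex.I * ((N : ℤ) - m : ℤ)) := by
  rw [← integral_mul_exp_int hm, fpair, integral_dm]
  congr 1
  funext x
  simp only [saw, mul_zero, Real.rpow_zero, one_smul]
  rw [mul_assoc, ← Complex.exp_add]
  congr 2
  push_cast
  ring

theorem fpair_saw_self (N : ℕ) : fpair (saw N) (-(N : ℤ)) = 0 := by
  refine integral_dm_odd 0 fun x => ?_
  simp only [saw]
  rw [mul_assoc, mul_assoc, ← Complex.exp_add, ← Complex.exp_add]
  have h1 : ∀ y : ℂ,
      Complex.I * (((N : ℤ) : ℂ) * y) + Complex.I * (((-(N : ℤ) : ℤ) : ℂ) * y) = 0 := by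
    intro y; push_cast; ring
  rw [h1, h1]
  simp

/-- The modulation by e^{iNx} makes the symmetric sum of length 2N + 1 see only one side of the
sawtooth's spectrum. At π the remaining phases agree, so nothing cancels and a harmonic sum is left.
-/
theorem partialSum_saw_pi (N : ℕ) :
    partialSum 0 (saw N) N Real.pi = Complex.exp (Complex.I * ((N : ℤ) * (Real.pi : ℝ))) /
      Complex.I * ((∑ m ∈ Finset.Icc (-(N : ℤ)) (N : ℤ), (1 : ℝ) / ((N : ℤ) - m : ℤ) : ℝ) : ℂ) := by
  rw [partialSum, Complex.ofReal_sum, Finset.mul_sum]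
  refine Finset.sum_congr rfl fun m _ => ?_
  rw [term_zero]
  -- For m = N the coefficient is the integral of an odd function, hence 0, in agreement with 1/0 =
  -- 0.
  by_cases hm : (N : ℤ) - m = 0
  · obtain rfl : m = N := by omega
    rw [fpair_saw_self]
    simp
  · have hmc : (((N : ℤ) - m : ℤ) : ℂ) ≠ 0 := by exact_mod_cast hm
    have hI := Complex.I_ne_zero
    have hpi : (Real.pi : ℂ) ≠ 0 := by exact_mod_cast Real.pi_ne_zero
    have h1 : Complex.exp (Complex.I * ((N : ℤ) * (Real.pi : ℝ)))
        = Complex.exp (Complex.I * (((N : ℤ) - m : ℤ) * (Real.pi : ℝ)))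
          * Complex.exp (Complex.I * (m * (Real.pi : ℝ))) := by
      rw [← Complex.exp_add]; congr 1; push_cast; ring
    rw [fpair_saw N hm, h1, Complex.ofReal_div, Complex.ofReal_one, Complex.ofReal_intCast]
    field_simp

theorem sum_range_le_norm_partialSum_saw (N : ℕ) :
    ∑ i ∈ Finset.range (2 * N), (1 : ℝ) / (i + 1) ≤ ‖partialSum 0 (saw N) N Real.pi‖ := by
  have h0 : ∀ m ∈ Finset.Icc (-(N : ℤ)) (N : ℤ), (0 : ℝ) ≤ 1 / ((N : ℤ) - m : ℤ) := by
    intro m hm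
    rw [Finset.mem_Icc] at hm
    have : (0 : ℝ) ≤ ((N : ℤ) - m : ℤ) := by exact_mod_cast (by omega : 0 ≤ (N : ℤ) - m)
    positivity
  rw [partialSum_saw_pi, norm_mul, norm_div, Complex.norm_I, div_one, mul_comm Complex.I,
    ← Complex.ofReal_intCast, ← Complex.ofReal_mul, Complex.norm_exp_ofReal_mul_I, one_mul,
    Complex.norm_real, Real.norm_of_nonneg (Finset.sum_nonneg h0)]
  have hinj : Set.InjOn (fun i : ℕ => (N : ℤ) - (i + 1)) (Finset.range (2 * N)) := by
    intro i _ j _ hij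
    simp only at hij
    omega
  have h1 : ∑ i ∈ Finset.range (2 * N), (1 : ℝ) / (i + 1)
      = ∑ m ∈ (Finset.range (2 * N)).image (fun i : ℕ => (N : ℤ) - (i + 1)),
        (1 : ℝ) / ((N : ℤ) - m : ℤ) := by
    rw [Finset.sum_image hinj]
    refine Finset.sum_congr rfl fun i _ => ?_
    rw [sub_sub_cancel]
    push_cast
    rfl
  rw [h1]
  refine Finset.sum_le_sum_of_subset_of_nonneg ?_ fun m hm _ => h0 m hm
  intro m hm
  simp only [Finset.mem_image, Finset.mem_range, Finset.mem_Icc] at hm ⊢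
  omega

theorem norm_le_of_forall_integral_le {F : ℝ → ℂ} (hF : Continuous F) {b K : ℝ}
    (h : ∀ ε : ℝ, 0 < ε → ε ≤ 1 → ‖∫ x in (b - ε)..b, F x‖ ≤ K * ε) : ‖F b‖ ≤ K := by
  refine le_of_forall_pos_le_add fun η hη => ?_
  obtain ⟨δ, hδ, hball⟩ := Metric.continuousAt_iff.mp hF.continuousAt η hη
  set ε := min (δ / 2) 1 with hε
  have hε0 : 0 < ε := by positivity
  have h1 : ‖∫ x in (b - ε)..b, (F b - F x)‖ ≤ η * |b - (b - ε)| := by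
    refine intervalIntegral.norm_integral_le_of_norm_le_const fun x hx => ?_
    rw [Set.uIoc_of_le (by linarith)] at hx
    have hd : dist x b < δ := by
      rw [Real.dist_eq, abs_sub_comm, abs_of_nonneg (by linarith [hx.2])]
      linarith [hx.1, min_le_left (δ / 2) 1]
    have := (hball hd).le
    rwa [dist_comm, dist_eq_norm] at this
  have h2 := h ε hε0 (min_le_right _ _)
  rw [intervalIntegral.integral_sub (by simp) (hF.intervalIntegrable _ _),
    intervalIntegral.integral_const] at h1
  have h3 : ‖(b - (b - ε)) • F b‖ = ε * ‖F b‖ := by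
    rw [norm_smul, sub_sub_cancel, Real.norm_of_nonneg hε0.le]
  have h4 := norm_sub_norm_le ((b - (b - ε)) • F b) (∫ x in (b - ε)..b, F x)
  rw [h3, sub_sub_cancel] at h4
  rw [sub_sub_cancel, abs_of_pos hε0] at h1
  have h5 : ε * ‖F b‖ ≤ ε * (K + η) := by nlinarith
  exact le_of_mul_le_mul_left h5 hε0

theorem ae_norm_saw_le (N : ℕ) : ∀ᵐ x ∂(dm 0), ‖saw N x‖ ≤ Real.pi := by
  rw [dm_zero]
  filter_upwards [ae_restrict_mem measurableSet_Icc] with x hx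
  rw [saw, mul_comm Complex.I, ← Complex.ofReal_intCast, ← Complex.ofReal_mul, norm_mul,
    Complex.norm_exp_ofReal_mul_I, mul_one, Complex.norm_real]
  exact abs_le.mpr hx

/-- The hypothesis concerns averages to the left of π because L^p bounds do not see the value at one
point; continuity recovers that value, which is at least a partial sum of the harmonic series. -/
theorem not_bounded_of_saw {C : ℝ}
    (h : ∀ (N : ℕ) (ε : ℝ), 0 < ε → ε ≤ 1 →
      ‖∫ x in (Real.pi - ε)..Real.pi, partialSum 0 (saw N) N x‖ ≤ C * ε) : False := by
  have h1 : ∀ N : ℕ, ∑ i ∈ Finset.range (2 * N), (1 : ℝ) / (i + 1) ≤ C := fun N =>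
    (sum_range_le_norm_partialSum_saw N).trans
      (norm_le_of_forall_integral_le (continuous_partialSum le_rfl _ _) (h N))
  have h2 := Real.tendsto_sum_range_one_div_nat_succ_atTop.comp
    (tendsto_id.const_mul_atTop' (two_pos : 0 < 2))
  obtain ⟨N, hN⟩ := (h2.eventually_gt_atTop C).exists
  exact absurd (h1 N) (not_le.mpr hN)

theorem interval_integral_eq_dm_zero {ε : ℝ} (hε : 0 < ε) (hε1 : ε ≤ 1) (F : ℝ → ℂ) :
    ∫ x in (Real.pi - ε)..Real.pi, F x
      = ∫ x, (Set.Ioc (Real.pi - ε) Real.pi).indicator (fun _ => (1 : ℂ)) x * F x ∂(dm 0) := by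
  have h1 : ∀ x, (Set.Ioc (Real.pi - ε) Real.pi).indicator (fun _ => (1 : ℂ)) x * F x
      = (Set.Ioc (Real.pi - ε) Real.pi).indicator F x := fun x => by
    by_cases hx : x ∈ Set.Ioc (Real.pi - ε) Real.pi <;> simp [hx]
  have hsub : Set.Ioc (Real.pi - ε) Real.pi ∩ Set.Icc (-Real.pi) Real.pi
      = Set.Ioc (Real.pi - ε) Real.pi :=
    Set.inter_eq_left.mpr fun x hx => ⟨by linarith [hx.1, Real.pi_gt_three], hx.2⟩
  simp_rw [h1]
  rw [dm_zero, integral_indicator measurableSet_Ioc, Measure.restrict_restrict measurableSet_Ioc,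
    hsub, intervalIntegral.integral_of_le (by linarith)]

theorem not_bounded_zero_top :
    ¬ ∃ C : ℝ≥0, ∀ (N : ℕ) (g : ℝ → ℂ), MemLp g ∞ (dm 0) →
      eLpNorm (partialSum 0 g N) ∞ (dm 0) ≤ C * eLpNorm g ∞ (dm 0) := by
  rintro ⟨C, hC⟩
  refine not_bounded_of_saw (C := C * Real.pi) fun N ε hε hε1 => ?_
  have h1 := hC N (saw N) (memLp_of_continuous le_rfl _ (continuous_saw N))
  have h2 : eLpNorm (saw N) ∞ (dm 0) ≤ ENNReal.ofReal Real.pi := by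
    rw [eLpNorm_exponent_top]
    exact eLpNormEssSup_le_of_ae_bound (ae_norm_saw_le N)
  have h3 : eLpNorm (partialSum 0 (saw N) N) ∞ (dm 0) ≤ ENNReal.ofReal (C * Real.pi) := by
    refine h1.trans ?_
    rw [ENNReal.ofReal_mul C.coe_nonneg, ENNReal.ofReal_coe_nnreal]
    gcongr
  rw [eLpNorm_exponent_top] at h3
  have h4 : ∀ᵐ x ∂(dm 0), ‖partialSum 0 (saw N) N x‖ ≤ C * Real.pi := by
    filter_upwards [enorm_ae_le_eLpNormEssSup (partialSum 0 (saw N) N) (dm 0)] with x hx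
    have h5 := hx.trans h3
    rw [← ofReal_norm] at h5
    exact (ENNReal.ofReal_le_ofReal_iff (by positivity)).mp h5
  rw [dm_zero, ae_restrict_iff' measurableSet_Icc] at h4
  have h5 := intervalIntegral.norm_integral_le_of_norm_le_const_ae (a := Real.pi - ε)
    (b := Real.pi) (C := C * Real.pi) (f := partialSum 0 (saw N) N) (by
      filter_upwards [h4] with x hx hx'
      rw [Set.uIoc_of_le (by linarith)] at hx'
      exact hx ⟨by linarith [hx'.1, Real.pi_gt_three], hx'.2⟩)
  rwa [sub_sub_cancel, abs_of_pos hε] at h5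

/-- By symmetry, the average of S_N of the sawtooth near π is the pairing of the sawtooth, bounded
by π, with S_N of the indicator of (π - ε, π], whose L¹ norm is at most ε. -/
theorem not_bounded_zero_one :
    ¬ ∃ C : ℝ≥0, ∀ (N : ℕ) (g : ℝ → ℂ), MemLp g 1 (dm 0) →
      eLpNorm (partialSum 0 g N) 1 (dm 0) ≤ C * eLpNorm g 1 (dm 0) := by
  rintro ⟨C, hC⟩
  have := isFiniteMeasure_dm (le_refl (0 : ℝ))
  refine not_bounded_of_saw (C := C * Real.pi) fun N ε hε hε1 => ?_
  set φ : ℝ → ℂ := (Set.Ioc (Real.pi - ε) Real.pi).indicator (fun _ => (1 : ℂ)) with hφ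
  have hφi : Integrable φ (dm 0) := (integrable_const 1).indicator measurableSet_Ioc
  have hcont := continuous_partialSum le_rfl φ N
  have hpi := integrable_dm le_rfl hcont
  have h1 := hC N φ (memLp_one_iff_integrable.mpr hφi)
  have h2 : eLpNorm φ 1 (dm 0) ≤ ENNReal.ofReal ε := by
    rw [hφ, eLpNorm_indicator_const measurableSet_Ioc one_ne_zero ENNReal.one_ne_top]
    simp only [enorm_one, one_mul, ENNReal.toReal_one, div_one, ENNReal.rpow_one]
    rw [dm_zero]
    refine (Measure.restrict_apply_le _ _).trans ?_
    rw [Real.volume_Ioc, sub_sub_cancel]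
  have h3 : ∫ x, ‖partialSum 0 φ N x‖ ∂(dm 0) ≤ C * ε := by
    have h4 : eLpNorm (partialSum 0 φ N) 1 (dm 0) ≤ ENNReal.ofReal (C * ε) := by
      refine h1.trans ?_
      rw [ENNReal.ofReal_mul C.coe_nonneg, ENNReal.ofReal_coe_nnreal]
      gcongr
    rw [eLpNorm_one_eq_lintegral_enorm, ← ofReal_integral_norm_eq_lintegral_enorm hpi] at h4
    exact (ENNReal.ofReal_le_ofReal_iff (by positivity)).mp h4
  rw [interval_integral_eq_dm_zero hε hε1, integral_mul_partialSum_symm hφi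
    (integrable_dm le_rfl (continuous_saw N))]
  calc ‖∫ x, saw N x * partialSum 0 φ N x ∂(dm 0)‖
      ≤ ∫ x, Real.pi * ‖partialSum 0 φ N x‖ ∂(dm 0) := by
        refine norm_integral_le_of_norm_le (hpi.norm.const_mul _) ?_
        filter_upwards [ae_norm_saw_le N] with x hx
        rw [norm_mul]
        exact mul_le_mul_of_nonneg_right hx (norm_nonneg _)
    _ = Real.pi * ∫ x, ‖partialSum 0 φ N x‖ ∂(dm 0) := integral_const_mul _ _
    _ ≤ Real.pi * (C * ε) := by gcongr
    _ = _ := by ring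

/-! ### Conclusion -/

theorem not_bounded {k : ℝ} (hk : 0 ≤ k) {p : ℝ≥0∞} (hp1 : 1 ≤ p)
    (hp : ¬ (2 - 1 / (ENNReal.ofReal k + 1) < p ∧ p < 2 + 1 / ENNReal.ofReal k)) :
    ¬ ∃ C : ℝ≥0, ∀ (N : ℕ) (g : ℝ → ℂ), MemLp g p (dm k) →
      eLpNorm (partialSum k g N) p (dm k) ≤ C * eLpNorm g p (dm k) := by
  rw [not_and_or, not_lt, not_lt] at hp
  rcases hk.eq_or_lt with rfl | hk0
  · rcases hp with hp | hp
    · rw [two_sub_eq le_rfl] at hp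
      norm_num at hp
      obtain rfl := le_antisymm hp hp1
      exact not_bounded_zero_one
    -- Here 1/0 = ∞, so the upper range of p reduces to p = ∞.
    · simp only [ENNReal.ofReal_zero, ENNReal.div_zero (one_ne_zero), add_top, top_le_iff] at hp
      subst hp
      exact not_bounded_zero_top
  · rcases hp with hp | hp
    · exact not_bounded_of_le hk0 hp1 (by rwa [two_sub_eq hk] at hp)
    · exact not_bounded_of_ge hk0 hp1 (by rwa [two_add_eq hk0] at hp)

end HeckmanOpdam

theorem mainTheorem2 (k : ℝ) (hk : 0 ≤ k) (p : ℝ≥0∞) (hp1 : 1 ≤ p)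
    (hp : ¬ (2 - 1 / (ENNReal.ofReal k + 1) < p ∧ p < 2 + 1 / ENNReal.ofReal k)) :
    -- norm convergence fails in `L^p(dm_k)`
    (∃ g : ℝ → ℂ, MemLp g p (HeckmanOpdam.dm k) ∧
      ¬ Tendsto (fun N : ℕ =>
          eLpNorm (fun x => HeckmanOpdam.partialSum k g N x - g x) p (HeckmanOpdam.dm k))
        atTop (𝓝 0)) ∧
    -- the partial sum operators are not uniformly bounded on `L^p(dm_k)`
    (¬ ∃ C : ℝ≥0, ∀ (N : ℕ) (g : ℝ → ℂ), MemLp g p (HeckmanOpdam.dm k) →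
      eLpNorm (HeckmanOpdam.partialSum k g N) p (HeckmanOpdam.dm k)
        ≤ C * eLpNorm g p (HeckmanOpdam.dm k)) ∧
    -- the explicit function `f(x) = (1 - cos x)^{-(k+1)/2}`
    (0 < k →
      (∀ n : ℤ, Integrable
        (fun x : ℝ => HeckmanOpdam.cex k x * HeckmanOpdam.E k n (-(Complex.I * x)))
        (HeckmanOpdam.dm k)) ∧
      (MemLp (HeckmanOpdam.cex k) p (HeckmanOpdam.dm k) ↔
        p < 2 - 1 / (ENNReal.ofReal k + 1)) ∧
      (∃ A : ℝ, 0 < A ∧ ∀ n : ℕ, 1 ≤ n → ENNReal.ofReal A ≤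
        eLpNorm (fun x => HeckmanOpdam.term k (HeckmanOpdam.cex k) n x
          + HeckmanOpdam.term k (HeckmanOpdam.cex k) (-n) x) p (HeckmanOpdam.dm k)) ∧
      (¬ Tendsto (fun n : ℕ =>
        eLpNorm (fun x => HeckmanOpdam.term k (HeckmanOpdam.cex k) n x
          + HeckmanOpdam.term k (HeckmanOpdam.cex k) (-n) x) p (HeckmanOpdam.dm k))
        atTop (𝓝 0)) ∧
      (p < 2 - 1 / (ENNReal.ofReal k + 1) →
        ¬ Tendsto (fun N : ℕ => eLpNorm (fun x =>
            HeckmanOpdam.partialSum k (HeckmanOpdam.cex k) N x - HeckmanOpdam.cex k x)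
            p (HeckmanOpdam.dm k))
          atTop (𝓝 0))) := by
  have hnb := HeckmanOpdam.not_bounded hk hp1 hp
  refine ⟨?_, hnb, fun hk0 => ?_⟩
  · by_contra! h
    exact hnb (HeckmanOpdam.exists_bound_of_forall_tendsto hk hp1 h)
  · obtain ⟨A, hA, hAle⟩ := HeckmanOpdam.exists_le_eLpNorm_term_cex hk0 hp1
    refine ⟨fun n => ?_, HeckmanOpdam.memLp_cex_iff hk0 hp1, ⟨A, hA, hAle⟩,
      HeckmanOpdam.not_tendsto_of_le hA hAle, fun hlt hconv => ?_⟩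
    · exact HeckmanOpdam.integrable_mul_continuous (HeckmanOpdam.integrable_cexR hk0).ofReal
        ((HeckmanOpdam.continuous_E hk n).comp (by fun_prop))
    · have h := HeckmanOpdam.tendsto_term_of_tendsto_partialSum hk hp1
        ((HeckmanOpdam.memLp_cex_iff hk0 hp1).mpr hlt) hconv
      exact HeckmanOpdam.not_tendsto_of_le hA (fun n _ => hAle (n + 1) (by omega)) h
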